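/- Write $L^2_\sigma=\{v\in L^2(\mathbb R^3;\mathbb R^3):\nabla\cdot v=0\text{ in the sense of distributions}\}$ and, for $s\ge 0$, $H^s_\sigma=\{v\in L^2_\sigma:\|v\|_{H^s}^2=\int_{\mathbb R^3}(1+|\xi|^2)^s|\hat v(\xi)|^2\,d\xi<\infty\}$. For $\nu\ge 0$ and $u_0\in L^2_\sigma$, a solution on $[0,\infty)\times\mathbb R^3$ of $$\partial_t u+(u\cdot\nabla)u-\nu\Delta u+\nabla p=0,\qquad \nabla\cdot u=0,\qquad u(\cdot,0)=u_0,$$ is understood in the weak sense: $u(t)\in L^2_\sigma$ for a.e. $t>0$ and $$\int_0^\infty\!\!\int_{\mathbb R^3}\big[u\cdot(\partial_t\varphi+\nu\Delta\varphi)+u\otimes u:\nabla\varphi\big]\,dx\,dt=-\int_{\mathbb R^3}u_0\cdot\varphi(\cdot,0)\,dx$$ for all $\varphi\in C_c^\infty([0,\infty)\times\mathbb R^3;\mathbb R^3)$ with $\nabla\cdot\varphi=0$. For $\nu=0$ this is a solution of the Euler equations. For $\nu>0$ let $\mathcal N_\nu(u_0)$ be the set of Leray–Hopf solutions, that is, of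 the weakly continuous solutions $u\in C_w([0,\infty);L^2_\sigma)\cap L^\infty(0,\infty;L^2_\sigma)\cap L^2(0,\infty;\dot H^1)$ with $u(0)=u_0$ such that $\frac12\|u(t)\|_{L^2}^2+\nu\int_0^t\|\nabla u(\tau)\|_{L^2}^2\,d\tau\le\frac12\|u_0\|_{L^2}^2$ for every $t>0$. Let $s>5/2$, and suppose that for every $u_0\in H^s_\sigma$ there exists a solution $u\in L^\infty_{\mathrm{loc}}([0,\infty);H^s_\sigma)$ of the Euler equations with datum $u_0$. Then, for a Baire generic $u_0\in L^2_\sigma$ (that is, for all $u_0$ in a residual subset of $L^2_\sigma$), the following hold: 1. for every $T>0$, $$\liminf_{\nu\to0}\ \sup_{u^\nu\in\mathcal N_\nu(u_0)}\int_0^T\big(\|u_0\|_{L^2}^2-\|u^\nu(t)\|_{L^2}^2\big)\,dt=0;$$ 2. for every $t>0$, $$\liminf_{\nu\to0}\ \sup_{u^\nu\in\mathcal N_\nu(u_0)}\nu\int_0^t\|\nabla u^\nu(\tau)\|_{L^2}^2\,d\tau=0;$$ 3. there exists a solution $u\in C_w([0,\infty);L^2_\sigma)$ of the Euler equations with datum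 $u_0$ such that $\|u(t)\|_{L^2}=\|u_0\|_{L^2}$ for a.e. $t>0$ and $$\liminf_{\nu\to0}\ \sup_{u^\nu\in\mathcal N_\nu(u_0)}\|u^\nu-u\|_{L^2(0,T;L^2)}=0\qquad\text{for all }T>0.$$ -/

import Mathlib

open MeasureTheory Set Filter Topology
open scoped ContDiff ENNReal NNReal RealInnerProductSpace

noncomputable section

namespace Fluid

/-- Three-dimensional Euclidean space. -/
abbrev E3 : Type := EuclideanSpace ℝ (Fin 3)

/-- The space `L²(ℝ³; ℝ³)`. -/
abbrev L2 : Type := Lp E3 2 (volume : Measure E3)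

/-- The divergence of a vector field on `ℝ³`. -/
def divergence (f : E3 → E3) (x : E3) : ℝ :=
  ∑ i : Fin 3, (fderiv ℝ f x (EuclideanSpace.single i 1)) i

theorem integrable_fderiv_apply (v : L2) {ψ : E3 → ℝ} (hψ : ContDiff ℝ ∞ ψ)
    (hc : HasCompactSupport ψ) : Integrable (fun x => fderiv ℝ ψ x (v x)) volume := by
  have hcont : Continuous (fderiv ℝ ψ) := hψ.continuous_fderiv (by simp)
  have hL : MemLp (fderiv ℝ ψ) 2 (volume : Measure E3) :=
    hcont.memLp_of_hasCompactSupport (hc.fderiv ℝ)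
  have h := hL.norm.integrable_mul (Lp.memLp v).norm
  refine Integrable.mono' h ?_ ?_
  · exact (isBoundedBilinearMap_apply (𝕜 := ℝ) (E := E3) (F := ℝ)).continuous.comp_aestronglyMeasurable
      (hL.1.prodMk (Lp.memLp v).1)
  · exact Eventually.of_forall fun x => (fderiv ℝ ψ x).le_opNorm (v x)

/-- `L²_σ`: the subspace of `L²(ℝ³; ℝ³)` of the fields `v` with `∇ · v = 0` in the sense of
distributions. -/
def L2sigma : Submodule ℝ L2 where
  carrier := {v | ∀ ψ : E3 → ℝ, ContDiff ℝ ∞ ψ → HasCompactSupport ψ →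
    ∫ x, fderiv ℝ ψ x (v x) = 0}
  add_mem' := by
    intro a b ha hb ψ hψ hc
    have h : (fun x => fderiv ℝ ψ x ((a + b : L2) x)) =ᵐ[volume]
        fun x => fderiv ℝ ψ x (a x) + fderiv ℝ ψ x (b x) := by
      filter_upwards [Lp.coeFn_add a b] with x hx
      simp only [hx, Pi.add_apply, map_add]
    rw [integral_congr_ae h, integral_add (integrable_fderiv_apply a hψ hc)
      (integrable_fderiv_apply b hψ hc), ha ψ hψ hc, hb ψ hψ hc, add_zero]
  zero_mem' := by
    intro ψ _ _
    have h : (fun x => fderiv ℝ ψ x ((0 : L2) x)) =ᵐ[volume] fun _ => (0 : ℝ) := by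
      filter_upwards [Lp.coeFn_zero E3 2 (volume : Measure E3)] with x hx
      simp only [hx, Pi.zero_apply, map_zero]
    rw [integral_congr_ae h, integral_zero]
  smul_mem' := by
    intro c a ha ψ hψ hc
    have h : (fun x => fderiv ℝ ψ x ((c • a : L2) x)) =ᵐ[volume]
        fun x => c * fderiv ℝ ψ x (a x) := by
      filter_upwards [Lp.coeFn_smul c a] with x hx
      simp only [hx, Pi.smul_apply, map_smul, smul_eq_mul]
    rw [integral_congr_ae h, integral_const_mul, ha ψ hψ hc, mul_zero]

/-- `w` is the weak partial derivative `∂_j v` of `v ∈ L²(ℝ³; ℝ³)`. -/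
def IsWeakPartial (j : Fin 3) (v w : L2) : Prop :=
  ∀ ψ : E3 → ℝ, ContDiff ℝ ∞ ψ → HasCompactSupport ψ →
    ∫ x, (fderiv ℝ ψ x (EuclideanSpace.single j 1)) • v x = -∫ x, ψ x • w x

/-- `‖∇v‖²_{L²} = ∑_j ‖∂_j v‖²_{L²}`, which is `∞` if a weak partial derivative is not in `L²`.
Weak partial derivatives are unique, so the infimum is over at most one element. -/
def gradSq (v : L2) : ℝ≥0∞ :=
  ∑ j : Fin 3, ⨅ w : L2, ⨅ _ : IsWeakPartial j v w, ‖w‖ₑ ^ 2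

/-- The `i`-th component of `v ∈ L²(ℝ³; ℝ³)`, as an element of `L²(ℝ³; ℂ)`. -/
def component (i : Fin 3) (v : L2) : Lp ℂ 2 (volume : Measure E3) :=
  (Complex.ofRealCLM.comp (EuclideanSpace.proj i : E3 →L[ℝ] ℝ)).compLp v

/-- The squared Sobolev norm `‖v‖²_{H^s} = ∫ (1 + |ξ|²)^s |𝓕v(ξ)|² dξ ∈ [0, ∞]`, where `𝓕` is the
Fourier–Plancherel transform on `L²`. -/
def sobolevSq (s : ℝ) (v : L2) : ℝ≥0∞ :=
  ∑ i : Fin 3, ∫⁻ ξ : E3, ENNReal.ofReal ((1 + ‖ξ‖ ^ 2) ^ s) *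
    ‖(FourierTransform.fourier (component i v) : Lp ℂ 2 (volume : Measure E3)) ξ‖ₑ ^ 2

/-- The weak (divergence-free, distributional) form on `[0, ∞) × ℝ³` of
`∂ₜu + (u · ∇)u - ν Δu + ∇p = 0`, `∇ · u = 0`, `u(0) = u₀`. For `ν = 0` these are the Euler
equations. Here `⟪u, (Dφ) u⟫ = u ⊗ u : ∇φ`. -/
def WeakForm (ν : ℝ) (u₀ : L2sigma) (u : ℝ → L2sigma) : Prop :=
  ∀ φ : ℝ → E3 → E3, ContDiff ℝ ∞ (Function.uncurry φ) →
    HasCompactSupport (Function.uncurry φ) →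
    (∀ t, 0 ≤ t → ∀ x, divergence (φ t) x = 0) →
    ∫ t in Ioi (0 : ℝ), ∫ x,
      (⟪(u t : L2) x, deriv (fun τ => φ τ x) t + ν • Laplacian.laplacian (φ t) x⟫ +
        ⟪(u t : L2) x, fderiv ℝ (φ t) x ((u t : L2) x)⟫)
      = -∫ x, ⟪(u₀ : L2) x, φ 0 x⟫

/-- `u ∈ C_w([0, ∞); L²_σ)`. -/
def WeaklyContinuous (u : ℝ → L2sigma) : Prop :=
  ∀ w : L2sigma, ContinuousOn (fun t => ⟪w, u t⟫) (Ici 0)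

/-- Weak solutions of the Navier–Stokes equations with viscosity `ν` and datum `u₀` on
`[0, ∞) × ℝ³`, in the weakly continuous representative. The values of `u` at negative
times play no role. -/
structure IsWeakSolution (ν : ℝ) (u₀ : L2sigma) (u : ℝ → L2sigma) : Prop where
  weaklyContinuous : WeaklyContinuous u
  initial : u 0 = u₀
  bounded : ∃ C : ℝ, ∀ t, 0 ≤ t → ‖u t‖ ≤ C
  gradient : ∫⁻ t in Ioi (0 : ℝ), gradSq (u t) < ⊤
  weakForm : WeakForm ν u₀ u

/-- `𝓝_ν(u₀)`: the Leray–Hopf solutions with viscosity `ν` and datum `u₀`, i.e. the weak solutions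
that satisfy the energy inequality at every positive time. -/
def lerayHopf (ν : ℝ) (u₀ : L2sigma) : Set (ℝ → L2sigma) :=
  {u | IsWeakSolution ν u₀ u ∧ ∀ t, 0 < t →
    2⁻¹ * ‖u t‖ₑ ^ 2 + ENNReal.ofReal ν * ∫⁻ τ in Ioo 0 t, gradSq (u τ) ≤ 2⁻¹ * ‖u₀‖ₑ ^ 2}

/-- Solutions `u ∈ L^∞_loc([0, ∞); H^s_σ)` of the Euler equations with datum `u₀`. -/
structure IsSobolevEulerSolution (s : ℝ) (u₀ : L2sigma) (u : ℝ → L2sigma) : Prop where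
  measurable : AEStronglyMeasurable u (volume.restrict (Ioi 0))
  bounded : ∀ T : ℝ, 0 < T → ∃ C : ℝ≥0, ∀ᵐ t ∂volume.restrict (Ioo 0 T),
    sobolevSq s (u t) ≤ C
  weakForm : WeakForm 0 u₀ u

/-- Solutions `u ∈ C_w([0, ∞); L²_σ)` of the Euler equations with datum `u₀`. -/
structure IsWeakEulerSolution (u₀ : L2sigma) (u : ℝ → L2sigma) : Prop where
  weaklyContinuous : WeaklyContinuous u
  initial : u 0 = u₀
  weakForm : WeakForm 0 u₀ u

/-- Absence of anomalous dissipation for the datum `u₀`. All quantities are nonnegative (by the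
energy inequality), so suprema and lower limits are taken in `[0, ∞]`. -/
def NoAnomalousDissipation (u₀ : L2sigma) : Prop :=
  (∀ T : ℝ, 0 < T →
    liminf (fun ν : ℝ => ⨆ v ∈ lerayHopf ν u₀,
      ∫⁻ t in Ioo 0 T, ENNReal.ofReal (‖u₀‖ ^ 2 - ‖v t‖ ^ 2)) (𝓝[>] 0) = 0) ∧
  (∀ t : ℝ, 0 < t →
    liminf (fun ν : ℝ => ⨆ v ∈ lerayHopf ν u₀,
      ENNReal.ofReal ν * ∫⁻ τ in Ioo 0 t, gradSq (v τ)) (𝓝[>] 0) = 0) ∧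
  ∃ u : ℝ → L2sigma, IsWeakEulerSolution u₀ u ∧
    (∀ᵐ t ∂volume.restrict (Ioi (0 : ℝ)), ‖u t‖ = ‖u₀‖) ∧
    ∀ T : ℝ, 0 < T →
      liminf (fun ν : ℝ => ⨆ v ∈ lerayHopf ν u₀,
        eLpNorm (fun t => v t - u t) 2 (volume.restrict (Ioo 0 T))) (𝓝[>] 0) = 0

end Fluid

end

/-!
# Absence of anomalous dissipation for generic data

The mechanism is weak–strong stability. Let `W` be a solution of the Euler equations with datum `w₀`
that is bounded in `H^s`, `s > 5/2`, on `[0, T]`. Then `‖∇W‖_{L^∞} ≤ L` and `‖ΔW‖_{L²} ≤ K` there,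
and the relative energy inequality, followed by Gronwall's inequality, gives
`‖u - W‖² ≤ 2 (‖u₀ - w₀‖² + 2 ν K T ‖u₀‖) e^(4LT)` on `[0, T]` for *every* weakly continuous weak
solution `u` with viscosity `ν ≥ 0` and datum `u₀` whose energy never exceeds the initial one
(`Fluid.EulerFlow.norm_sq_sub_le`). These are both the Leray–Hopf solutions and, for `ν = 0`, the
Sobolev solutions of the Euler equations.

So each Sobolev datum `w₀` has, for every scale `m`, a ball around it such that all such solutions
with data in the ball and with small viscosity stay `1 / (m + 1)`-close to `W` on `[0, m + 1]`. The
radius depends on `W`, but as Sobolev data are dense (`Fluid.dense_sobolev`),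
  the union of these balls
is open and dense, and the data that lie in the unions for all `m` are residual
(`Fluid.IsGeneric`, `Fluid.eventually_isGeneric`). For a generic datum `u₀` the flows `W m` at the
scales `m` form a Cauchy sequence, locally uniformly in time. The limit solves the Euler equations
(`Fluid.WeakForm.of_tendsto`), conserves the energy since the `W m` do, and is the locally uniform
limit of all Leray–Hopf solutions with datum `u₀` as `ν → 0` (`Fluid.IsGeneric.exists_limit`). Hence
the energies of the latter converge to `‖u₀‖²`,
  which by the energy inequality bounds the dissipation.

The rigorous form of the relative energy inequality needs `W` as a test field in the weak form for
  `u`.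
Fields are localised to frequencies in an annulus by `Fluid.mollify`. The localisation of a
divergence-free field is smooth and the curl of a vector potential (`Fluid.curl_potential`), so that
cutting off the potential gives admissible test fields that converge to it
  (`Fluid.exists_testFields`).
With these, the weak form becomes an evolution equation in integral form for the localisation of `u`
(`Fluid.WeakForm.ae_smooth_eq`). For Sobolev solutions of the Euler equations the cutoff can be
removed, which yields a strong representative (`Fluid.IsSobolevEulerSolution.exists_eulerFlow`). The
product rule (`Fluid.LocBdd.integral_bilin`) then applies to the scalar product of `W` and the
localisation of `u`, and as the cutoff is removed the cubic terms combine to a term quadratic in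
`u - W` (`Fluid.Regular.inner_matMul_add_advect`).
-/

noncomputable section

namespace Fluid
open FourierTransform Complex

/-! ### Inverse Fourier transforms of band-limited symbols -/

/-- The `L²` inverse Fourier transform is the inverse Fourier integral on `L¹ ∩ L²`: both represent
the same tempered distribution. -/
theorem coeFn_fourierInv_toLp {g : E3 → ℂ} (h1 : Integrable g) (h2 : MemLp g 2 volume) :
    ((𝓕⁻ (h2.toLp g) : Lp ℂ 2 (volume : Measure E3)) : E3 → ℂ) =ᵐ[volume] 𝓕⁻ g := by
  have hcont : Continuous (𝓕⁻ g) := by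
    rw [Real.fourierInv_eq_fourier_comp_neg]
    exact VectorFourier.fourierIntegral_continuous Real.continuous_fourierChar
      (by exact continuous_inner) h1.comp_neg
  refine ae_eq_of_integral_contDiff_smul_eq ((Lp.memLp _).locallyIntegrable (by norm_num))
    hcont.locallyIntegrable ?_
  intro ψ hψ hc
  have hg₁ : HasCompactSupport (Complex.ofRealCLM ∘ ψ) := hc.comp_left rfl
  have hg₂ : ContDiff ℝ ∞ (Complex.ofRealCLM ∘ ψ) := by fun_prop
  set S : SchwartzMap E3 ℂ := hg₁.toSchwartzMap hg₂ with hS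
  have e1 : ∫ x, ψ x • ((𝓕⁻ (h2.toLp g) : Lp ℂ 2 (volume : Measure E3)) : E3 → ℂ) x =
      Lp.toTemperedDistribution (𝓕⁻ (h2.toLp g) : Lp ℂ 2 (volume : Measure E3)) S := by
    simp [hS]
  rw [e1, ← Lp.fourierInv_toTemperedDistribution_eq, TemperedDistribution.fourierInv_apply,
    Lp.toTemperedDistribution_apply]
  have e2 : ∫ x, (𝓕⁻ S) x • (h2.toLp g : E3 → ℂ) x = ∫ x, (𝓕⁻ S) x • g x := by
    apply integral_congr_ae
    filter_upwards [h2.coeFn_toLp] with x hx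
    rw [hx]
  rw [e2]
  have h3 := VectorFourier.integral_fourierIntegral_smul_eq_flip (μ := (volume : Measure E3))
    (ν := (volume : Measure E3)) (L := -innerₗ E3) (f := S) (g := g) Real.continuous_fourierChar
    (by exact (continuous_inner (𝕜 := ℝ) (E := E3)).neg) S.integrable h1
  have h4 : ((-innerₗ E3).flip) = -innerₗ E3 := by
    ext x y; simp [real_inner_comm]
  rw [h4] at h3
  rw [SchwartzMap.fourierInv_coe]
  exact h3

/-- The real part of the inverse Fourier integral. -/
def reInv (g : E3 → ℂ) (x : E3) : ℝ := (𝓕⁻ g x).re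

theorem reInv_congr_ae {g h : E3 → ℂ} (hgh : g =ᵐ[volume] h) : reInv g = reInv h := by
  ext x
  simp only [reInv]
  rw [Real.fourierInv_congr_ae hgh]

theorem abs_reInv_le (g : E3 → ℂ) (x : E3) : |reInv g x| ≤ ∫ ξ, ‖g ξ‖ := by
  refine (Complex.abs_re_le_norm _).trans ?_
  rw [Real.fourierInv_eq]
  refine (norm_integral_le_integral_norm _).trans_eq ?_
  simp

theorem integrable_fourierChar_smul {F : Type*} [NormedAddCommGroup F] [NormedSpace ℂ F]
    {g : E3 → F} (hg : Integrable g) (x : E3) :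
    Integrable (fun ξ => Real.fourierChar ⟪ξ, x⟫ • g ξ) := by
  simpa using (Real.fourierIntegral_convergent_iff (-x)).2 hg

theorem reInv_add {g h : E3 → ℂ} (hg : Integrable g) (hh : Integrable h) (x : E3) :
    reInv (fun ξ => g ξ + h ξ) x = reInv g x + reInv h x := by
  simp only [reInv, Real.fourierInv_eq, smul_add]
  rw [integral_add (integrable_fourierChar_smul hg x) (integrable_fourierChar_smul hh x), add_re]

theorem reInv_sub {g h : E3 → ℂ} (hg : Integrable g) (hh : Integrable h) (x : E3) :
    reInv (fun ξ => g ξ - h ξ) x = reInv g x - reInv h x := by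
  simp only [reInv, Real.fourierInv_eq, smul_sub]
  rw [integral_sub (integrable_fourierChar_smul hg x) (integrable_fourierChar_smul hh x), sub_re]

theorem reInv_smul (c : ℝ) (g : E3 → ℂ) (x : E3) :
    reInv (fun ξ => c * g ξ) x = c * reInv g x := by
  simp only [reInv, Real.fourierInv_eq]
  rw [← re_ofReal_mul, ← integral_const_mul]
  congr 2
  ext ξ
  simp only [Circle.smul_def, smul_eq_mul]
  ring

/-- The symbol `2πi⟨ξ, y⟩` of the derivative in the direction `y`. -/
def dsym (y ξ : E3) : ℂ := 2 * Real.pi * I * (⟪ξ, y⟫ : ℝ)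

theorem norm_dsym_le (y ξ : E3) : ‖dsym y ξ‖ ≤ 2 * Real.pi * (‖ξ‖ * ‖y‖) := by
  simp only [dsym, norm_mul, norm_I, norm_real, Real.norm_eq_abs, abs_of_pos Real.pi_pos,
    RCLike.norm_ofNat, mul_one]
  gcongr
  exact abs_real_inner_le_norm ξ y

/-- The derivative of an inverse Fourier integral is again one, with the symbol multiplied by
`2πi⟨ξ, y⟩`. -/
theorem hasFDerivAt_fourierInv {g : E3 → ℂ} (hg : Integrable g)
    (hg' : Integrable fun ξ => ‖ξ‖ * ‖g ξ‖) (x : E3) :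
    ∃ D : E3 →L[ℝ] ℂ, HasFDerivAt (𝓕⁻ g) D x ∧ ∀ y, D y = 𝓕⁻ (fun ξ => dsym y ξ * g ξ) x := by
  have h1 : Integrable fun ξ => g (-ξ) := hg.comp_neg
  have h2 : Integrable fun ξ => ‖ξ‖ * ‖g (-ξ)‖ := by simpa using hg'.comp_neg
  have h := Real.hasFDerivAt_fourier h1 h2 x
  rw [Real.fourierInv_eq_fourier_comp_neg]
  refine ⟨_, h, fun y => ?_⟩
  have h3 : Integrable (VectorFourier.fourierSMulRight (innerSL ℝ) fun ξ : E3 => g (-ξ)) := by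
    refine (h2.const_mul (2 * Real.pi * ‖innerSL ℝ (E := E3)‖)).mono'
      h1.1.fourierSMulRight (Eventually.of_forall fun ξ => ?_)
    refine (VectorFourier.norm_fourierSMulRight_le _ _ _).trans_eq ?_
    ring
  rw [Real.fourier_eq, ContinuousLinearMap.integral_apply
    (by simpa using (Real.fourierIntegral_convergent_iff x).2 h3), Real.fourierInv_eq_fourier_comp_neg,
    Real.fourier_eq]
  congr 1
  ext ξ
  simp only [dsym, inner_neg_left, ofReal_neg, smul_apply,
    VectorFourier.fourierSMulRight_apply, Circle.smul_def, smul_eq_mul, real_smul]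
  change (_ * (-(2 * Real.pi * I) * ((⟪ξ, y⟫ : ℝ) * g (-ξ))) : ℂ) = _
  ring

theorem hasFDerivAt_reInv {g : E3 → ℂ} (hg : Integrable g)
    (hg' : Integrable fun ξ => ‖ξ‖ * ‖g ξ‖) (x : E3) :
    ∃ D : E3 →L[ℝ] ℝ, HasFDerivAt (reInv g) D x ∧
      ∀ y, D y = reInv (fun ξ => dsym y ξ * g ξ) x := by
  obtain ⟨D, hD, hDy⟩ := hasFDerivAt_fourierInv hg hg' x
  refine ⟨Complex.reCLM.comp D, Complex.reCLM.hasFDerivAt.comp x hD, fun y => ?_⟩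
  simp [reInv, hDy]

theorem fderiv_reInv {g : E3 → ℂ} (hg : Integrable g)
    (hg' : Integrable fun ξ => ‖ξ‖ * ‖g ξ‖) (x y : E3) :
    fderiv ℝ (reInv g) x y = reInv (fun ξ => dsym y ξ * g ξ) x := by
  obtain ⟨D, hD, hDy⟩ := hasFDerivAt_reInv hg hg' x
  rw [hD.fderiv, hDy]

/-- Band-limited symbols: square integrable and vanishing outside a ball. -/
structure Band (g : E3 → ℂ) : Prop where
  memLp : MemLp g 2 (volume : Measure E3)
  bounded : ∃ N : ℝ, ∀ ξ, N < ‖ξ‖ → g ξ = 0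

theorem Band.exists_bound {g : E3 → ℂ} (hg : Band g) :
    ∃ N : ℝ, 0 ≤ N ∧ ∀ ξ, N < ‖ξ‖ → g ξ = 0 := by
  obtain ⟨N, hN⟩ := hg.bounded
  exact ⟨max N 0, le_max_right _ _, fun ξ hξ => hN ξ (lt_of_le_of_lt (le_max_left _ _) hξ)⟩

theorem Band.integrable {g : E3 → ℂ} (hg : Band g) : Integrable g := by
  obtain ⟨N, -, hN⟩ := hg.exists_bound
  have h : Integrable (indicator (Metric.closedBall (0 : E3) N) g) := by
    rw [integrable_indicator_iff measurableSet_closedBall]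
    have : IsFiniteMeasure (volume.restrict (Metric.closedBall (0 : E3) N)) :=
      isFiniteMeasure_restrict.2 (measure_closedBall_lt_top.ne)
    exact (hg.memLp.restrict _).integrable (by norm_num)
  refine h.congr (Eventually.of_forall fun ξ => ?_)
  by_cases hξ : ξ ∈ Metric.closedBall (0 : E3) N
  · simp [hξ]
  · rw [indicator_of_notMem hξ, hN ξ (by simpa using hξ)]

/-- Multiplication by a multiplier that is bounded on bounded sets preserves band limitation. -/
theorem Band.mul {g m : E3 → ℂ} (hg : Band g) (hm : AEStronglyMeasurable m)
    (hb : ∀ N, ∃ C, ∀ ξ : E3, ‖ξ‖ ≤ N → g ξ ≠ 0 → ‖m ξ‖ ≤ C) : Band (fun ξ => m ξ * g ξ) := by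
  obtain ⟨N, -, hN⟩ := hg.exists_bound
  obtain ⟨C, hC⟩ := hb N
  refine ⟨(hg.memLp.const_mul (C : ℂ)).mono (hm.mul hg.memLp.1) (Eventually.of_forall fun ξ => ?_),
    N, fun ξ hξ => by simp [hN ξ hξ]⟩
  by_cases h0 : g ξ = 0
  · simp [h0]
  · have hξ : ‖ξ‖ ≤ N := by
      by_contra! h
      exact h0 (hN ξ h)
    rw [norm_mul, norm_mul, norm_real, Real.norm_eq_abs]
    gcongr
    exact (hC ξ hξ h0).trans (le_abs_self C)

theorem Band.add {g h : E3 → ℂ} (hg : Band g) (hh : Band h) : Band (fun ξ => g ξ + h ξ) := by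
  obtain ⟨N, -, hN⟩ := hg.exists_bound
  obtain ⟨M, -, hM⟩ := hh.exists_bound
  exact ⟨hg.memLp.add hh.memLp, max N M, fun ξ hξ => by
    rw [hN ξ (lt_of_le_of_lt (le_max_left _ _) hξ), hM ξ (lt_of_le_of_lt (le_max_right _ _) hξ),
      add_zero]⟩

theorem continuous_dsym (y : E3) : Continuous (dsym y) := by
  unfold dsym; fun_prop

theorem Band.dsym_mul {g : E3 → ℂ} (hg : Band g) (y : E3) : Band (fun ξ => dsym y ξ * g ξ) :=
  hg.mul (continuous_dsym y).aestronglyMeasurable fun N =>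
    ⟨2 * Real.pi * (N * ‖y‖), fun ξ hξ _ => (norm_dsym_le y ξ).trans (by gcongr)⟩

theorem Band.integrable_pow_mul {g : E3 → ℂ} (hg : Band g) (n : ℕ) :
    Integrable fun ξ => ‖ξ‖ ^ n * ‖g ξ‖ := by
  have h : Band (fun ξ => ((‖ξ‖ ^ n : ℝ) : ℂ) * g ξ) := by
    refine hg.mul (by fun_prop) fun N => ⟨N ^ n, fun ξ hξ _ => ?_⟩
    simp only [norm_real, norm_pow, norm_norm]
    gcongr
  simpa using h.integrable.norm

theorem Band.integrable_norm_mul {g : E3 → ℂ} (hg : Band g) :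
    Integrable fun ξ => ‖ξ‖ * ‖g ξ‖ := by simpa using hg.integrable_pow_mul 1

theorem Band.contDiff_fourierInv {g : E3 → ℂ} (hg : Band g) : ContDiff ℝ ∞ (𝓕⁻ g) := by
  rw [Real.fourierInv_eq_fourier_comp_neg]
  refine Real.contDiff_fourier (N := ⊤) fun n _ => ?_
  simpa using (hg.integrable_pow_mul n).comp_neg

theorem Band.contDiff_reInv {g : E3 → ℂ} (hg : Band g) : ContDiff ℝ ∞ (reInv g) :=
  Complex.reCLM.contDiff.comp hg.contDiff_fourierInv

theorem Band.memLp_fourierInv {g : E3 → ℂ} (hg : Band g) : MemLp (𝓕⁻ g) 2 (volume : Measure E3) :=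
  (memLp_congr_ae (coeFn_fourierInv_toLp hg.integrable hg.memLp)).1 (Lp.memLp _)

theorem Band.memLp_reInv {g : E3 → ℂ} (hg : Band g) : MemLp (reInv g) 2 (volume : Measure E3) :=
  hg.memLp_fourierInv.re

theorem Lp.norm_sq_eq_integral {α F : Type*} [MeasurableSpace α] {μ : Measure α}
    [NormedAddCommGroup F] (f : Lp F 2 μ) : ‖f‖ ^ 2 = ∫ x, ‖f x‖ ^ 2 ∂μ := by
  rw [Lp.norm_def, (Lp.memLp f).eLpNorm_eq_integral_rpow_norm (by norm_num) (by norm_num),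
    ENNReal.toReal_ofReal (by positivity)]
  simp only [ENNReal.toReal_ofNat, Real.rpow_ofNat]
  rw [← Real.rpow_natCast, ← Real.rpow_mul (integral_nonneg fun x => by positivity)]
  norm_num

/-- Plancherel's inequality for the real part of the inverse transform. -/
theorem Band.integral_sq_reInv_le {g : E3 → ℂ} (hg : Band g) :
    ∫ x, reInv g x ^ 2 ≤ ∫ ξ, ‖g ξ‖ ^ 2 := by
  have h1 : ∫ x, reInv g x ^ 2 ≤ ∫ x, ‖𝓕⁻ g x‖ ^ 2 := by
    refine integral_mono hg.memLp_reInv.integrable_sq hg.memLp_fourierInv.norm.integrable_sq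
      fun x => ?_
    rw [← sq_abs]
    gcongr
    exact Complex.abs_re_le_norm _
  refine h1.trans_eq ?_
  have key := Lp.norm_sq_eq_integral (F := ℂ) (μ := (volume : Measure E3))
  have e1 : ∫ x, ‖𝓕⁻ g x‖ ^ 2 = ‖(𝓕⁻ (hg.memLp.toLp g) : Lp ℂ 2 (volume : Measure E3))‖ ^ 2 := by
    rw [key]
    apply integral_congr_ae
    filter_upwards [coeFn_fourierInv_toLp hg.integrable hg.memLp] with x hx
    rw [hx]
  have e2 : ∫ x, ‖g x‖ ^ 2 = ‖hg.memLp.toLp g‖ ^ 2 := by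
    rw [key]
    apply integral_congr_ae
    filter_upwards [hg.memLp.coeFn_toLp] with x hx
    rw [hx]
  rw [e1, e2, ← Lp.norm_fourier_eq, FourierTransform.fourier_fourierInv_eq]

/-- Parseval's identity, in the form in which the real scalar products of `L²` use it. -/
theorem Band.integral_mul_reInv {g : E3 → ℂ} (hg : Band g) (f : Lp ℂ 2 (volume : Measure E3))
    (hf : ∀ᵐ x, (f x).im = 0) :
    ∫ x, (f x).re * reInv g x =
      ∫ ξ, ((starRingEnd ℂ) ((𝓕 f : Lp ℂ 2 (volume : Measure E3)) ξ) * g ξ).re := by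
  have h := Lp.inner_fourier_eq f (𝓕⁻ (hg.memLp.toLp g) : Lp ℂ 2 (volume : Measure E3))
  rw [FourierTransform.fourier_fourierInv_eq, L2.inner_def, L2.inner_def] at h
  have h' := congrArg Complex.re h
  rw [← reCLM_apply, ← reCLM_apply, ← ContinuousLinearMap.integral_comp_comm _
    (L2.integrable_inner _ _),
    ← ContinuousLinearMap.integral_comp_comm _ (L2.integrable_inner _ _)] at h'
  calc _ = _ := ?_
    _ = _ := h'.symm
    _ = _ := ?_
  · apply integral_congr_ae
    filter_upwards [coeFn_fourierInv_toLp hg.integrable hg.memLp, hf] with x hx hx'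
    simp [hx, reInv, RCLike.inner_apply, hx', mul_comm]
  · apply integral_congr_ae
    filter_upwards [hg.memLp.coeFn_toLp] with x hx
    simp [hx, RCLike.inner_apply, mul_comm]

/-! ### Smooth functions with square-integrable derivatives -/

/-- Smooth functions all of whose derivatives are bounded and square integrable. -/
structure Nice {F : Type*} [NormedAddCommGroup F] [NormedSpace ℝ F] (f : E3 → F) : Prop where
  contDiff : ContDiff ℝ ∞ f
  bounded : ∀ n, ∃ C : ℝ, ∀ x, ‖iteratedFDeriv ℝ n f x‖ ≤ C
  memLp : ∀ n, MemLp (fun x => ‖iteratedFDeriv ℝ n f x‖) 2 (volume : Measure E3)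

section Nice

variable {F G : Type*} [NormedAddCommGroup F] [NormedSpace ℝ F] [NormedAddCommGroup G]
  [NormedSpace ℝ G] {f g : E3 → F}

theorem continuous_iteratedFDeriv_of_contDiff (hf : ContDiff ℝ ∞ f) (n : ℕ) :
    Continuous (iteratedFDeriv ℝ n f) :=
  hf.continuous_iteratedFDeriv (by exact_mod_cast le_top)

theorem Nice.of_le (hf : ContDiff ℝ ∞ f) {m : ℕ → E3 → ℝ}
    (hb : ∀ n, ∃ C : ℝ, ∀ x, m n x ≤ C) (hm : ∀ n, MemLp (m n) 2 (volume : Measure E3))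
    (h : ∀ n x, ‖iteratedFDeriv ℝ n f x‖ ≤ m n x) : Nice f where
  contDiff := hf
  bounded n := by
    obtain ⟨C, hC⟩ := hb n
    exact ⟨C, fun x => (h n x).trans (hC x)⟩
  memLp n := (hm n).mono' (continuous_iteratedFDeriv_of_contDiff hf n).norm.aestronglyMeasurable
    (Eventually.of_forall fun x => by simpa using h n x)

theorem Nice.clm_comp (hf : Nice f) (L : F →L[ℝ] G) : Nice (fun x => L (f x)) := by
  refine Nice.of_le (L.contDiff.comp hf.contDiff)
    (m := fun n x => ‖L‖ * ‖iteratedFDeriv ℝ n f x‖) (fun n => ?_)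
      (fun n => (hf.memLp n).const_mul _)
    fun n x => L.norm_iteratedFDeriv_comp_left hf.contDiff.contDiffAt
      (by exact_mod_cast le_top)
  obtain ⟨C, hC⟩ := hf.bounded n
  exact ⟨‖L‖ * C, fun x => by gcongr; exact hC x⟩

theorem Nice.sum {ι : Type*} {s : Finset ι} {f : ι → E3 → F} (hf : ∀ i ∈ s, Nice (f i)) :
    Nice (fun x => ∑ i ∈ s, f i x) := by
  have hs : ContDiff ℝ ∞ fun x => ∑ i ∈ s, f i x := ContDiff.sum fun i hi => (hf i hi).contDiff
  refine Nice.of_le hs (m := fun n x => ∑ i ∈ s, ‖iteratedFDeriv ℝ n (f i) x‖) (fun n => ?_)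
    (fun n => memLp_finsetSum _ fun i hi => (hf i hi).memLp n) fun n x => ?_
  · have : ∀ i, ∃ C : ℝ, i ∈ s → ∀ x, ‖iteratedFDeriv ℝ n (f i) x‖ ≤ C := fun i => by
      by_cases hi : i ∈ s
      · obtain ⟨C, hC⟩ := (hf i hi).bounded n
        exact ⟨C, fun _ => hC⟩
      · exact ⟨0, fun h => absurd h hi⟩
    choose C hC using this
    exact ⟨∑ i ∈ s, C i, fun x => Finset.sum_le_sum fun i hi => hC i hi x⟩
  · rw [iteratedFDeriv_fun_sum_apply fun i hi =>
      ((hf i hi).contDiff.of_le (by exact_mod_cast le_top)).contDiffAt]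
    exact norm_sum_le _ _

theorem Nice.fderiv (hf : Nice f) : Nice (fderiv ℝ f) where
  contDiff := hf.contDiff.fderiv_right (by simp)
  bounded n := by simpa only [norm_iteratedFDeriv_fderiv] using hf.bounded (n + 1)
  memLp n := by simpa only [norm_iteratedFDeriv_fderiv] using hf.memLp (n + 1)

theorem Nice.norm_bounded (hf : Nice f) : ∃ C : ℝ, ∀ x, ‖f x‖ ≤ C := by
  simpa using hf.bounded 0

theorem Nice.memLp_self (hf : Nice f) : MemLp f 2 (volume : Measure E3) :=
  (hf.memLp 0).mono hf.contDiff.continuous.aestronglyMeasurable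
    (Eventually.of_forall fun x => by simp)

/-- Smooth cutoffs of a function with bounded, square integrable derivatives: they agree with it
near any given point eventually, with derivatives dominated independently of the cutoff. -/
theorem Nice.exists_cutoff (hf : Nice f) :
    ∃ A : ℕ → E3 → F, (∀ k, ContDiff ℝ ∞ (A k)) ∧ (∀ k, HasCompactSupport (A k)) ∧
      (∀ x, ∀ᶠ k in atTop, A k =ᶠ[𝓝 x] f) ∧
      ∃ m : ℕ → E3 → ℝ, (∀ n, MemLp (m n) 2 (volume : Measure E3)) ∧
        (∀ n, ∃ C : ℝ, ∀ x, m n x ≤ C) ∧ ∀ n k x, ‖iteratedFDeriv ℝ n (A k) x‖ ≤ m n x := by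
  -- a bump function, dilated by the factors `k + 1`
  let χ : ContDiffBump (0 : E3) := ⟨1, 2, one_pos, one_lt_two⟩
  have hχ : ContDiff ℝ ∞ (χ : E3 → ℝ) := χ.contDiff
  have hB : ∀ n, ∃ B : ℝ, ∀ x, ‖iteratedFDeriv ℝ n (χ : E3 → ℝ) x‖ ≤ B := fun n =>
    (continuous_iteratedFDeriv_of_contDiff hχ n).bounded_above_of_compact_support
      (χ.hasCompactSupport.iteratedFDeriv n)
  choose B hB using hB
  let c : ℕ → ℝ := fun k => ((k : ℝ) + 1)⁻¹
  have hc : ∀ k, 0 < c k := fun k => by positivity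
  have hc1 : ∀ k, c k ≤ 1 := fun k => inv_le_one_of_one_le₀ (by simp)
  have hχk : ∀ k, ContDiff ℝ ∞ fun x => χ (c k • x) := fun k => hχ.comp (contDiff_const_smul _)
  refine ⟨fun k x => χ (c k • x) • f x, fun k => (hχk k).smul hf.contDiff, fun k => ?_, fun x => ?_,
    fun n x => ∑ i ∈ Finset.range (n + 1), (n.choose i : ℝ) * B i * ‖iteratedFDeriv ℝ (n - i) f x‖,
    fun n => memLp_finsetSum _ fun i _ => (hf.memLp (n - i)).const_mul _, fun n => ?_,
      fun n k x => ?_⟩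
  · exact (χ.hasCompactSupport.comp_smul (hc k).ne').smul_right
  · have hlim : Tendsto (fun k : ℕ => c k * (‖x‖ + 1)) atTop (𝓝 0) := by
      simpa using (tendsto_one_div_add_atTop_nhds_zero_nat (𝕜 := ℝ)).mul_const (‖x‖ + 1)
    filter_upwards [hlim.eventually_lt_const one_pos] with k hk
    filter_upwards [Metric.ball_mem_nhds x one_pos] with y hy
    rw [χ.one_of_mem_closedBall, one_smul]
    have h1 : ‖y‖ ≤ ‖x‖ + 1 := by
      have := norm_sub_norm_le y x
      rw [Metric.mem_ball, dist_eq_norm] at hy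
      linarith
    rw [mem_closedBall_zero_iff, norm_smul, Real.norm_of_nonneg (hc k).le]
    exact (mul_le_mul_of_nonneg_left h1 (hc k).le).trans hk.le
  · choose C hC using hf.bounded
    refine ⟨∑ i ∈ Finset.range (n + 1), (n.choose i : ℝ) * B i * C (n - i), fun x =>
      Finset.sum_le_sum fun i _ => ?_⟩
    have : 0 ≤ B i := (norm_nonneg _).trans (hB i 0)
    gcongr
    exact hC _ x
  · refine (norm_iteratedFDeriv_smul_le (hχk k) hf.contDiff x (n := n)
      (by exact_mod_cast le_top)).trans (Finset.sum_le_sum fun i _ => ?_)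
    gcongr
    rw [iteratedFDeriv_comp_const_smul _ (hχ.of_le (by exact_mod_cast le_top)), norm_smul, norm_pow,
      Real.norm_of_nonneg (hc k).le]
    calc c k ^ i * _ ≤ 1 * B i := by
          gcongr
          · exact pow_le_one₀ (hc k).le (hc1 k)
          · exact hB i _
      _ = B i := one_mul _

theorem norm_fderiv_eq_iteratedFDeriv_one (f : E3 → F) (x : E3) :
    ‖fderiv ℝ f x‖ = ‖iteratedFDeriv ℝ 1 f x‖ := by
  rw [← norm_iteratedFDeriv_fderiv, norm_iteratedFDeriv_zero]

end Nice

theorem fderiv_eq_sum_smulRight {F : Type*} [NormedAddCommGroup F] [NormedSpace ℝ F]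
    (D : E3 →L[ℝ] F) :
    D = ∑ j : Fin 3, (EuclideanSpace.proj j : E3 →L[ℝ] ℝ).smulRight
      (D (EuclideanSpace.single j 1)) := by
  ext x
  conv_lhs => rw [← (EuclideanSpace.basisFun (Fin 3) ℝ).sum_repr x]
  simp [map_sum]

/-- All derivatives are controlled by induction on the order, as the first partial derivatives of
`reInv g` are of the form `reInv (dsym _ * g)` with band-limited symbols. -/
theorem Band.nice {g : E3 → ℂ} (hg : Band g) : Nice (reInv g) := by
  have key : ∀ n, ∀ g : E3 → ℂ, Band g → (∃ C : ℝ, ∀ x, ‖iteratedFDeriv ℝ n (reInv g) x‖ ≤ C) ∧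
      MemLp (fun x => ‖iteratedFDeriv ℝ n (reInv g) x‖) 2 (volume : Measure E3) := by
    intro n
    induction n with
    | zero =>
      intro g hg
      simp only [norm_iteratedFDeriv_zero]
      exact ⟨⟨_, abs_reInv_le g⟩, hg.memLp_reInv.norm⟩
    | succ n ih =>
      intro g hg
      let L : Fin 3 → ℝ →L[ℝ] E3 →L[ℝ] ℝ := fun j =>
        ContinuousLinearMap.smulRightL ℝ E3 ℝ (EuclideanSpace.proj j : E3 →L[ℝ] ℝ)
      let gj : Fin 3 → E3 → ℂ := fun j ξ => dsym (EuclideanSpace.single j 1) ξ * g ξ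
      have hgj : ∀ j, Band (gj j) := fun j => hg.dsym_mul _
      have hf : fderiv ℝ (reInv g) = fun x => ∑ j : Fin 3, L j (reInv (gj j) x) := by
        ext1 x
        rw [fderiv_eq_sum_smulRight (fderiv ℝ (reInv g) x)]
        refine Finset.sum_congr rfl fun j _ => ?_
        rw [fderiv_reInv hg.integrable hg.integrable_norm_mul]
        rfl
      have hle : ∀ x, ‖iteratedFDeriv ℝ (n + 1) (reInv g) x‖ ≤
          ∑ j : Fin 3, ‖L j‖ * ‖iteratedFDeriv ℝ n (reInv (gj j)) x‖ := by
        intro x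
        have hL : ∀ j, ContDiff ℝ n fun x => L j (reInv (gj j) x) := fun j =>
          ((L j).contDiff.comp (hgj j).contDiff_reInv).of_le (by exact_mod_cast le_top)
        rw [← norm_iteratedFDeriv_fderiv, hf,
          iteratedFDeriv_fun_sum_apply fun j _ => (hL j).contDiffAt]
        refine (norm_sum_le _ _).trans (Finset.sum_le_sum fun j _ => ?_)
        exact (L j).norm_iteratedFDeriv_comp_left (hgj j).contDiff_reInv.contDiffAt
          (by exact_mod_cast le_top)
      constructor
      · choose C hC using fun j => (ih (gj j) (hgj j)).1
        exact ⟨∑ j : Fin 3, ‖L j‖ * C j, fun x => (hle x).trans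
          (Finset.sum_le_sum fun j _ => by gcongr; exact hC j x)⟩
      · refine MemLp.mono' (g := fun x => ∑ j : Fin 3, ‖L j‖ * ‖iteratedFDeriv ℝ n
          (reInv (gj j)) x‖)
          (memLp_finsetSum _ fun j _ => ((ih (gj j) (hgj j)).2.const_mul _))
          (continuous_iteratedFDeriv_of_contDiff hg.contDiff_reInv
            (n + 1)).norm.aestronglyMeasurable
          (Eventually.of_forall fun x => by simpa using hle x)
  exact ⟨hg.contDiff_reInv, fun n => (key n g hg).1, fun n => (key n g hg).2⟩

/-- A divergence-free field annihilates the gradient of a product `a b`, of which only the first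
factor has to be square integrable. The product need not have compact support: `a` is cut off. -/
theorem integral_fderiv_mul_eq_zero (v : L2sigma) {a b : E3 → ℝ} (ha : Nice a)
    (hb : ContDiff ℝ ∞ b) (hb0 : ∃ C, ∀ x, ‖b x‖ ≤ C) (hb1 : ∃ C, ∀ x, ‖fderiv ℝ b x‖ ≤ C) :
    ∫ x, (fderiv ℝ a x ((v : L2) x) * b x + a x * fderiv ℝ b x ((v : L2) x)) = 0 := by
  obtain ⟨A, hA, hAc, hAe, m, hm, -, hAm⟩ := ha.exists_cutoff
  obtain ⟨C0, hC0⟩ := hb0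
  obtain ⟨C1, hC1⟩ := hb1
  have hv : AEStronglyMeasurable ((v : L2) : E3 → E3) volume := (Lp.memLp (v : L2)).1
  have happ : ∀ {c : E3 → ℝ}, ContDiff ℝ ∞ c →
      AEStronglyMeasurable (fun x => fderiv ℝ c x ((v : L2) x)) volume := fun hc =>
    (isBoundedBilinearMap_apply (𝕜 := ℝ) (E := E3) (F := ℝ)).continuous.comp_aestronglyMeasurable
      ((hc.continuous_fderiv (by simp)).aestronglyMeasurable.prodMk hv)
  have hmul : ∀ {c : E3 → ℝ}, ContDiff ℝ ∞ c → AEStronglyMeasurable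
      (fun x => fderiv ℝ c x ((v : L2) x) * b x + c x * fderiv ℝ b x ((v : L2) x)) volume :=
        fun hc =>
    ((happ hc).mul hb.continuous.aestronglyMeasurable).add
      (hc.continuous.aestronglyMeasurable.mul (happ hb))
  have hzero : ∀ k, ∫ x, (fderiv ℝ (A k) x ((v : L2) x) * b x
      + A k x * fderiv ℝ b x ((v : L2) x)) = 0 := by
    intro k
    have h := v.2 (fun x => A k x * b x) ((hA k).mul hb) (hAc k).mul_right
    rw [← h]
    congr 1
    ext x
    rw [fderiv_fun_mul ((hA k).differentiable (by simp) x) (hb.differentiable (by simp) x)]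
    simp [smul_eq_mul]
    ring
  have hlim := tendsto_integral_of_dominated_convergence (μ := (volume : Measure E3))
    (F := fun k x => fderiv ℝ (A k) x ((v : L2) x) * b x + A k x * fderiv ℝ b x ((v : L2) x))
    (f := fun x => fderiv ℝ a x ((v : L2) x) * b x + a x * fderiv ℝ b x ((v : L2) x))
    (fun x => m 1 x * ‖(v : L2) x‖ * C0 + m 0 x * ‖(v : L2) x‖ * C1)
    (fun k => hmul (hA k))
    ((((hm 1).integrable_mul (Lp.memLp (v : L2)).norm).mul_const _).add
      (((hm 0).integrable_mul (Lp.memLp (v : L2)).norm).mul_const _))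
    (fun k => Eventually.of_forall fun x => ?_)
    (Eventually.of_forall fun x => ?_)
  · simp only [hzero] at hlim
    exact tendsto_nhds_unique hlim tendsto_const_nhds |>.symm ▸ rfl
  · have h1 : ‖fderiv ℝ (A k) x ((v : L2) x)‖ ≤ m 1 x * ‖(v : L2) x‖ :=
      (ContinuousLinearMap.le_opNorm _ _).trans (by
        gcongr; rw [norm_fderiv_eq_iteratedFDeriv_one]; exact hAm 1 k x)
    have h2 : ‖A k x‖ ≤ m 0 x := by simpa using hAm 0 k x
    have h3 : ‖fderiv ℝ b x ((v : L2) x)‖ ≤ C1 * ‖(v : L2) x‖ :=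
      (ContinuousLinearMap.le_opNorm _ _).trans (by gcongr; exact hC1 x)
    refine (norm_add_le _ _).trans ?_
    rw [norm_mul, norm_mul, mul_assoc (m 0 x), mul_comm ‖(v : L2) x‖ C1]
    have hm0 : 0 ≤ m 0 x := (norm_nonneg _).trans h2
    have hm1 : 0 ≤ m 1 x * ‖(v : L2) x‖ := (norm_nonneg _).trans h1
    gcongr
    exact hC0 x
  · refine tendsto_const_nhds.congr' ?_
    filter_upwards [hAe x] with k hk
    rw [hk.fderiv_eq, hk.eq_of_nhds]

/-! ### Vector fields on the Fourier side -/

/-- The Fourier transform of the `i`-th component of `v`. -/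
def vhat (v : L2) (i : Fin 3) : E3 → ℂ :=
  (𝓕 (component i v) : Lp ℂ 2 (volume : Measure E3))

theorem memLp_vhat (v : L2) (i : Fin 3) : MemLp (vhat v i) 2 (volume : Measure E3) := Lp.memLp _

theorem coeFn_component (i : Fin 3) (v : L2) :
    component i v =ᵐ[volume] fun x => ((v x i : ℝ) : ℂ) := by
  filter_upwards [ContinuousLinearMap.coeFn_compLp
    (Complex.ofRealCLM.comp (EuclideanSpace.proj i : E3 →L[ℝ] ℝ)) v] with x hx
  rw [component, hx]
  rfl

theorem inner_E3 (x y : E3) : ⟪x, y⟫ = ∑ i, x i * y i := by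
  simp [PiLp.inner_apply, mul_comm]

theorem norm_sq_E3 (x : E3) : ‖x‖ ^ 2 = ∑ i, x i ^ 2 := by
  simp [EuclideanSpace.norm_sq_eq]

theorem norm_E3_le (x : E3) : ‖x‖ ≤ ∑ i, |x i| := by
  refine abs_le_of_sq_le_sq' ?_ (by positivity) |>.2
  rw [norm_sq_E3]
  simp only [Fin.sum_univ_three]
  nlinarith [sq_abs (x 0), sq_abs (x 1), sq_abs (x 2), abs_nonneg (x 0), abs_nonneg (x 1),
    abs_nonneg (x 2), mul_nonneg (abs_nonneg (x 0)) (abs_nonneg (x 1)),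
    mul_nonneg (abs_nonneg (x 0)) (abs_nonneg (x 2)), mul_nonneg (abs_nonneg (x 1))
      (abs_nonneg (x 2))]

theorem memLp_coord (v : L2) (i : Fin 3) : MemLp (fun x => v x i) 2 (volume : Measure E3) :=
  (EuclideanSpace.proj i : E3 →L[ℝ] ℝ).comp_memLp' (Lp.memLp v)

theorem sum_integral_norm_sq_vhat (v : L2) : ∑ i, ∫ ξ, ‖vhat v i ξ‖ ^ 2 = ‖v‖ ^ 2 := by
  have h1 : ∀ i, ∫ ξ, ‖vhat v i ξ‖ ^ 2 = ∫ x, v x i ^ 2 := fun i => by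
    rw [vhat, ← Lp.norm_sq_eq_integral, Lp.norm_fourier_eq, Lp.norm_sq_eq_integral]
    apply integral_congr_ae
    filter_upwards [coeFn_component i v] with x hx
    simp [hx]
  simp only [h1]
  rw [Lp.norm_sq_eq_integral, ← integral_finsetSum _ fun i _ => (memLp_coord v i).integrable_sq]
  simp only [norm_sq_E3]

/-- The real vector field with given complex Fourier coefficients. -/
def field (G : Fin 3 → E3 → ℂ) (x : E3) : E3 := WithLp.toLp 2 fun i => reInv (G i) x

theorem field_apply (G : Fin 3 → E3 → ℂ) (x : E3) (i : Fin 3) : field G x i = reInv (G i) x := rfl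

theorem field_eq_sum (G : Fin 3 → E3 → ℂ) : field G = fun x => ∑ i : Fin 3,
    (ContinuousLinearMap.toSpanSingleton ℝ (EuclideanSpace.single i 1 : E3)) (reInv (G i) x) := by
  ext x j
  simp only [field, Fin.sum_univ_three]
  fin_cases j <;> simp

theorem nice_field {G : Fin 3 → E3 → ℂ} (hG : ∀ i, Band (G i)) : Nice (field G) := by
  rw [field_eq_sum]
  exact Nice.sum fun i _ => (hG i).nice.clm_comp _

theorem hasFDerivAt_field {G : Fin 3 → E3 → ℂ} (hG : ∀ i, Integrable (G i))
    (hG' : ∀ i, Integrable fun ξ => ‖ξ‖ * ‖G i ξ‖) (x : E3) : ∃ D : E3 →L[ℝ] E3,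
      HasFDerivAt (field G) D x ∧ ∀ y, D y = field (fun i ξ => dsym y ξ * G i ξ) x := by
  choose D hD hDy using fun i => hasFDerivAt_reInv (hG i) (hG' i) x
  refine ⟨∑ i : Fin 3, (ContinuousLinearMap.toSpanSingleton ℝ (EuclideanSpace.single i 1 : E3)).comp
    (D i), ?_, fun y => ?_⟩
  · rw [field_eq_sum]
    exact HasFDerivAt.fun_sum fun i _ => (ContinuousLinearMap.hasFDerivAt _).comp x (hD i)
  · rw [field_eq_sum]
    simp [hDy]

theorem fderiv_field {G : Fin 3 → E3 → ℂ} (hG : ∀ i, Integrable (G i))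
    (hG' : ∀ i, Integrable fun ξ => ‖ξ‖ * ‖G i ξ‖) (x y : E3) :
    fderiv ℝ (field G) x y = field (fun i ξ => dsym y ξ * G i ξ) x := by
  obtain ⟨D, hD, hDy⟩ := hasFDerivAt_field hG hG' x
  rw [hD.fderiv, hDy]

/-- The `L^∞` norm of the gradient is controlled by the `L¹` norms of its Fourier coefficients. -/
theorem norm_fderiv_field_le {G : Fin 3 → E3 → ℂ} (hG : ∀ i, Integrable (G i))
    (hG' : ∀ i, Integrable fun ξ => ‖ξ‖ * ‖G i ξ‖) (x : E3) :
    ‖fderiv ℝ (field G) x‖ ≤ 2 * Real.pi * ∑ i, ∫ ξ, ‖ξ‖ * ‖G i ξ‖ := by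
  refine ContinuousLinearMap.opNorm_le_bound _ (mul_nonneg (by positivity)
    (Finset.sum_nonneg fun i _ => integral_nonneg fun ξ => by positivity)) fun y => ?_
  rw [fderiv_field hG hG']
  refine (norm_E3_le _).trans ?_
  rw [Finset.mul_sum, Finset.sum_mul]
  refine Finset.sum_le_sum fun i _ => (abs_reInv_le _ _).trans ?_
  rw [mul_assoc, ← integral_mul_const, ← integral_const_mul]
  refine integral_mono_of_nonneg (Eventually.of_forall fun ξ => norm_nonneg _)
    (((hG' i).mul_const _).const_mul _) (Eventually.of_forall fun ξ => ?_)
  calc ‖dsym y ξ * G i ξ‖ ≤ 2 * Real.pi * (‖ξ‖ * ‖y‖) * ‖G i ξ‖ := by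
        rw [norm_mul]; gcongr; exact norm_dsym_le y ξ
    _ = _ := by ring

theorem laplacian_reInv {g : E3 → ℂ} (hg : Band g) (x : E3) :
    Laplacian.laplacian (reInv g) x = reInv
      (fun ξ => -(4 * Real.pi ^ 2 * ‖ξ‖ ^ 2 : ℝ) * g ξ) x := by
  rw [InnerProductSpace.laplacian_eq_iteratedFDeriv_orthonormalBasis _
    (EuclideanSpace.basisFun (Fin 3) ℝ)]
  have h : ∀ i : Fin 3, iteratedFDeriv ℝ 2 (reInv g) x ![EuclideanSpace.basisFun (Fin 3) ℝ i,
      EuclideanSpace.basisFun (Fin 3) ℝ i] =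
        reInv (fun ξ => -(4 * Real.pi ^ 2 * ξ i ^ 2 : ℝ) * g ξ) x := by
    intro i
    simp only [iteratedFDeriv_two_apply, Matrix.cons_val_zero, Matrix.cons_val_one,
      EuclideanSpace.basisFun_apply]
    set e : E3 := EuclideanSpace.single i 1 with he
    have h1 : fderiv ℝ (fderiv ℝ (reInv g)) x e e = fderiv ℝ
      (fun y => fderiv ℝ (reInv g) y e) x e := by
      rw [fderiv_clm_apply ((hg.contDiff_reInv.fderiv_right (m := ∞) (by simp)).differentiable
        (by simp) x) (differentiableAt_const _)]
      simp
    have h2 : (fun y => fderiv ℝ (reInv g) y e) = reInv (fun ξ => dsym e ξ * g ξ) := by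
      ext y
      rw [fderiv_reInv hg.integrable hg.integrable_norm_mul]
    rw [h1, h2, fderiv_reInv (hg.dsym_mul e).integrable (hg.dsym_mul e).integrable_norm_mul]
    congr 1
    ext ξ
    simp only [dsym, he, EuclideanSpace.inner_single_right, one_mul]
    simp
    linear_combination (4 * (Real.pi : ℂ) ^ 2 * (ξ i : ℂ) ^ 2 * g ξ) * I_sq
  simp only [h]
  have hb : ∀ i : Fin 3, Band fun ξ => -(4 * Real.pi ^ 2 * ξ i ^ 2 : ℝ) * g ξ := fun i =>
    hg.mul (by fun_prop) fun N => ⟨4 * Real.pi ^ 2 * N ^ 2, fun ξ hξ _ => by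
      rw [norm_neg, norm_real, Real.norm_eq_abs, abs_of_nonneg (by positivity)]
      have := (PiLp.norm_apply_le ξ i).trans hξ
      rw [Real.norm_eq_abs] at this
      gcongr 4 * Real.pi ^ 2 * ?_
      rw [← sq_abs]
      gcongr⟩
  rw [Fin.sum_univ_three, ← reInv_add (hb 0).integrable (hb 1).integrable,
    ← reInv_add ((hb 0).add (hb 1)).integrable (hb 2).integrable]
  congr 1
  ext ξ
  rw [norm_sq_E3, Fin.sum_univ_three]
  push_cast
  ring

theorem laplacian_field {G : Fin 3 → E3 → ℂ} (hG : ∀ i, Band (G i)) (x : E3) :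
    Laplacian.laplacian (field G) x =
      field (fun i ξ => -(4 * Real.pi ^ 2 * ‖ξ‖ ^ 2 : ℝ) * G i ξ) x := by
  ext i
  rw [field_apply, ← laplacian_reInv (hG i)]
  have := ContDiffAt.laplacian_CLM_comp_left (l := (EuclideanSpace.proj i : E3 →L[ℝ] ℝ))
    (contDiff_infty.1 (nice_field hG).contDiff 2).contDiffAt (x := x)
  exact this.symm

/-- Parseval's identity for vector fields. -/
theorem integral_inner_field {G : Fin 3 → E3 → ℂ} (hG : ∀ i, Band (G i)) (v : L2) :
    ∫ x, ⟪v x, field G x⟫ = ∑ i, ∫ ξ, ((starRingEnd ℂ) (vhat v i ξ) * G i ξ).re := by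
  have h1 : ∀ i, ∫ x, v x i * reInv (G i) x = ∫ ξ, ((starRingEnd ℂ) (vhat v i ξ) * G i ξ).re := by
    intro i
    rw [vhat, ← (hG i).integral_mul_reInv (component i v)
      (by filter_upwards [coeFn_component i v] with x hx; simp [hx])]
    apply integral_congr_ae
    filter_upwards [coeFn_component i v] with x hx
    simp [hx]
  simp only [← h1]
  rw [← integral_finsetSum Finset.univ (f := fun i x => v x i * reInv (G i) x)
    fun i _ => (memLp_coord v i).integrable_mul (hG i).memLp_reInv]
  simp only [inner_E3, field_apply]

theorem integral_norm_sq_field_le {G : Fin 3 → E3 → ℂ} (hG : ∀ i, Band (G i)) :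
    ∫ x, ‖field G x‖ ^ 2 ≤ ∑ i, ∫ ξ, ‖G i ξ‖ ^ 2 := by
  simp only [norm_sq_E3, field_apply]
  rw [integral_finsetSum _ fun i _ => (hG i).memLp_reInv.integrable_sq]
  exact Finset.sum_le_sum fun i _ => (hG i).integral_sq_reInv_le

/-- The Fourier transform of a divergence-free field is orthogonal to the frequency. -/
theorem sum_mul_vhat_eq_zero (v : L2sigma) :
    ∀ᵐ ξ : E3, ∑ i, (ξ i : ℂ) * vhat v i ξ = 0 := by
  set d : E3 → ℂ := fun ξ => ∑ i, (ξ i : ℂ) * vhat v i ξ with hd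
  have hdm : AEStronglyMeasurable d volume := by
    refine Finset.aestronglyMeasurable_fun_sum _ fun i _ => ?_
    exact (by fun_prop : AEStronglyMeasurable (fun ξ : E3 => (ξ i : ℂ)) volume).mul (memLp_vhat v i).1
  -- Testing with the real part of the function whose symbol is `-i d`, cut off to a ball, gives
  -- `∫ ‖d‖² = 0` over that ball.
  have hN : ∀ N : ℕ, ∀ᵐ ξ : E3, ‖ξ‖ ≤ N → d ξ = 0 := by
    intro N
    have hb : ∀ i, Band ((Metric.closedBall (0 : E3) N).indicator (vhat v i)) := fun i =>
      ⟨(memLp_vhat v i).indicator measurableSet_closedBall, N, fun ξ hξ => by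
        rw [indicator_of_notMem]; simpa using hξ⟩
    set g : E3 → ℂ := fun ξ => (-I) * (∑ i, (ξ i : ℂ) * (Metric.closedBall (0 : E3) N).indicator
      (vhat v i) ξ) with hg
    have hgi : ∀ i, Band fun ξ => (ξ i : ℂ) * (Metric.closedBall (0 : E3) N).indicator
      (vhat v i) ξ :=
      fun i => (hb i).mul (by fun_prop) fun M => ⟨M, fun ξ hξ _ => by
        rw [norm_real]; exact (PiLp.norm_apply_le ξ i).trans hξ⟩
    have hgb : Band g := by
      refine Band.mul ?_ aestronglyMeasurable_const fun _ => ⟨1, fun _ _ _ => by simp⟩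
      simp only [Fin.sum_univ_three]
      exact ((hgi 0).add (hgi 1)).add (hgi 2)
    have h0 := integral_fderiv_mul_eq_zero v hgb.nice (b := fun _ => 1) contDiff_const
      ⟨1, by simp⟩ ⟨0, by simp⟩
    simp only [mul_one, fderiv_fun_const, Pi.zero_apply, zero_apply, mul_zero, add_zero] at h0
    have h1 : ∀ x, fderiv ℝ (reInv g) x ((v : L2) x) =
        ⟪(v : L2) x, field (fun i ξ => dsym (EuclideanSpace.single i 1) ξ * g ξ) x⟫ := by
      intro x
      rw [fderiv_eq_sum_smulRight (fderiv ℝ (reInv g) x), inner_E3]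
      simp [field_apply, fderiv_reInv hgb.integrable hgb.integrable_norm_mul]
    simp only [h1] at h0
    rw [integral_inner_field (fun i => hgb.dsym_mul _), ← integral_finsetSum] at h0
    · have h2 : ∀ ξ, ∑ i : Fin 3, ((starRingEnd ℂ) (vhat v i ξ) *
          (dsym (EuclideanSpace.single i 1) ξ * g ξ)).re =
          (Metric.closedBall (0 : E3) N).indicator (fun ξ => 2 * Real.pi * ‖d ξ‖ ^ 2) ξ := by
        intro ξ
        by_cases hξ : ξ ∈ Metric.closedBall (0 : E3) N
        · have hgd : g ξ = -I * d ξ := by simp only [hg, hd, indicator_of_mem hξ]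
          rw [indicator_of_mem hξ, hgd, ← re_sum]
          have : ∑ i : Fin 3, (starRingEnd ℂ) (vhat v i ξ) *
              (dsym (EuclideanSpace.single i 1) ξ * (-I * d ξ)) =
              2 * Real.pi * ((starRingEnd ℂ) (d ξ) * d ξ) := by
            rw [hd]
            simp only [dsym, EuclideanSpace.inner_single_right, one_mul, Fin.sum_univ_three,
              map_add, map_mul, conj_ofReal]
            simp
            linear_combination (-2 * Real.pi * ((starRingEnd ℂ) (vhat v 0 ξ) * ξ 0 +
              (starRingEnd ℂ) (vhat v 1 ξ) * ξ 1 + (starRingEnd ℂ) (vhat v 2 ξ) * ξ 2) *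
              (ξ 0 * vhat v 0 ξ + ξ 1 * vhat v 1 ξ + ξ 2 * vhat v 2 ξ)) * I_sq
          rw [this, conj_mul', ← ofReal_ofNat, ← ofReal_pow, ← ofReal_mul, ← ofReal_mul, ofReal_re]
        · simp [hg, indicator_of_notMem hξ]
      simp only [h2] at h0
      rw [integral_eq_zero_iff_of_nonneg_ae] at h0
      · filter_upwards [h0] with ξ hξ hξN
        rw [indicator_of_mem (by simpa using hξN)] at hξ
        simpa [Real.pi_ne_zero] using hξ
      · refine Eventually.of_forall fun ξ => indicator_nonneg (fun _ _ => by positivity) _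
      · have hb2 : Band ((Metric.closedBall (0 : E3) N).indicator d) := by
          have : (Metric.closedBall (0 : E3) N).indicator d = fun ξ =>
              ∑ i, (ξ i : ℂ) * (Metric.closedBall (0 : E3) N).indicator (vhat v i) ξ := by
            ext ξ
            by_cases hξ : ξ ∈ Metric.closedBall (0 : E3) N
            · simp [hξ, hd]
            · simp [indicator_of_notMem hξ]
          rw [this]
          simp only [Fin.sum_univ_three]
          exact ((hgi 0).add (hgi 1)).add (hgi 2)
        refine (hb2.memLp.norm.integrable_sq.const_mul (2 * Real.pi)).congr
          (Eventually.of_forall fun ξ => ?_)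
        by_cases hξ : ξ ∈ Metric.closedBall (0 : E3) N
        · simp [hξ]
        · simp [indicator_of_notMem hξ]
    · intro i _
      exact (((memLp_vhat v i).star).integrable_mul (hgb.dsym_mul _).memLp).re
  filter_upwards [ae_all_iff.2 hN] with ξ hξ
  obtain ⟨N, hN⟩ := exists_nat_ge ‖ξ‖
  exact hξ N hN

/-! ### The Cauchy–Schwarz inequality for integrals -/

theorem integral_mul_le_sqrt {α : Type*} [MeasurableSpace α] {μ : Measure α} {f g : α → ℝ}
    (hf : MemLp f 2 μ) (hg : MemLp g 2 μ) :
    ∫ x, |f x| * |g x| ∂μ ≤ √(∫ x, f x ^ 2 ∂μ) * √(∫ x, g x ^ 2 ∂μ) := by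
  have h := integral_mul_le_Lp_mul_Lq_of_nonneg (μ := μ) (f := fun x => |f x|) (g := fun x => |g x|)
    Real.HolderConjugate.two_two (Eventually.of_forall fun x => abs_nonneg _)
    (Eventually.of_forall fun x => abs_nonneg _) (by simpa using hf.norm) (by simpa using hg.norm)
  simpa only [Real.rpow_two, sq_abs, Real.sqrt_eq_rpow] using h

/-! ### Curls -/

/-- The antisymmetric part of a matrix, as a vector. Indices are added in `Fin 3`, that is,
cyclically. -/
def curlMap : (E3 →L[ℝ] E3) →L[ℝ] E3 :=
  LinearMap.toContinuousLinearMap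
    { toFun := fun D => WithLp.toLp 2 fun i => D (EuclideanSpace.single (i + 1) 1) (i + 2) -
        D (EuclideanSpace.single (i + 2) 1) (i + 1)
      map_add' := fun D D' => by ext i; simp; ring
      map_smul' := fun c D => by ext i; simp; ring }

/-- The curl of a vector field. -/
def curl (f : E3 → E3) (x : E3) : E3 := curlMap (fderiv ℝ f x)

theorem curl_apply (f : E3 → E3) (x : E3) (i : Fin 3) : curl f x i =
    fderiv ℝ f x (EuclideanSpace.single (i + 1) 1) (i + 2) -
      fderiv ℝ f x (EuclideanSpace.single (i + 2) 1) (i + 1) := rfl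

theorem contDiff_curl {f : E3 → E3} (hf : ContDiff ℝ ∞ f) : ContDiff ℝ ∞ (curl f) :=
  curlMap.contDiff.comp (hf.fderiv_right (by simp))

theorem divergence_curl {f : E3 → E3} (hf : ContDiff ℝ ∞ f) (x : E3) :
    divergence (curl f) x = 0 := by
  have hd : DifferentiableAt ℝ (fderiv ℝ f) x :=
    (hf.fderiv_right (m := ∞) (by simp)).differentiable (by simp) x
  have h1 : ∀ y, fderiv ℝ (curl f) x y = curlMap (fderiv ℝ (fderiv ℝ f) x y) := fun y => by
    have : HasFDerivAt (curl f) (curlMap.comp (fderiv ℝ (fderiv ℝ f) x)) x :=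
      curlMap.hasFDerivAt.comp x hd.hasFDerivAt
    rw [this.fderiv]; rfl
  have hs : ∀ y z, fderiv ℝ (fderiv ℝ f) x y z = fderiv ℝ (fderiv ℝ f) x z y :=
    (hf.contDiffAt (x := x)).isSymmSndFDerivAt (by
      rw [minSmoothness_of_isRCLikeNormedField]; exact WithTop.coe_le_coe.2 (le_top : (2 : ℕ∞) ≤ ⊤))
  have hc : ∀ (D : E3 →L[ℝ] E3) (i : Fin 3), curlMap D i =
    D (EuclideanSpace.single (i + 1) 1) (i + 2) -
      D (EuclideanSpace.single (i + 2) 1) (i + 1) := fun D i => rfl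
  simp only [divergence, h1, hc, Fin.sum_univ_three, Fin.isValue, show (1 : Fin 3) + 1 = 2 from rfl,
    show (1 : Fin 3) + 2 = 0 from rfl, show (2 : Fin 3) + 1 = 0 from rfl,
    show (2 : Fin 3) + 2 = 1 from rfl, zero_add]
  rw [hs (EuclideanSpace.single 1 1) (EuclideanSpace.single 0 1),
    hs (EuclideanSpace.single 2 1) (EuclideanSpace.single 0 1),
    hs (EuclideanSpace.single 2 1) (EuclideanSpace.single 1 1)]
  ring

/-! ### Frequency localisation -/

/-- The frequencies `1 / (n + 1) ≤ |ξ| ≤ n + 1`. High frequencies are removed for smoothness, and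
low frequencies so that the vector potential stays in `L²`. -/
def annulus (n : ℕ) : Set E3 := {ξ | ((n : ℝ) + 1)⁻¹ ≤ ‖ξ‖ ∧ ‖ξ‖ ≤ n + 1}

theorem measurableSet_annulus (n : ℕ) : MeasurableSet (annulus n) :=
  (measurableSet_le measurable_const measurable_norm).inter
    (measurableSet_le measurable_norm measurable_const)

theorem eventually_mem_annulus {ξ : E3} (hξ : ξ ≠ 0) : ∀ᶠ n in atTop, ξ ∈ annulus n := by
  have h1 : Tendsto (fun n : ℕ => ((n : ℝ) + 1)⁻¹) atTop (𝓝 0) := by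
    simpa using tendsto_one_div_add_atTop_nhds_zero_nat (𝕜 := ℝ)
  have h2 : Tendsto (fun n : ℕ => (n : ℝ) + 1) atTop atTop :=
    tendsto_atTop_add_const_right _ _ tendsto_natCast_atTop_atTop
  filter_upwards [h1.eventually_le_const (norm_pos_iff.2 hξ), h2.eventually_ge_atTop ‖ξ‖] with n a b
  exact ⟨a, b⟩

/-- The Fourier transform of `v`, restricted to the frequencies of the `n`-th annulus. -/
def bandSym (n : ℕ) (v : L2) (i : Fin 3) : E3 → ℂ := (annulus n).indicator (vhat v i)

theorem norm_bandSym_le (n : ℕ) (v : L2) (i : Fin 3) (ξ : E3) : ‖bandSym n v i ξ‖ ≤ ‖vhat v i ξ‖ :=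
  norm_indicator_le_norm_self _ _

theorem band_bandSym (n : ℕ) (v : L2) (i : Fin 3) : Band (bandSym n v i) :=
  ⟨(memLp_vhat v i).indicator (measurableSet_annulus n), n + 1, fun ξ hξ => by
    rw [bandSym, indicator_of_notMem]
    exact fun h => absurd h.2 (not_le.2 hξ)⟩

/-- The smooth field whose Fourier transform is that of `v`, restricted to an annulus. -/
def mollify (n : ℕ) (v : L2) : E3 → E3 := field (bandSym n v)

theorem nice_mollify (n : ℕ) (v : L2) : Nice (mollify n v) := nice_field (band_bandSym n v)

theorem component_add (i : Fin 3) (v w : L2) : component i (v + w) = component i v +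
    component i w :=
  map_add (ContinuousLinearMap.compLpL 2 volume
    (Complex.ofRealCLM.comp (EuclideanSpace.proj i : E3 →L[ℝ] ℝ))) v w

theorem component_smul (i : Fin 3) (c : ℝ) (v : L2) :
    component i (c • v) = (c : ℂ) • component i v := by
  have := map_smul (ContinuousLinearMap.compLpL 2 volume
    (Complex.ofRealCLM.comp (EuclideanSpace.proj i : E3 →L[ℝ] ℝ))) c v
  refine this.trans ?_
  ext1
  filter_upwards [Lp.coeFn_smul (c : ℂ) (component i v),
    Lp.coeFn_smul c (component i v)] with x h1 h2
  rw [h1]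
  refine h2.trans ?_
  simp

theorem vhat_add (v w : L2) (i : Fin 3) : vhat (v + w) i =ᵐ[volume] fun ξ => vhat v i ξ +
    vhat w i ξ := by
  rw [vhat, component_add, FourierTransform.fourier_add]
  exact Lp.coeFn_add _ _

theorem vhat_smul (c : ℝ) (v : L2) (i : Fin 3) :
    vhat (c • v) i =ᵐ[volume] fun ξ => (c : ℂ) * vhat v i ξ := by
  rw [vhat, component_smul, FourierTransform.fourier_smul]
  exact Lp.coeFn_smul _ _

theorem mollify_add (n : ℕ) (v w : L2) (x : E3) :
    mollify n (v + w) x = mollify n v x + mollify n w x := by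
  ext i
  have h : bandSym n (v + w) i =ᵐ[volume] fun ξ => bandSym n v i ξ + bandSym n w i ξ := by
    filter_upwards [vhat_add v w i] with ξ hξ
    by_cases h : ξ ∈ annulus n <;> simp [bandSym, h, hξ]
  simp only [mollify, field_apply, PiLp.add_apply]
  rw [reInv_congr_ae h, reInv_add (band_bandSym n v i).integrable (band_bandSym n w i).integrable]

theorem mollify_smul (n : ℕ) (c : ℝ) (v : L2) (x : E3) :
    mollify n (c • v) x = c • mollify n v x := by
  ext i
  have h : bandSym n (c • v) i =ᵐ[volume] fun ξ => c * bandSym n v i ξ := by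
    filter_upwards [vhat_smul c v i] with ξ hξ
    by_cases h : ξ ∈ annulus n <;> simp [bandSym, h, hξ]
  simp only [mollify, field_apply, PiLp.smul_apply, smul_eq_mul]
  rw [reInv_congr_ae h, reInv_smul]

/-- Frequency localisation as an operator on `L²`. -/
def mollifyL2 (n : ℕ) : L2 →L[ℝ] L2 :=
  LinearMap.mkContinuous
    { toFun := fun v => (nice_mollify n v).memLp_self.toLp (mollify n v)
      map_add' := fun v w => by
        rw [← MemLp.toLp_add]
        exact MemLp.toLp_congr _ _ (Eventually.of_forall (mollify_add n v w))
      map_smul' := fun c v => by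
        rw [RingHom.id_apply, ← MemLp.toLp_const_smul]
        exact MemLp.toLp_congr _ _ (Eventually.of_forall (mollify_smul n c v)) } 1 fun v => by
    refine abs_le_of_sq_le_sq' ?_ (by positivity) |>.2
    rw [one_mul, Lp.norm_sq_eq_integral, ← sum_integral_norm_sq_vhat v]
    calc ∫ x, ‖((nice_mollify n v).memLp_self.toLp (mollify n v) : L2) x‖ ^ 2
        = ∫ x, ‖mollify n v x‖ ^ 2 := by
          apply integral_congr_ae
          filter_upwards [(nice_mollify n v).memLp_self.coeFn_toLp] with x hx
          rw [hx]
      _ ≤ ∑ i, ∫ ξ, ‖bandSym n v i ξ‖ ^ 2 := integral_norm_sq_field_le (band_bandSym n v)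
      _ ≤ _ := Finset.sum_le_sum fun i _ => integral_mono
          (band_bandSym n v i).memLp.norm.integrable_sq (memLp_vhat v i).norm.integrable_sq
          fun ξ => by have := norm_bandSym_le n v i ξ; gcongr

theorem coeFn_mollifyL2 (n : ℕ) (v : L2) : mollifyL2 n v =ᵐ[volume] mollify n v :=
  (nice_mollify n v).memLp_self.coeFn_toLp

theorem norm_mollifyL2_le (n : ℕ) (v : L2) : ‖mollifyL2 n v‖ ≤ ‖v‖ := by
  have := (mollifyL2 n).le_of_opNorm_le
    (LinearMap.mkContinuous_norm_le _ zero_le_one _) v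
  simpa using this

theorem inner_L2_eq (v w : L2) : ⟪v, w⟫ = ∫ x, ⟪v x, w x⟫ := L2.inner_def v w

theorem inner_mollifyL2 (n : ℕ) (z v : L2) : ⟪z, mollifyL2 n v⟫ =
    ∑ i, ∫ ξ, ((starRingEnd ℂ) (vhat z i ξ) * bandSym n v i ξ).re := by
  rw [← integral_inner_field (band_bandSym n v), inner_L2_eq]
  apply integral_congr_ae
  filter_upwards [coeFn_mollifyL2 n v] with x hx
  rw [hx]; rfl

theorem inner_eq_sum_vhat (z v : L2) : ⟪z, v⟫ =
    ∑ i, ∫ ξ, ((starRingEnd ℂ) (vhat z i ξ) * vhat v i ξ).re := by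
  have h1 : ∀ i, ∫ x, z x i * v x i = ∫ ξ, ((starRingEnd ℂ) (vhat z i ξ) * vhat v i ξ).re := by
    intro i
    have h := Lp.inner_fourier_eq (component i z) (component i v)
    rw [L2.inner_def, L2.inner_def] at h
    have h' := congrArg Complex.re h
    rw [← reCLM_apply, ← reCLM_apply,
      ← ContinuousLinearMap.integral_comp_comm _ (L2.integrable_inner _ _),
      ← ContinuousLinearMap.integral_comp_comm _ (L2.integrable_inner _ _)] at h'
    calc _ = _ := ?_
      _ = _ := h'.symm
      _ = _ := ?_
    · apply integral_congr_ae
      filter_upwards [coeFn_component i z, coeFn_component i v] with x hx hx'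
      rw [RCLike.inner_apply, hx, hx', conj_ofReal, ← ofReal_mul, reCLM_apply, ofReal_re, mul_comm]
    · refine integral_congr_ae (Eventually.of_forall fun ξ => ?_)
      simp only [RCLike.inner_apply, reCLM_apply]
      rw [mul_comm]
      rfl
  simp only [← h1]
  rw [inner_L2_eq, ← integral_finsetSum Finset.univ (f := fun i x => z x i * v x i)
    fun i _ => (memLp_coord z i).integrable_mul (memLp_coord v i)]
  simp only [inner_E3]

theorem ae_ne_zero : ∀ᵐ ξ : E3, ξ ≠ 0 := by
  simp [ae_iff, measure_singleton]

theorem tendsto_bandSym (v : L2) (i : Fin 3) :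
    ∀ᵐ ξ : E3, Tendsto (fun n => bandSym n v i ξ) atTop (𝓝 (vhat v i ξ)) := by
  filter_upwards [ae_ne_zero] with ξ hξ
  refine tendsto_const_nhds.congr' ?_
  filter_upwards [eventually_mem_annulus hξ] with n hn
  rw [bandSym, indicator_of_mem hn]

theorem tendsto_inner_mollifyL2 (z v : L2) :
    Tendsto (fun n => ⟪z, mollifyL2 n v⟫) atTop (𝓝 ⟪z, v⟫) := by
  simp only [inner_mollifyL2]
  rw [inner_eq_sum_vhat]
  refine tendsto_finsetSum _ fun i _ => ?_
  refine tendsto_integral_of_dominated_convergence (fun ξ => ‖vhat z i ξ‖ * ‖vhat v i ξ‖)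
    (fun n => ?_) ((memLp_vhat z i).norm.integrable_mul (memLp_vhat v i).norm) (fun n => ?_) ?_
  · exact ((memLp_vhat z i).star.1.mul (band_bandSym n v i).memLp.1).re
  · refine Eventually.of_forall fun ξ => (Complex.abs_re_le_norm _).trans ?_
    rw [norm_mul, RCLike.norm_conj]
    gcongr
    exact norm_bandSym_le n v i ξ
  · filter_upwards [tendsto_bandSym v i] with ξ hξ
    exact (Complex.continuous_re.tendsto _).comp (hξ.const_mul _)

/-- Weak convergence, together with `‖mollifyL2 n v‖ ≤ ‖v‖`, gives strong convergence. -/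
theorem tendsto_mollifyL2 (v : L2) : Tendsto (fun n => mollifyL2 n v) atTop (𝓝 v) := by
  rw [tendsto_iff_norm_sub_tendsto_zero]
  have h : Tendsto (fun n => 2 * ‖v‖ ^ 2 - 2 * ⟪v, mollifyL2 n v⟫) atTop (𝓝 0) := by
    have := ((tendsto_inner_mollifyL2 v v).const_mul 2).const_sub (2 * ‖v‖ ^ 2)
    rwa [real_inner_self_eq_norm_sq, sub_self] at this
  have h2 : Tendsto (fun n => ‖mollifyL2 n v - v‖ ^ 2) atTop (𝓝 0) := by
    refine squeeze_zero (fun _ => by positivity) (fun n => ?_) h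
    rw [norm_sub_sq_real, real_inner_comm]
    have := norm_mollifyL2_le n v
    have : ‖mollifyL2 n v‖ ^ 2 ≤ ‖v‖ ^ 2 := by gcongr
    linarith
  simpa using h2.sqrt

/-- A vector potential of `mollify n v`, given by the Biot–Savart law on the Fourier side. -/
def potential (n : ℕ) (v : L2) : E3 → E3 := field fun i ξ => (I * ((2 * Real.pi * ‖ξ‖ ^ 2)⁻¹ : ℝ)) *
  (ξ (i + 1) * bandSym n v (i + 2) ξ - ξ (i + 2) * bandSym n v (i + 1) ξ)

theorem band_potential (n : ℕ) (v : L2) (i : Fin 3) : Band fun ξ : E3 =>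
    (I * ((2 * Real.pi * ‖ξ‖ ^ 2)⁻¹ : ℝ)) *
      (ξ (i + 1) * bandSym n v (i + 2) ξ - ξ (i + 2) * bandSym n v (i + 1) ξ) := by
  have h1 : ∀ j k : Fin 3, ∀ c : ℂ, Band fun ξ : E3 => (c * ξ j) * bandSym n v k ξ := fun j k c =>
    (band_bandSym n v k).mul (by fun_prop) fun N => ⟨‖c‖ * N, fun ξ hξ _ => by
      rw [norm_mul, norm_real]; gcongr; exact (PiLp.norm_apply_le ξ j).trans hξ⟩
  have h2 : Band fun ξ : E3 => ξ (i + 1) * bandSym n v (i + 2) ξ - ξ (i + 2) * bandSym n v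
    (i + 1) ξ := by
    simpa [sub_eq_add_neg] using (h1 (i + 1) (i + 2) 1).add (h1 (i + 2) (i + 1) (-1))
  refine h2.mul (by
    have : Measurable fun ξ : E3 => (2 * Real.pi * ‖ξ‖ ^ 2)⁻¹ := by fun_prop
    exact (measurable_const.mul (measurable_ofReal.comp this)).aestronglyMeasurable)
    fun N => ⟨((2 * Real.pi * (((n : ℝ) + 1)⁻¹) ^ 2)⁻¹), fun ξ _ h0 => ?_⟩
  have hξ : ξ ∈ annulus n := by
    by_contra h
    simp [bandSym, h] at h0
  rw [norm_mul, norm_I, one_mul, norm_real, Real.norm_of_nonneg (by positivity)]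
  have := hξ.1
  gcongr

/-- The identity `iξ × (i ξ × v̂) = |ξ|² v̂` on the Fourier side, which needs `ξ · v̂ = 0`. -/
theorem curl_potential (n : ℕ) (v : L2sigma) : curl (potential n v) = mollify n (v : L2) := by
  ext x i
  rw [curl_apply, potential, fderiv_field (fun j => (band_potential n v j).integrable)
    (fun j => (band_potential n v j).integrable_norm_mul),
    fderiv_field (fun j => (band_potential n v j).integrable)
    (fun j => (band_potential n v j).integrable_norm_mul), field_apply, field_apply,
    ← reInv_sub ((band_potential n v _).dsym_mul _).integrable
      ((band_potential n v _).dsym_mul _).integrable, mollify, field_apply]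
  refine congrFun (reInv_congr_ae ?_) x
  filter_upwards [sum_mul_vhat_eq_zero v] with ξ hξ
  by_cases h : ξ ∈ annulus n
  · simp only [bandSym, indicator_of_mem h]
    have hpos : 0 < ‖ξ‖ := lt_of_lt_of_le (by positivity) h.1
    have hn : ((‖ξ‖ : ℂ)) ^ 2 = ξ 0 ^ 2 + ξ 1 ^ 2 + ξ 2 ^ 2 := by
      have := norm_sq_E3 ξ
      rw [Fin.sum_univ_three] at this
      exact_mod_cast this
    have hn0 : (‖ξ‖ : ℂ) ≠ 0 := by exact_mod_cast hpos.ne'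
    have hpi : (Real.pi : ℂ) ≠ 0 := by exact_mod_cast Real.pi_ne_zero
    rw [Fin.sum_univ_three] at hξ
    simp only [dsym, EuclideanSpace.inner_single_right]
    push_cast
    fin_cases i
    all_goals
      simp only [Fin.zero_eta, Fin.mk_one, Fin.reduceFinMk, Fin.isValue, Fin.reduceAdd, zero_add]
      simp
      field_simp
      rw [hn, I_sq]
      first
      | linear_combination (-(ξ 0 : ℂ)) * hξ
      | linear_combination (-(ξ 1 : ℂ)) * hξ
      | linear_combination (-(ξ 2 : ℂ)) * hξ
  · simp [bandSym, h]

theorem nice_potential (n : ℕ) (v : L2) : Nice (potential n v) := nice_field (band_potential n v)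

/-- The frequency localisation of a divergence-free field is the limit of smooth, compactly
supported divergence-free fields that agree with it near any given point eventually, with
derivatives dominated in `L²`. The approximations are the curls of cutoffs of a vector potential,
which keeps them divergence free. -/
theorem exists_testFields (n : ℕ) (v : L2sigma) :
    ∃ φ : ℕ → E3 → E3, (∀ k, ContDiff ℝ ∞ (φ k)) ∧ (∀ k, HasCompactSupport (φ k)) ∧
      (∀ k x, divergence (φ k) x = 0) ∧ (∀ x, ∀ᶠ k in atTop, φ k =ᶠ[𝓝 x] mollify n v) ∧
      ∃ m : ℕ → E3 → ℝ, (∀ j, MemLp (m j) 2 (volume : Measure E3)) ∧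
        (∀ j, ∃ C : ℝ, ∀ x, m j x ≤ C) ∧ ∀ j k x, ‖iteratedFDeriv ℝ j (φ k) x‖ ≤ m j x := by
  obtain ⟨A, hA, hAc, hAe, m, hm, hmb, hAm⟩ := (nice_potential n v).exists_cutoff
  refine ⟨fun k => curl (A k), fun k => contDiff_curl (hA k), fun k => ?_,
    fun k x => divergence_curl (hA k) x, fun x => ?_, fun j x => ‖curlMap‖ * m (j + 1) x,
    fun j => (hm (j + 1)).const_mul _, fun j => ?_, fun j k x => ?_⟩
  · exact ((hAc k).fderiv ℝ).comp_left (map_zero curlMap)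
  · filter_upwards [hAe x] with k hk
    rw [← curl_potential]
    filter_upwards [hk.fderiv (𝕜 := ℝ)] with y hy
    rw [curl, curl, hy]
  · obtain ⟨C, hC⟩ := hmb (j + 1)
    exact ⟨‖curlMap‖ * C, fun x => mul_le_mul_of_nonneg_left (hC x) (norm_nonneg curlMap)⟩
  · refine (curlMap.norm_iteratedFDeriv_comp_left (f := fderiv ℝ (A k))
      ((hA k).fderiv_right (m := ∞) (by simp)).contDiffAt (by exact_mod_cast le_top)).trans ?_
    rw [norm_iteratedFDeriv_fderiv]
    exact mul_le_mul_of_nonneg_left (hAm _ k x) (norm_nonneg _)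

open scoped BoundedContinuousFunction

/-! ### Multiplication by bounded matrix fields -/

theorem memLp_matMul (D : E3 →ᵇ (E3 →L[ℝ] E3)) (w : L2) :
    MemLp (fun x => D x (w x)) 2 (volume : Measure E3) := by
  refine ((Lp.memLp w).norm.const_mul ‖D‖).mono' ?_ (Eventually.of_forall fun x => ?_)
  · exact (isBoundedBilinearMap_apply (𝕜 := ℝ) (E := E3)
      (F := E3)).continuous.comp_aestronglyMeasurable
      (D.continuous.aestronglyMeasurable.prodMk (Lp.memLp w).1)
  · exact (D x).le_of_opNorm_le (D.norm_coe_le_norm x) _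

/-- Multiplication of `L²` fields by a bounded continuous matrix field. -/
def matMul (D : E3 →ᵇ (E3 →L[ℝ] E3)) : L2 →L[ℝ] L2 :=
  LinearMap.mkContinuous
    { toFun := fun w => (memLp_matMul D w).toLp _
      map_add' := fun v w => by
        rw [← MemLp.toLp_add]
        refine MemLp.toLp_congr _ _ ?_
        filter_upwards [Lp.coeFn_add v w] with x hx
        simp only [hx, Pi.add_apply, map_add]
      map_smul' := fun c v => by
        rw [RingHom.id_apply, ← MemLp.toLp_const_smul]
        refine MemLp.toLp_congr _ _ ?_
        filter_upwards [Lp.coeFn_smul c v] with x hx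
        simp only [hx, Pi.smul_apply, map_smul] } ‖D‖ fun w => by
    refine Lp.norm_le_mul_norm_of_ae_le_mul ?_
    filter_upwards [(memLp_matMul D w).coeFn_toLp] with x hx
    simp only [LinearMap.coe_mk, AddHom.coe_mk]
    rw [hx]
    exact (D x).le_of_opNorm_le (D.norm_coe_le_norm x) _

theorem coeFn_matMul (D : E3 →ᵇ (E3 →L[ℝ] E3)) (w : L2) :
    matMul D w =ᵐ[volume] fun x => D x (w x) := (memLp_matMul D w).coeFn_toLp

theorem norm_matMul_le (D : E3 →ᵇ (E3 →L[ℝ] E3)) (w : L2) : ‖matMul D w‖ ≤ ‖D‖ * ‖w‖ :=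
  (matMul D).le_of_opNorm_le (LinearMap.mkContinuous_norm_le _ (norm_nonneg D) _) w

theorem matMul_add (D D' : E3 →ᵇ (E3 →L[ℝ] E3)) (w : L2) :
    matMul (D + D') w = matMul D w + matMul D' w := by
  ext1
  filter_upwards [coeFn_matMul (D + D') w, coeFn_matMul D w, coeFn_matMul D' w,
    Lp.coeFn_add (matMul D w) (matMul D' w)] with x h1 h2 h3 h4
  rw [h1, h4, Pi.add_apply, h2, h3]
  simp

theorem matMul_smul (c : ℝ) (D : E3 →ᵇ (E3 →L[ℝ] E3)) (w : L2) :
    matMul (c • D) w = c • matMul D w := by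
  ext1
  filter_upwards [coeFn_matMul (c • D) w, coeFn_matMul D w, Lp.coeFn_smul c (matMul D w)]
    with x h1 h2 h4
  rw [h1, h4, Pi.smul_apply, h2]
  simp

theorem matMul_sub (D D' : E3 →ᵇ (E3 →L[ℝ] E3)) (w : L2) :
    matMul (D - D') w = matMul D w - matMul D' w := by
  ext1
  filter_upwards [coeFn_matMul (D - D') w, coeFn_matMul D w, coeFn_matMul D' w,
    Lp.coeFn_sub (matMul D w) (matMul D' w)] with x h1 h2 h3 h4
  rw [h1, h4, Pi.sub_apply, h2, h3]
  simp

theorem inner_matMul (D : E3 →ᵇ (E3 →L[ℝ] E3)) (u w : L2) :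
    ⟪u, matMul D w⟫ = ∫ x, ⟪u x, D x (w x)⟫ := by
  rw [inner_L2_eq]
  apply integral_congr_ae
  filter_upwards [coeFn_matMul D w] with x hx
  rw [hx]

theorem integrable_inner_matMul (D : E3 →ᵇ (E3 →L[ℝ] E3)) (u w : L2) :
    Integrable (fun x => ⟪u x, D x (w x)⟫) (volume : Measure E3) := by
  refine (L2.integrable_inner (𝕜 := ℝ) u (matMul D w)).congr ?_
  filter_upwards [coeFn_matMul D w] with x hx
  rw [hx]

theorem abs_inner_matMul_le (D : E3 →ᵇ (E3 →L[ℝ] E3)) (u w : L2) :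
    |⟪u, matMul D w⟫| ≤ ‖D‖ * (‖u‖ * ‖w‖) := by
  refine (abs_real_inner_le_norm _ _).trans ?_
  calc ‖u‖ * ‖matMul D w‖ ≤ ‖u‖ * (‖D‖ * ‖w‖) := by gcongr; exact norm_matMul_le D w
    _ = _ := by ring

/-! ### Gradients and Laplacians of frequency-localised fields -/

/-- The gradient of a field with bounded, continuous derivative. -/
def boundedGrad (f : E3 → E3) (hf : Continuous (fderiv ℝ f))
    (hb : ∃ C : ℝ, ∀ x, ‖fderiv ℝ f x‖ ≤ C) :
    E3 →ᵇ (E3 →L[ℝ] E3) :=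
  BoundedContinuousFunction.ofNormedAddCommGroup (fderiv ℝ f) hf hb.choose hb.choose_spec

/-- The gradient of a frequency-localised field. -/
def mollifyGrad (n : ℕ) (v : L2) : E3 →ᵇ (E3 →L[ℝ] E3) :=
  boundedGrad (mollify n v) (nice_mollify n v).fderiv.contDiff.continuous
    (nice_mollify n v).fderiv.norm_bounded

@[simp] theorem mollifyGrad_apply (n : ℕ) (v : L2) (x : E3) :
    mollifyGrad n v x = fderiv ℝ (mollify n v) x := rfl

theorem differentiable_mollify (n : ℕ) (v : L2) : Differentiable ℝ (mollify n v) :=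
  (nice_mollify n v).contDiff.differentiable (by simp)

theorem mollifyGrad_add (n : ℕ) (v w : L2) :
    mollifyGrad n (v + w) = mollifyGrad n v + mollifyGrad n w := by
  ext1 x
  have : mollify n (v + w) = fun x => mollify n v x + mollify n w x := funext (mollify_add n v w)
  simp only [mollifyGrad_apply, BoundedContinuousFunction.coe_add, Pi.add_apply, this]
  exact fderiv_fun_add (differentiable_mollify n v x) (differentiable_mollify n w x)

theorem mollifyGrad_smul (n : ℕ) (c : ℝ) (v : L2) :
    mollifyGrad n (c • v) = c • mollifyGrad n v := by
  ext1 x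
  have : mollify n (c • v) = fun x => c • mollify n v x := funext (mollify_smul n c v)
  simp only [mollifyGrad_apply, BoundedContinuousFunction.coe_smul, this]
  exact fderiv_fun_const_smul (differentiable_mollify n v x) c

theorem norm_mollifyGrad_le (n : ℕ) (v : L2) :
    ‖mollifyGrad n v‖ ≤ 2 * Real.pi * ∑ i, ∫ ξ, ‖ξ‖ * ‖bandSym n v i ξ‖ :=
  (BoundedContinuousFunction.norm_le (mul_nonneg (by positivity)
    (Finset.sum_nonneg fun i _ => integral_nonneg fun ξ => by positivity))).2 fun x =>
    norm_fderiv_field_le (fun i => (band_bandSym n v i).integrable)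
      (fun i => (band_bandSym n v i).integrable_norm_mul) x

theorem integral_norm_sq_vhat_le (v : L2) (i : Fin 3) : ∫ ξ, ‖vhat v i ξ‖ ^ 2 ≤ ‖v‖ ^ 2 := by
  rw [← sum_integral_norm_sq_vhat v]
  exact Finset.single_le_sum (f := fun i => ∫ ξ, ‖vhat v i ξ‖ ^ 2)
    (fun i _ => integral_nonneg fun ξ => by positivity) (Finset.mem_univ i)

/-- By the Cauchy–Schwarz inequality on the annulus, which has finite measure. The constant depends
on `n`. -/
theorem exists_norm_mollifyGrad_le (n : ℕ) : ∃ C : ℝ, 0 ≤ C ∧ ∀ v : L2, ‖mollifyGrad n v‖ ≤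
    C * ‖v‖ := by
  have hm : MemLp ((annulus n).indicator fun ξ : E3 => ‖ξ‖) 2 (volume : Measure E3) := by
    have h : MemLp ((annulus n).indicator fun _ : E3 => ((n : ℝ) + 1)) 2 (volume : Measure E3) :=
      memLp_indicator_const 2 (measurableSet_annulus n) _ (Or.inr (ne_of_lt (lt_of_le_of_lt
        (measure_mono fun ξ hξ => mem_closedBall_zero_iff.2 hξ.2)
        (measure_closedBall_lt_top (x := (0 : E3)) (r := (n : ℝ) + 1)))))
    refine h.mono ((measurable_norm.indicator (measurableSet_annulus n)).aestronglyMeasurable)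
      (Eventually.of_forall fun ξ => ?_)
    by_cases hξ : ξ ∈ annulus n
    · simp only [indicator_of_mem hξ, norm_norm]
      exact hξ.2.trans (le_abs_self _)
    · simp [indicator_of_notMem hξ]
  refine ⟨2 * Real.pi * (3 * √(∫ ξ, ((annulus n).indicator (fun ξ : E3 => ‖ξ‖) ξ) ^ 2)),
    by positivity, fun v => (norm_mollifyGrad_le n v).trans ?_⟩
  have h3 : ∀ i, ∫ ξ, ‖ξ‖ * ‖bandSym n v i ξ‖ ≤
      √(∫ ξ, ((annulus n).indicator (fun ξ : E3 => ‖ξ‖) ξ) ^ 2) * ‖v‖ := by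
    intro i
    calc ∫ ξ, ‖ξ‖ * ‖bandSym n v i ξ‖
        = ∫ ξ, |(annulus n).indicator (fun ξ : E3 => ‖ξ‖) ξ| * |‖vhat v i ξ‖| := by
          congr 1
          ext ξ
          by_cases hξ : ξ ∈ annulus n <;> simp [bandSym, hξ]
      _ ≤ _ := integral_mul_le_sqrt hm (memLp_vhat v i).norm
      _ ≤ _ := by
          gcongr
          rw [Real.sqrt_le_left (norm_nonneg _)]
          exact integral_norm_sq_vhat_le v i
  calc 2 * Real.pi * ∑ i, ∫ ξ, ‖ξ‖ * ‖bandSym n v i ξ‖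
      ≤ 2 * Real.pi *
        ∑ _i : Fin 3, √(∫ ξ, ((annulus n).indicator (fun ξ : E3 => ‖ξ‖) ξ) ^ 2) * ‖v‖ := by
        gcongr with i
        exact h3 i
    _ = _ := by
        rw [Finset.sum_const, Finset.card_fin]
        ring

theorem laplacian_mollify (n : ℕ) (v : L2) : Laplacian.laplacian (mollify n v) =
    field fun i ξ => -(4 * Real.pi ^ 2 * ‖ξ‖ ^ 2 : ℝ) * bandSym n v i ξ :=
  funext fun x => laplacian_field (band_bandSym n v) x

theorem band_laplacian (n : ℕ) (v : L2) (i : Fin 3) :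
    Band fun ξ => -(4 * Real.pi ^ 2 * ‖ξ‖ ^ 2 : ℝ) * bandSym n v i ξ :=
  (band_bandSym n v i).mul (by fun_prop) fun N => ⟨4 * Real.pi ^ 2 * N ^ 2, fun ξ hξ _ => by
    rw [norm_neg, norm_real, Real.norm_eq_abs, abs_of_nonneg (by positivity)]
    gcongr⟩

theorem memLp_laplacian_mollify (n : ℕ) (v : L2) :
    MemLp (Laplacian.laplacian (mollify n v)) 2 (volume : Measure E3) := by
  rw [laplacian_mollify]
  exact (nice_field (band_laplacian n v)).memLp_self

/-- The Laplacian of a frequency-localised field, as an element of `L²`. -/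
def mollifyLap (n : ℕ) (v : L2) : L2 := (memLp_laplacian_mollify n v).toLp _

theorem coeFn_mollifyLap (n : ℕ) (v : L2) :
    mollifyLap n v =ᵐ[volume] Laplacian.laplacian (mollify n v) :=
  (memLp_laplacian_mollify n v).coeFn_toLp

theorem contDiffAt_two_mollify (n : ℕ) (v : L2) (x : E3) : ContDiffAt ℝ 2 (mollify n v) x :=
  (contDiff_infty.1 (nice_mollify n v).contDiff 2).contDiffAt

theorem mollifyLap_add (n : ℕ) (v w : L2) : mollifyLap n (v + w) = mollifyLap n v +
    mollifyLap n w := by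
  rw [mollifyLap, mollifyLap, mollifyLap, ← MemLp.toLp_add]
  refine MemLp.toLp_congr _ _ (Eventually.of_forall fun x => ?_)
  have : mollify n (v + w) = mollify n v + mollify n w := funext (mollify_add n v w)
  rw [this, Pi.add_apply]
  exact (contDiffAt_two_mollify n v x).laplacian_add (contDiffAt_two_mollify n w x)

theorem mollifyLap_smul (n : ℕ) (c : ℝ) (v : L2) : mollifyLap n (c • v) = c • mollifyLap n v := by
  rw [mollifyLap, mollifyLap, ← MemLp.toLp_const_smul]
  refine MemLp.toLp_congr _ _ (Eventually.of_forall fun x => ?_)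
  have : mollify n (c • v) = c • mollify n v := funext (mollify_smul n c v)
  rw [this, Pi.smul_apply]
  exact InnerProductSpace.laplacian_smul c (contDiffAt_two_mollify n v x)

theorem norm_mollifyLap_sq_le (n : ℕ) (v : L2) :
    ‖mollifyLap n v‖ ^ 2 ≤ ∑ i, ∫ ξ, ((4 * Real.pi ^ 2 * ‖ξ‖ ^ 2) * ‖bandSym n v i ξ‖) ^ 2 := by
  rw [Lp.norm_sq_eq_integral]
  calc ∫ x, ‖mollifyLap n v x‖ ^ 2 = ∫ x, ‖Laplacian.laplacian (mollify n v) x‖ ^ 2 := by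
        apply integral_congr_ae
        filter_upwards [coeFn_mollifyLap n v] with x hx
        rw [hx]
    _ ≤ ∑ i, ∫ ξ, ‖-(4 * Real.pi ^ 2 * ‖ξ‖ ^ 2 : ℝ) * bandSym n v i ξ‖ ^ 2 := by
        rw [laplacian_mollify]
        exact integral_norm_sq_field_le (band_laplacian n v)
    _ = _ := by
        congr 1
        ext i
        congr 1
        ext ξ
        rw [norm_mul, norm_neg, norm_real, Real.norm_of_nonneg (by positivity)]

theorem exists_norm_mollifyLap_le (n : ℕ) : ∃ C : ℝ, 0 ≤ C ∧ ∀ v : L2, ‖mollifyLap n v‖ ≤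
    C * ‖v‖ := by
  refine ⟨4 * Real.pi ^ 2 * ((n : ℝ) + 1) ^ 2, by positivity, fun v => ?_⟩
  suffices h : ‖mollifyLap n v‖ ^ 2 ≤ (4 * Real.pi ^ 2 * ((n : ℝ) + 1) ^ 2 * ‖v‖) ^ 2 from
    (abs_le_of_sq_le_sq' h (by positivity)).2
  refine (norm_mollifyLap_sq_le n v).trans ?_
  rw [mul_pow, ← sum_integral_norm_sq_vhat v, Finset.mul_sum]
  refine Finset.sum_le_sum fun i _ => ?_
  rw [← integral_const_mul]
  refine integral_mono_of_nonneg (Eventually.of_forall fun ξ => by positivity)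
    ((memLp_vhat v i).norm.integrable_sq.const_mul _) (Eventually.of_forall fun ξ => ?_)
  simp only
  rw [← mul_pow]
  by_cases hξ : ξ ∈ annulus n
  · rw [bandSym, indicator_of_mem hξ]
    have := hξ.2
    gcongr
  · rw [bandSym, indicator_of_notMem hξ]
    rw [norm_zero, mul_zero, zero_pow two_ne_zero]
    exact sq_nonneg _

/-! ### The space `L²_σ` -/

theorem isClosed_L2sigma : IsClosed (L2sigma : Set L2) := by
  have h : (L2sigma : Set L2) = ⋂ (ψ : E3 → ℝ) (_ : ContDiff ℝ ∞ ψ) (_ : HasCompactSupport ψ),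
      {v : L2 | ∫ x, fderiv ℝ ψ x (v x) = 0} := by
    ext v; simp [L2sigma]
  rw [h]
  refine isClosed_iInter fun ψ => isClosed_iInter fun hψ => isClosed_iInter fun hc => ?_
  have hg : MemLp (gradient ψ) 2 (volume : Measure E3) := by
    have hcont : Continuous (gradient ψ) :=
      (InnerProductSpace.toDual ℝ E3).symm.continuous.comp (hψ.continuous_fderiv (by simp))
    exact hcont.memLp_of_hasCompactSupport ((hc.fderiv ℝ).comp_left (map_zero _))
  have : ∀ v : L2, ∫ x, fderiv ℝ ψ x (v x) = ⟪hg.toLp (gradient ψ), v⟫ := by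
    intro v
    rw [inner_L2_eq]
    apply integral_congr_ae
    filter_upwards [hg.coeFn_toLp] with x hx
    rw [hx, gradient, InnerProductSpace.toDual_symm_apply]
  simp only [this]
  exact isClosed_eq (continuous_const.inner continuous_id) continuous_const

instance : CompleteSpace L2sigma := isClosed_L2sigma.completeSpace_coe

/-- The adjoint of the frequency localisation restricted to `L²_σ`. By duality this is the frequency
localisation, followed by the projection to `L²_σ`. -/
def smooth (n : ℕ) : L2 →L[ℝ] L2sigma :=
  ContinuousLinearMap.adjoint ((mollifyL2 n).comp L2sigma.subtypeL)

theorem inner_smooth (n : ℕ) (u : L2) (v : L2sigma) : ⟪smooth n u, v⟫ = ⟪u, mollifyL2 n v⟫ :=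
  ContinuousLinearMap.adjoint_inner_left _ _ _

theorem norm_smooth_le (n : ℕ) (u : L2) : ‖smooth n u‖ ≤ ‖u‖ := by
  have h : ‖smooth n u‖ ^ 2 ≤ ‖u‖ * ‖smooth n u‖ := by
    rw [← real_inner_self_eq_norm_sq, inner_smooth]
    refine (real_inner_le_norm _ _).trans ?_
    gcongr
    exact norm_mollifyL2_le _ _
  by_contra! hlt
  nlinarith [norm_nonneg u]

/-- The functional `v ↦ ν ∫ u · Δ v_n + ∫ u ⊗ u : ∇ v_n`, where `v_n` is the frequency localisation
of `v`. -/
def forceFun (n : ℕ) (ν : ℝ) (u : L2) : L2sigma →L[ℝ] ℝ :=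
  LinearMap.mkContinuousOfExistsBound
    { toFun := fun v => ν * ⟪u, mollifyLap n v⟫ + ⟪u, matMul (mollifyGrad n v) u⟫
      map_add' := fun v w => by
        simp only [Submodule.coe_add, mollifyLap_add, mollifyGrad_add, matMul_add, inner_add_right]
        ring
      map_smul' := fun c v => by
        simp only [Submodule.coe_smul, mollifyLap_smul, mollifyGrad_smul, matMul_smul,
          real_inner_smul_right, RingHom.id_apply, smul_eq_mul]
        ring } (by
    obtain ⟨C, hC, hCv⟩ := exists_norm_mollifyGrad_le n
    obtain ⟨K, hK, hKv⟩ := exists_norm_mollifyLap_le n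
    refine ⟨|ν| * (‖u‖ * K) + C * (‖u‖ * ‖u‖), fun v => ?_⟩
    have h1 : |⟪u, mollifyLap n v⟫| ≤ ‖u‖ * (K * ‖v‖) :=
      (abs_real_inner_le_norm _ _).trans (by gcongr; exact hKv v)
    have h2 : |⟪u, matMul (mollifyGrad n v) u⟫| ≤ C * ‖v‖ * (‖u‖ * ‖u‖) :=
      (abs_inner_matMul_le _ _ _).trans (by gcongr; exact hCv v)
    calc ‖ν * ⟪u, mollifyLap n v⟫ + ⟪u, matMul (mollifyGrad n v) u⟫‖
        ≤ |ν| * |⟪u, mollifyLap n v⟫| + |⟪u, matMul (mollifyGrad n v) u⟫| := by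
          refine (norm_add_le _ _).trans_eq ?_
          rw [Real.norm_eq_abs, Real.norm_eq_abs, abs_mul]
      _ ≤ |ν| * (‖u‖ * (K * ‖v‖)) + C * ‖v‖ * (‖u‖ * ‖u‖) := by gcongr
      _ = _ := by ring)

/-- The frequency-localised right-hand side `P(νΔu - (u · ∇)u)` of the equation, as the Riesz
representative of `forceFun`. -/
def force (n : ℕ) (ν : ℝ) (u : L2) : L2sigma :=
  (InnerProductSpace.toDual ℝ L2sigma).symm (forceFun n ν u)

theorem inner_force (n : ℕ) (ν : ℝ) (u : L2) (v : L2sigma) :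
    ⟪force n ν u, v⟫ = ν * ⟪u, mollifyLap n v⟫ + ⟪u, matMul (mollifyGrad n v) u⟫ := by
  rw [force, InnerProductSpace.toDual_symm_apply]
  rfl

theorem norm_le_of_inner_le {H : Type*} [NormedAddCommGroup H] [InnerProductSpace ℝ H] {x : H}
    {M : ℝ}
    (hM : 0 ≤ M) (h : ∀ v, ⟪x, v⟫ ≤ M * ‖v‖) : ‖x‖ ≤ M := by
  have h2 := h x
  rw [real_inner_self_eq_norm_sq] at h2
  by_contra! hlt
  nlinarith

theorem exists_norm_force_le (n : ℕ) (ν M : ℝ) : ∃ C : ℝ, ∀ u : L2, ‖u‖ ≤ M → ‖force n ν u‖ ≤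
    C := by
  obtain ⟨C, hC, hCv⟩ := exists_norm_mollifyGrad_le n
  obtain ⟨K, hK, hKv⟩ := exists_norm_mollifyLap_le n
  refine ⟨|ν| * (M * K) + C * (M * M), fun u hu => ?_⟩
  have hM : 0 ≤ M := (norm_nonneg u).trans hu
  refine norm_le_of_inner_le (by positivity) fun v => ?_
  rw [inner_force]
  have h1 : |⟪u, mollifyLap n v⟫| ≤ M * (K * ‖v‖) :=
    (abs_real_inner_le_norm _ _).trans (by gcongr; exact hKv v)
  have h2 : |⟪u, matMul (mollifyGrad n v) u⟫| ≤ C * ‖v‖ * (M * M) :=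
    (abs_inner_matMul_le _ _ _).trans (by gcongr; exact hCv v)
  calc ν * ⟪u, mollifyLap n v⟫ + ⟪u, matMul (mollifyGrad n v) u⟫
      ≤ |ν| * |⟪u, mollifyLap n v⟫| + |⟪u, matMul (mollifyGrad n v) u⟫| := by
        rw [← abs_mul]; exact add_le_add (le_abs_self _) (le_abs_self _)
    _ ≤ |ν| * (M * (K * ‖v‖)) + C * ‖v‖ * (M * M) := by gcongr
    _ = _ := by ring

end Fluid

namespace Fluid

/-! ### Measurability in separable Hilbert spaces -/

instance : SecondCountableTopology L2 := by
  have : Fact ((2 : ℝ≥0∞) ≠ ⊤) := ⟨ENNReal.ofNat_ne_top⟩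
  infer_instance

instance : SecondCountableTopology L2sigma :=
  TopologicalSpace.Subtype.secondCountableTopology (L2sigma : Set L2)

theorem Orthonormal.countable {H ι : Type*} [NormedAddCommGroup H] [InnerProductSpace ℝ H]
    [TopologicalSpace.SeparableSpace H] {b : ι → H} (hb : Orthonormal ℝ b) : Countable ι := by
  have hd : Pairwise (Function.onFun Disjoint fun i => Metric.ball (b i) (1 / 2)) := by
    intro i j hij
    refine Metric.ball_disjoint_ball ?_
    rw [dist_eq_norm]
    have h : ‖b i - b j‖ ^ 2 = 2 := by
      rw [norm_sub_sq_real, hb.1, hb.1, hb.2 hij]; norm_num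
    have : 1 ≤ ‖b i - b j‖ ^ 2 := by rw [h]; norm_num
    have := (one_le_sq_iff₀ (norm_nonneg (b i - b j))).1 this
    linarith
  exact hd.countable_of_isOpen_disjoint (fun i => Metric.isOpen_ball)
    fun i => Metric.nonempty_ball.2 (by norm_num)

/-- Pettis' theorem in a separable Hilbert space: weak measurability implies measurability. -/
theorem aestronglyMeasurable_of_inner {α H : Type*} [MeasurableSpace α] {μ : Measure α}
    [NormedAddCommGroup H] [InnerProductSpace ℝ H] [CompleteSpace H]
    [TopologicalSpace.SeparableSpace H] {f : α → H}
    (hf : ∀ v, AEStronglyMeasurable (fun t => ⟪v, f t⟫) μ) : AEStronglyMeasurable f μ := by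
  obtain ⟨w, b, -⟩ := exists_hilbertBasis ℝ H
  have : Countable w := Orthonormal.countable b.orthonormal
  refine aestronglyMeasurable_of_tendsto_ae (atTop : Filter (Finset w))
    (f := fun s t => ∑ i ∈ s, ⟪b i, f t⟫ • b i) (fun s => ?_) (Eventually.of_forall fun t => ?_)
  · exact Finset.aestronglyMeasurable_fun_sum _ fun i _ => (hf (b i)).smul_const _
  · simpa only [HasSum, HilbertBasis.repr_apply_apply] using! b.hasSum_repr (f t)

/-! ### Locally bounded curves -/

/-- Measurable curves on `(0, ∞)` that are bounded on bounded time intervals. -/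
structure LocBdd {E : Type*} [NormedAddCommGroup E] (p : ℝ → E) : Prop where
  meas : AEStronglyMeasurable p (volume.restrict (Ioi 0))
  bdd : ∀ T : ℝ, 0 < T → ∃ M : ℝ, 0 ≤ M ∧ ∀ᵐ t ∂volume.restrict (Ioi (0 : ℝ)), t ≤ T → ‖p t‖ ≤ M

theorem LocBdd.intervalIntegrable {E : Type*} [NormedAddCommGroup E] {p : ℝ → E} (hp : LocBdd p)
    {a b : ℝ} (ha : 0 ≤ a) (hb : 0 ≤ b) :
    IntervalIntegrable p volume a b := by
  obtain ⟨M, -, hM⟩ := hp.bdd (max a b + 1) (by positivity)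
  have hsub : uIoc a b ⊆ Ioi 0 := fun t ht => lt_of_le_of_lt (le_min ha hb) ht.1
  rw [intervalIntegrable_iff]
  refine IntegrableOn.of_bound (s := uIoc a b) measure_Ioc_lt_top (hp.meas.mono_set hsub) M ?_
  rw [ae_restrict_iff' measurableSet_uIoc]
  filter_upwards [(ae_restrict_iff' measurableSet_Ioi).1 hM] with t ht htm
  exact ht (hsub htm) (htm.2.trans (by linarith))

theorem LocBdd.of_continuousOn {E : Type*} [NormedAddCommGroup E] {p : ℝ → E}
    (hp : ContinuousOn p (Ici 0)) : LocBdd p where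
  meas := (hp.mono Ioi_subset_Ici_self).aestronglyMeasurable measurableSet_Ioi
  bdd T _ := by
    obtain ⟨M, hM⟩ := (isCompact_Icc (a := (0 : ℝ)) (b := T)).exists_bound_of_continuousOn
      (hp.mono Icc_subset_Ici_self)
    refine ⟨max M 0, le_max_right _ _, ?_⟩
    filter_upwards [ae_restrict_mem measurableSet_Ioi] with t ht htT
    exact (hM t ⟨le_of_lt ht, htT⟩).trans (le_max_left _ _)

theorem LocBdd.add {E : Type*} [NormedAddCommGroup E] {p q : ℝ → E} (hp : LocBdd p)
    (hq : LocBdd q) : LocBdd fun t => p t + q t where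
  meas := hp.meas.add hq.meas
  bdd T hT := by
    obtain ⟨M, hM0, hM⟩ := hp.bdd T hT
    obtain ⟨N, hN0, hN⟩ := hq.bdd T hT
    refine ⟨M + N, by positivity, ?_⟩
    filter_upwards [hM, hN] with t h1 h2 ht
    exact (norm_add_le _ _).trans (add_le_add (h1 ht) (h2 ht))

theorem LocBdd.const {E : Type*} [NormedAddCommGroup E] (c : E) : LocBdd fun _ => c :=
  LocBdd.of_continuousOn continuousOn_const

theorem LocBdd.of_continuous {E : Type*} [NormedAddCommGroup E] {p : ℝ → E} (hp : Continuous p) :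
    LocBdd p :=
  LocBdd.of_continuousOn hp.continuousOn

theorem exists_bound_of_compactSupport {E : Type*} [NormedAddCommGroup E] {θ : ℝ → E}
    (hc : HasCompactSupport θ) :
    ∃ T : ℝ, 0 < T ∧ ∀ t, t ∉ Icc (-T) T → t ∉ tsupport θ := by
  obtain ⟨T, hT⟩ := hc.isCompact.isBounded.subset_closedBall 0
  refine ⟨max T 1, lt_of_lt_of_le one_pos (le_max_right _ _), fun t ht h => ht ?_⟩
  have := hT h
  rw [Real.closedBall_eq_Icc] at this
  constructor
  · have := this.1; have := le_max_left T 1; linarith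
  · have := this.2; have := le_max_left T 1; linarith

section Curves

variable {E F G : Type*} [NormedAddCommGroup E] [NormedSpace ℝ E] [NormedAddCommGroup F]
  [NormedSpace ℝ F] [NormedAddCommGroup G] [NormedSpace ℝ G]

theorem LocBdd.bilin (B : E →L[ℝ] F →L[ℝ] G) {p : ℝ → E} {q : ℝ → F} (hp : LocBdd p)
    (hq : LocBdd q) :
    LocBdd fun t => B (p t) (q t) where
  meas := B.aestronglyMeasurable_comp₂ hp.meas hq.meas
  bdd T hT := by
    obtain ⟨M, hM0, hM⟩ := hp.bdd T hT
    obtain ⟨N, hN0, hN⟩ := hq.bdd T hT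
    refine ⟨‖B‖ * M * N, by positivity, ?_⟩
    filter_upwards [hM, hN] with t h1 h2 ht
    refine (B.le_opNorm₂ _ _).trans ?_
    have := h1 ht
    have := h2 ht
    gcongr

theorem LocBdd.norm_integral_le {p : ℝ → E} (hp : LocBdd p) {T : ℝ} (hT : 0 < T) :
    ∃ M : ℝ, 0 ≤ M ∧ ∀ s ∈ Icc 0 T, ∀ t ∈ Icc 0 T, ‖∫ τ in s..t, p τ‖ ≤ M * |t - s| := by
  obtain ⟨M, hM0, hM⟩ := hp.bdd T hT
  refine ⟨M, hM0, fun s hs t ht => intervalIntegral.norm_integral_le_of_norm_le_const_ae ?_⟩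
  filter_upwards [(ae_restrict_iff' measurableSet_Ioi).1 hM] with τ hτ hτm
  exact hτ (lt_of_le_of_lt (le_min hs.1 ht.1) hτm.1) (hτm.2.trans (max_le hs.2 ht.2))

theorem LocBdd.continuousOn_primitive {p : ℝ → E} (hp : LocBdd p) (c : E) :
    ContinuousOn (fun t => c + ∫ τ in (0 : ℝ)..t, p τ) (Ici 0) := by
  intro t (ht : 0 ≤ t)
  have h := intervalIntegral.continuousOn_primitive_interval'
    (hp.intervalIntegrable le_rfl (by linarith : 0 ≤ t + 1)) left_mem_uIcc
  rw [uIcc_of_le (by linarith)] at h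
  refine continuousWithinAt_const.add ((h t ⟨ht, by linarith⟩).mono_of_mem_nhdsWithin ?_)
  exact inter_mem self_mem_nhdsWithin (mem_nhdsWithin_of_mem_nhds (Iic_mem_nhds (by linarith)))

/-- The product rule for primitives of bounded curves. Such curves are differentiable only almost
everywhere, but Lipschitz continuous, so the difference of the two sides, whose derivative vanishes
almost everywhere, is constant. -/
theorem LocBdd.integral_bilin [CompleteSpace E] [CompleteSpace F] [CompleteSpace G]
    (B : E →L[ℝ] F →L[ℝ] G) {p P : ℝ → E} {q Q : ℝ → F}
    (hp : LocBdd p) (hq : LocBdd q) (hP : ∀ t, 0 ≤ t → P t = P 0 + ∫ τ in (0 : ℝ)..t, p τ)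
    (hQ : ∀ t, 0 ≤ t → Q t = Q 0 + ∫ τ in (0 : ℝ)..t, q τ) {T : ℝ} (hT : 0 ≤ T) :
    ∫ t in (0 : ℝ)..T, (B (p t) (Q t) + B (P t) (q t)) = B (P T) (Q T) - B (P 0) (Q 0) := by
  obtain rfl | hT := hT.eq_or_lt
  · simp
  have hPc : LocBdd P := LocBdd.of_continuousOn ((hp.continuousOn_primitive (P 0)).congr hP)
  have hQc : LocBdd Q := LocBdd.of_continuousOn ((hq.continuousOn_primitive (Q 0)).congr hQ)
  have hr : LocBdd fun t => B (p t) (Q t) + B (P t) (q t) := (hp.bilin B hQc).add (hPc.bilin B hq)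
  set r : ℝ → G := fun t => B (p t) (Q t) + B (P t) (q t) with hrdef
  obtain ⟨Mp, hMp0, hMp⟩ := hp.norm_integral_le hT
  obtain ⟨Mq, hMq0, hMq⟩ := hq.norm_integral_le hT
  obtain ⟨Mr, hMr0, hMr⟩ := hr.norm_integral_le hT
  obtain ⟨CP, hCP⟩ := (isCompact_Icc (a := (0 : ℝ)) (b := T)).exists_bound_of_continuousOn
    (((hp.continuousOn_primitive (P 0)).congr hP).mono Icc_subset_Ici_self)
  obtain ⟨CQ, hCQ⟩ := (isCompact_Icc (a := (0 : ℝ)) (b := T)).exists_bound_of_continuousOn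
    (((hq.continuousOn_primitive (Q 0)).congr hQ).mono Icc_subset_Ici_self)
  have hsubP : ∀ s ∈ Icc 0 T, ∀ t ∈ Icc 0 T, P t - P s = ∫ τ in s..t, p τ := fun s hs t ht => by
    rw [hP t ht.1, hP s hs.1, add_sub_add_left_eq_sub, intervalIntegral.integral_interval_sub_left
      (hp.intervalIntegrable le_rfl ht.1) (hp.intervalIntegrable le_rfl hs.1)]
  have hsubQ : ∀ s ∈ Icc 0 T, ∀ t ∈ Icc 0 T, Q t - Q s = ∫ τ in s..t, q τ := fun s hs t ht => by
    rw [hQ t ht.1, hQ s hs.1, add_sub_add_left_eq_sub, intervalIntegral.integral_interval_sub_left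
      (hq.intervalIntegrable le_rfl ht.1) (hq.intervalIntegrable le_rfl hs.1)]
  have h0 : (0 : ℝ) ∈ Icc 0 T := ⟨le_rfl, hT.le⟩
  have hCP0 : 0 ≤ CP := (norm_nonneg _).trans (hCP 0 h0)
  have hCQ0 : 0 ≤ CQ := (norm_nonneg _).trans (hCQ 0 h0)
  let h : ℝ → G := fun t => B (P t) (Q t) - ∫ τ in (0 : ℝ)..t, r τ
  have hK0 : 0 ≤ ‖B‖ * Mp * CQ + ‖B‖ * CP * Mq + Mr := by positivity
  have hLip : LipschitzOnWith (‖B‖ * Mp * CQ + ‖B‖ * CP * Mq + Mr).toNNReal h (uIcc 0 T) := by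
    rw [uIcc_of_le hT.le]
    refine LipschitzOnWith.of_dist_le_mul fun t ht s hs => ?_
    rw [dist_eq_norm, Real.dist_eq, Real.coe_toNNReal _ hK0]
    have e : h t - h s = B (P t - P s) (Q t) + B (P s) (Q t - Q s) - ∫ τ in s..t, r τ := by
      rw [← intervalIntegral.integral_interval_sub_left (hr.intervalIntegrable le_rfl ht.1)
        (hr.intervalIntegrable le_rfl hs.1)]
      simp only [h, map_sub, sub_apply]
      abel
    rw [e]
    have h1 : ‖B (P t - P s) (Q t)‖ ≤ ‖B‖ * (Mp * |t - s|) * CQ := by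
      refine (B.le_opNorm₂ _ _).trans ?_
      rw [hsubP s hs t ht]
      have := hMp s hs t ht
      have := hCQ t ht
      gcongr
    have h2 : ‖B (P s) (Q t - Q s)‖ ≤ ‖B‖ * CP * (Mq * |t - s|) := by
      refine (B.le_opNorm₂ _ _).trans ?_
      rw [hsubQ s hs t ht]
      have := hMq s hs t ht
      have := hCP s hs
      gcongr
    calc _ ≤ ‖B (P t - P s) (Q t)‖ + ‖B (P s) (Q t - Q s)‖ + ‖∫ τ in s..t, r τ‖ :=
          (norm_sub_le _ _).trans (by gcongr; exact norm_add_le _ _)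
      _ ≤ ‖B‖ * (Mp * |t - s|) * CQ + ‖B‖ * CP * (Mq * |t - s|) + Mr * |t - s| := by
          gcongr
          exact hMr s hs t ht
      _ = _ := by ring
  have hder : ∀ᵐ t, t ∈ uIcc 0 T → HasDerivAt h 0 t := by
    filter_upwards [(hp.intervalIntegrable le_rfl hT.le).ae_hasDerivAt_integral,
      (hq.intervalIntegrable le_rfl hT.le).ae_hasDerivAt_integral,
      (hr.intervalIntegrable le_rfl hT.le).ae_hasDerivAt_integral,
      show ∀ᵐ t : ℝ, t ≠ 0 by simp [ae_iff, measure_singleton]] with t h1 h2 h3 h4 ht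
    have ht0 : 0 < t := by
      rw [uIcc_of_le hT.le] at ht
      exact lt_of_le_of_ne ht.1 (Ne.symm h4)
    have hP' : HasDerivAt P (p t) t := by
      refine ((h1 ht 0 left_mem_uIcc).const_add (P 0)).congr_of_eventuallyEq ?_
      filter_upwards [Ioi_mem_nhds ht0] with s hs using hP s (le_of_lt hs)
    have hQ' : HasDerivAt Q (q t) t := by
      refine ((h2 ht 0 left_mem_uIcc).const_add (Q 0)).congr_of_eventuallyEq ?_
      filter_upwards [Ioi_mem_nhds ht0] with s hs using hQ s (le_of_lt hs)
    have := (B.hasDerivAt_of_bilinear (fun _ => hP') (fun _ => hQ')).sub (h3 ht 0 left_mem_uIcc)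
    have e2 : B (P t) (q t) + B (p t) (Q t) - r t = 0 := by
      simp only [hrdef]
      abel
    rw [e2] at this
    exact this
  obtain ⟨C, hC⟩ := hLip.absolutelyContinuousOnInterval.const_of_ae_hasDerivAt_zero hder
  have e1 := (hC T right_mem_uIcc).trans (hC 0 left_mem_uIcc).symm
  simp only [h, intervalIntegral.integral_same, sub_zero] at e1
  rw [← e1]
  abel

theorem integral_Ioi_eq_intervalIntegral {f : ℝ → E} {T : ℝ} (hT : 0 ≤ T)
    (hf : ∀ t, T < t → f t = 0) : ∫ t in Ioi (0 : ℝ), f t = ∫ t in (0 : ℝ)..T, f t := by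
  rw [intervalIntegral.integral_of_le hT]
  exact setIntegral_eq_of_subset_of_forall_sdiff_eq_zero measurableSet_Ioi Ioc_subset_Ioi_self
    fun t ht => hf t (by
      by_contra! h
      exact ht.2 ⟨ht.1, h⟩)

/-- The fundamental lemma of the calculus of variations for `a' = b`, `a(0) = c`, in weak form. -/
theorem ae_eq_primitive_of_weak [CompleteSpace E] {a b : ℝ → E} {c : E} (ha : LocBdd a)
    (hb : LocBdd b)
    (h : ∀ θ : ℝ → ℝ, ContDiff ℝ ∞ θ → HasCompactSupport θ →
      ∫ t in Ioi (0 : ℝ), (deriv θ t • a t + θ t • b t) = -(θ 0 • c)) :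
    ∀ᵐ t ∂volume.restrict (Ioi (0 : ℝ)), a t = c + ∫ τ in (0 : ℝ)..t, b τ := by
  set Bt : ℝ → E := fun t => ∫ τ in (0 : ℝ)..t, b τ with hBt
  have hBl : LocBdd Bt := LocBdd.of_continuousOn (by simpa using hb.continuousOn_primitive 0)
  have hB0 : Bt 0 = 0 := by simp [hBt]
  have hg : LocBdd fun t => a t + (-(c + Bt t)) :=
    ha.add (LocBdd.of_continuousOn (hb.continuousOn_primitive c).neg)
  -- the difference is orthogonal to all derivatives of test functions
  have key : ∀ θ : ℝ → ℝ, ContDiff ℝ ∞ θ → HasCompactSupport θ →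
      ∫ t in Ioi (0 : ℝ), deriv θ t • (a t + (-(c + Bt t))) = 0 := by
    intro θ hθ hc
    obtain ⟨T, hT, hTs⟩ := exists_bound_of_compactSupport hc
    have hz : ∀ t, T < t → θ t = 0 ∧ deriv θ t = 0 := fun t ht => by
      have h1 : t ∉ tsupport θ := hTs t fun h => absurd h.2 (not_le.2 ht)
      exact ⟨image_eq_zero_of_notMem_tsupport h1, image_eq_zero_of_notMem_tsupport fun h2 =>
        h1 (tsupport_deriv_subset (𝕜 := ℝ) (f := θ) h2)⟩
    have hθc : LocBdd θ := LocBdd.of_continuous hθ.continuous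
    have hθd : LocBdd (deriv θ) := LocBdd.of_continuous (hθ.continuous_deriv (by simp))
    have hint : ∀ t, θ t = θ 0 + ∫ τ in (0 : ℝ)..t, deriv θ τ := fun t => by
      rw [intervalIntegral.integral_deriv_eq_sub (fun x _ => hθ.differentiable (by simp) x)
        ((hθ.continuous_deriv (by simp)).intervalIntegrable _ _)]
      ring
    -- beyond the support of the test function
    have hT1 : (0 : ℝ) ≤ T + 1 := by linarith
    have h1 := h θ hθ hc
    rw [integral_Ioi_eq_intervalIntegral hT1 fun t ht => by
      rw [(hz t (by linarith)).1, (hz t (by linarith)).2, zero_smul, zero_smul, add_zero]] at h1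
    have h2 := LocBdd.integral_bilin (ContinuousLinearMap.lsmul ℝ ℝ : ℝ →L[ℝ] E →L[ℝ] E) hθd hb
      (P := θ) (Q := fun t => c + Bt t) (fun t _ => hint t) (fun t _ => by simp [hBt]) hT1
    simp only [ContinuousLinearMap.lsmul_apply, hB0, add_zero,
      (hz (T + 1) (by linarith)).1, zero_smul,
      zero_sub] at h2
    rw [integral_Ioi_eq_intervalIntegral hT1 fun t ht => by rw [(hz t (by linarith)).2, zero_smul]]
    have hI : ∀ {p : ℝ → ℝ} {q : ℝ → E}, LocBdd p → LocBdd q →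
        IntervalIntegrable (fun t => p t • q t) volume 0 (T + 1) := fun hp hq =>
      (LocBdd.bilin (ContinuousLinearMap.lsmul ℝ ℝ : ℝ →L[ℝ] E →L[ℝ] E) hp hq).intervalIntegrable
        le_rfl hT1
    have hcB : LocBdd fun t => c + Bt t := (LocBdd.const c).add hBl
    have e : ∀ t, deriv θ t • (a t + (-(c + Bt t))) = (deriv θ t • a t + θ t • b t) -
        (deriv θ t • (c + Bt t) + θ t • b t) := fun t => by
      rw [smul_add, smul_neg]; abel
    simp only [e]
    rw [intervalIntegral.integral_sub ((hI hθd ha).add (hI hθc hb)) ((hI hθd hcB).add (hI hθc hb)),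
      h1, h2, sub_self]
  have hloc : LocallyIntegrableOn (fun t => a t + (-(c + Bt t))) (Ioi 0) volume := by
    rw [locallyIntegrableOn_iff isOpen_Ioi.isLocallyClosed]
    intro K hK hKc
    obtain ⟨T, hT⟩ := hKc.isBounded.subset_closedBall 0
    rw [Real.closedBall_eq_Icc] at hT
    have h1 := (hg.intervalIntegrable le_rfl (le_max_right T 0)).1
    refine h1.mono_set fun t ht => ⟨hK ht, ?_⟩
    have := (hT ht).2
    exact le_trans (by linarith) (le_max_left _ _)
  have h0 := isOpen_Ioi.ae_eq_zero_of_integral_contDiff_smul_eq_zero hloc fun η hη hηc hηs => by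
    obtain ⟨T, hT, hTs⟩ := exists_bound_of_compactSupport hηc
    have hηz : ∀ t, T < t → η t = 0 := fun t ht =>
      image_eq_zero_of_notMem_tsupport (hTs t fun h => absurd h.2 (not_le.2 ht))
    -- an antiderivative of the test function that vanishes for large times, cut off at
    -- negative times
    let κ : ContDiffBump (0 : ℝ) := ⟨T + 1, T + 2, by linarith, by linarith⟩
    let N : ℝ → ℝ := fun t => ∫ τ in T..t, η τ
    have hNd : ∀ t, HasDerivAt N (η t) t := fun t =>
      intervalIntegral.integral_hasDerivAt_right (hη.continuous.intervalIntegrable _ _)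
        (hη.continuous.stronglyMeasurableAtFilter _ _) hη.continuous.continuousAt
    have hN : ContDiff ℝ ∞ N := by
      rw [contDiff_infty_iff_deriv]
      refine ⟨fun t => (hNd t).differentiableAt, ?_⟩
      rwa [show deriv N = η from funext fun t => (hNd t).deriv]
    have hNz : ∀ t, T ≤ t → N t = 0 := fun t ht => by
      have : ∫ τ in T..t, η τ = ∫ τ in T..t, (0 : ℝ) :=
        intervalIntegral.integral_congr_ae (Eventually.of_forall fun τ hτ => by
          rw [uIoc_of_le ht] at hτ
          exact hηz τ hτ.1)
      simp [N, this]
    have hκ : ContDiff ℝ ∞ (κ : ℝ → ℝ) := κ.contDiff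
    have h3 := key (fun t => κ t * N t) (hκ.mul hN) κ.hasCompactSupport.mul_right
    rw [← setIntegral_eq_integral_of_forall_compl_eq_zero (s := Ioi (0 : ℝ)) fun t ht => by
      rw [image_eq_zero_of_notMem_tsupport fun h => ht (hηs h), zero_smul], ← h3]
    refine setIntegral_congr_fun measurableSet_Ioi fun t (ht : 0 < t) => ?_
    have hd : deriv (fun t => κ t * N t) t = η t := by
      by_cases htT : t < T + 1
      · have : (fun t => κ t * N t) =ᶠ[𝓝 t] N := by
          filter_upwards [Ioo_mem_nhds (show -(T + 1) < t by linarith) htT] with s hs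
          rw [κ.one_of_mem_closedBall
            (by rw [Real.closedBall_eq_Icc]; constructor <;> simp [κ] <;> linarith [hs.1, hs.2]), one_mul]
        rw [this.deriv_eq, (hNd t).deriv]
      · have : (fun t => κ t * N t) =ᶠ[𝓝 t] fun _ => 0 := by
          filter_upwards [Ioi_mem_nhds (show T < t by linarith)] with s hs
          rw [hNz s (le_of_lt hs), mul_zero]
        rw [this.deriv_eq, deriv_const, hηz t (by linarith)]
    simp only [hd]
  rw [ae_restrict_iff' measurableSet_Ioi]
  filter_upwards [h0] with t ht ht0
  have := ht ht0
  rwa [← sub_eq_add_neg, sub_eq_zero] at this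

end Curves

/-! ### From the weak form to an evolution equation for the frequency-localised field -/

theorem nice_of_compactSupport {F : Type*} [NormedAddCommGroup F] [NormedSpace ℝ F] {f : E3 → F}
    (hf : ContDiff ℝ ∞ f) (hc : HasCompactSupport f) : Nice f where
  contDiff := hf
  bounded n := (continuous_iteratedFDeriv_of_contDiff hf n).bounded_above_of_compact_support
    (hc.iteratedFDeriv n)
  memLp n := ((continuous_iteratedFDeriv_of_contDiff hf n).memLp_of_hasCompactSupport
    (hc.iteratedFDeriv n)).norm

theorem laplacian_eq_sum (f : E3 → E3) : Laplacian.laplacian f = fun x => ∑ i : Fin 3,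
    iteratedFDeriv ℝ 2 f x ![EuclideanSpace.basisFun (Fin 3) ℝ i,
      EuclideanSpace.basisFun (Fin 3) ℝ i] :=
  InnerProductSpace.laplacian_eq_iteratedFDeriv_orthonormalBasis _ _

theorem norm_laplacian_le (f : E3 → E3) (x : E3) :
    ‖Laplacian.laplacian f x‖ ≤ 3 * ‖iteratedFDeriv ℝ 2 f x‖ := by
  rw [laplacian_eq_sum]
  refine (norm_sum_le _ _).trans ?_
  have h : ∀ i : Fin 3, ‖iteratedFDeriv ℝ 2 f x ![EuclideanSpace.basisFun (Fin 3) ℝ i,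
      EuclideanSpace.basisFun (Fin 3) ℝ i]‖ ≤ ‖iteratedFDeriv ℝ 2 f x‖ := fun i => by
    refine (ContinuousMultilinearMap.le_opNorm _ _).trans_eq ?_
    simp
  exact (Finset.sum_le_sum fun i _ => h i).trans_eq (by simp)

theorem continuous_laplacian {f : E3 → E3} (hf : ContDiff ℝ ∞ f) :
    Continuous (Laplacian.laplacian f) := by
  rw [laplacian_eq_sum]
  exact continuous_finsetSum _ fun i _ => (ContinuousMultilinearMap.apply ℝ (fun _ : Fin 2 => E3) E3
    ![EuclideanSpace.basisFun (Fin 3) ℝ i, EuclideanSpace.basisFun (Fin 3) ℝ i]).continuous.comp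
      (continuous_iteratedFDeriv_of_contDiff hf 2)

theorem Nice.memLp_laplacian {f : E3 → E3} (hf : Nice f) :
    MemLp (Laplacian.laplacian f) 2 (volume : Measure E3) :=
  ((hf.memLp 2).const_mul 3).mono' (continuous_laplacian hf.contDiff).aestronglyMeasurable
    (Eventually.of_forall (norm_laplacian_le f))

/-- The gradient of a field with bounded square-integrable derivatives. -/
def Nice.grad {f : E3 → E3} (hf : Nice f) : BoundedContinuousFunction E3 (E3 →L[ℝ] E3) :=
  boundedGrad f hf.fderiv.contDiff.continuous hf.fderiv.norm_bounded

/-- The coefficient of `θ'` in the weak form tested with `θ(t) f(x)`. -/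
def pairField (f : E3 → E3) (z : L2) : ℝ := ∫ x, ⟪z x, f x⟫

/-- The coefficient of `ν θ` in the weak form tested with `θ(t) f(x)`. -/
def pairLap (f : E3 → E3) (z : L2) : ℝ := ∫ x, ⟪z x, Laplacian.laplacian f x⟫

/-- The nonviscous coefficient of `θ` in the weak form tested with `θ(t) f(x)`. -/
def pairGrad (f : E3 → E3) (z : L2) : ℝ := ∫ x, ⟪z x, fderiv ℝ f x (z x)⟫

theorem pairField_eq_inner {f : E3 → E3} (hf : MemLp f 2 (volume : Measure E3)) (z : L2) :
    ∫ x, ⟪z x, f x⟫ = ⟪z, hf.toLp f⟫ := by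
  rw [inner_L2_eq]
  apply integral_congr_ae
  filter_upwards [hf.coeFn_toLp] with x hx
  rw [hx]

theorem integrable_inner_memLp {f : E3 → E3} (hf : MemLp f 2 (volume : Measure E3)) (z : L2) :
    Integrable (fun x => ⟪z x, f x⟫) volume := by
  refine (L2.integrable_inner (𝕜 := ℝ) z (hf.toLp f)).congr ?_
  filter_upwards [hf.coeFn_toLp] with x hx
  rw [hx]

theorem pairGrad_eq_inner {f : E3 → E3} (hf : Nice f) (z : L2) :
    pairGrad f z = ⟪z, matMul hf.grad z⟫ := by
  rw [inner_matMul]; rfl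

theorem continuous_inner_matMul (D : BoundedContinuousFunction E3 (E3 →L[ℝ] E3)) :
    Continuous fun z : L2 => ⟪z, matMul D z⟫ :=
  continuous_id.inner (matMul D).continuous

theorem Nice.continuous_pairField {f : E3 → E3} (hf : Nice f) : Continuous (pairField f) := by
  have : pairField f = fun z => ⟪z, hf.memLp_self.toLp f⟫ :=
    funext (pairField_eq_inner hf.memLp_self)
  rw [this]
  exact continuous_id.inner continuous_const

theorem Nice.continuous_pairLap {f : E3 → E3} (hf : Nice f) : Continuous (pairLap f) := by
  have : pairLap f = fun z => ⟪z, hf.memLp_laplacian.toLp _⟫ :=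
    funext (pairField_eq_inner hf.memLp_laplacian)
  rw [this]
  exact continuous_id.inner continuous_const

theorem Nice.continuous_pairGrad {f : E3 → E3} (hf : Nice f) : Continuous (pairGrad f) := by
  rw [show pairGrad f = fun z => ⟪z, matMul hf.grad z⟫ from funext (pairGrad_eq_inner hf)]
  exact continuous_inner_matMul _

/-- The weak form for test fields with separated variables. -/
theorem WeakForm.separated {ν : ℝ} {u₀ : L2sigma} {u : ℝ → L2sigma} (h : WeakForm ν u₀ u)
    {f : E3 → E3} (hf : ContDiff ℝ ∞ f) (hc : HasCompactSupport f) (hdiv : ∀ x, divergence f x = 0)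
    {θ : ℝ → ℝ} (hθ : ContDiff ℝ ∞ θ) (hθc : HasCompactSupport θ) :
    ∫ t in Ioi (0 : ℝ), (deriv θ t * pairField f (u t) +
      θ t * (ν * pairLap f (u t) + pairGrad f (u t))) = -(θ 0 * pairField f u₀) := by
  have hnice := nice_of_compactSupport hf hc
  have h1 := h (fun t x => θ t • f x) ?_ ?_ ?_
  · have e0 : ∫ x, ⟪(u₀ : L2) x, θ 0 • f x⟫ = θ 0 * pairField f u₀ := by
      simp only [real_inner_smul_right]
      rw [integral_const_mul]; rfl
    rw [e0] at h1
    rw [← h1]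
    congr 1
    ext t
    have hlap : ∀ x, Laplacian.laplacian (fun y => θ t • f y) x = θ t • Laplacian.laplacian f x :=
      fun x =>
      InnerProductSpace.laplacian_smul (θ t) (contDiff_infty.1 hf 2).contDiffAt
    have hfd : ∀ x, fderiv ℝ (fun y => θ t • f y) x = θ t • fderiv ℝ f x := fun x =>
      fderiv_fun_const_smul (hf.differentiable (by simp) x) (θ t)
    have hdv : ∀ x, deriv (fun τ => θ τ • f x) t = deriv θ t • f x := fun x =>
      ((hθ.differentiable (by simp) t).hasDerivAt.smul_const (f x)).deriv
    simp only [hlap, hfd, hdv, inner_add_right, real_inner_smul_right, smul_apply]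
    have i1 := integrable_inner_memLp hnice.memLp_self (u t : L2)
    have i2 := integrable_inner_memLp hnice.memLp_laplacian (u t : L2)
    have i3 : Integrable (fun x => ⟪(u t : L2) x, fderiv ℝ f x ((u t : L2) x)⟫) volume :=
      integrable_inner_matMul hnice.grad (u t : L2) (u t : L2)
    have i12 : Integrable (fun x => deriv θ t * ⟪(u t : L2) x, f x⟫ +
        ν * (θ t * ⟪(u t : L2) x, Laplacian.laplacian f x⟫)) volume :=
      (i1.const_mul _).add ((i2.const_mul _).const_mul _)
    rw [integral_add i12 (i3.const_mul _),
      integral_add (i1.const_mul _) ((i2.const_mul _).const_mul _), integral_const_mul,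
      integral_const_mul, integral_const_mul, integral_const_mul, pairField, pairLap, pairGrad]
    ring
  · exact (hθ.comp contDiff_fst).smul (hf.comp contDiff_snd)
  · refine HasCompactSupport.intro (hθc.isCompact.prod hc.isCompact) fun p hp => ?_
    by_cases h1 : p.1 ∈ tsupport θ
    · have h2 : p.2 ∉ tsupport f := fun h2 => hp ⟨h1, h2⟩
      simp [Function.uncurry, image_eq_zero_of_notMem_tsupport h2]
    · simp [Function.uncurry, image_eq_zero_of_notMem_tsupport h1]
  · intro t _ x
    have hfd : fderiv ℝ (fun y => θ t • f y) x = θ t • fderiv ℝ f x :=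
      fderiv_fun_const_smul (hf.differentiable (by simp) x) (θ t)
    have := hdiv x
    simp only [divergence, hfd, smul_apply, PiLp.smul_apply, smul_eq_mul] at this ⊢
    rw [← Finset.mul_sum, this, mul_zero]

theorem integral_norm_mul_le (z : L2) {m : E3 → ℝ} (hm : MemLp m 2 (volume : Measure E3)) :
    ∫ x, ‖z x‖ * |m x| ≤ √(∫ x, m x ^ 2) * ‖z‖ := by
  have h := integral_mul_le_sqrt (Lp.memLp z).norm hm
  simp only [abs_norm] at h
  rwa [← Lp.norm_sq_eq_integral, Real.sqrt_sq (norm_nonneg _), mul_comm] at h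

theorem LocBdd.clm_comp {E F : Type*} [NormedAddCommGroup E] [NormedSpace ℝ E]
    [NormedAddCommGroup F]
    [NormedSpace ℝ F] (L : E →L[ℝ] F) {p : ℝ → E} (hp : LocBdd p) : LocBdd fun t => L (p t) where
  meas := L.continuous.comp_aestronglyMeasurable hp.meas
  bdd T hT := by
    obtain ⟨M, hM0, hM⟩ := hp.bdd T hT
    refine ⟨‖L‖ * M, by positivity, ?_⟩
    filter_upwards [hM] with t ht htT
    exact L.le_opNorm_of_le (ht htT)

theorem LocBdd.coe_L2 {u : ℝ → L2sigma} (hu : LocBdd u) : LocBdd fun t => (u t : L2) :=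
  hu.clm_comp L2sigma.subtypeL

theorem locBdd_force {u : ℝ → L2sigma} (hu : LocBdd u) (n : ℕ) (ν : ℝ) :
    LocBdd fun t => force n ν (u t) where
  meas := by
    refine aestronglyMeasurable_of_inner fun v => ?_
    have hc : Continuous fun z : L2 => ν * ⟪z, mollifyLap n v⟫ + ⟪z, matMul (mollifyGrad n v) z⟫ :=
      ((continuous_id.inner continuous_const).const_mul ν |>.add (continuous_inner_matMul _))
    refine (hc.comp_aestronglyMeasurable hu.coe_L2.meas).congr (Eventually.of_forall fun t => ?_)
    exact (inner_force n ν (u t : L2) v).symm.trans (real_inner_comm _ _)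
  bdd T hT := by
    obtain ⟨M, hM0, hM⟩ := hu.bdd T hT
    obtain ⟨C, hC⟩ := exists_norm_force_le n ν M
    refine ⟨max C 0, le_max_right _ _, ?_⟩
    filter_upwards [hM] with t ht htT
    exact (hC _ (ht htT)).trans (le_max_left _ _)

theorem LocBdd.integrableOn_smul {E : Type*} [NormedAddCommGroup E] [NormedSpace ℝ E] {p : ℝ → E}
    (hp : LocBdd p) {θ : ℝ → ℝ} (hθ : Continuous θ) (hθc : HasCompactSupport θ) :
    IntegrableOn (fun t => θ t • p t) (Ioi 0) := by
  obtain ⟨T, hT, hTs⟩ := exists_bound_of_compactSupport hθc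
  have h1 : IntegrableOn (fun t => θ t • p t) (Ioc 0 T) :=
    (LocBdd.bilin (ContinuousLinearMap.lsmul ℝ ℝ : ℝ →L[ℝ] E →L[ℝ] E) (LocBdd.of_continuous hθ)
      hp).intervalIntegrable le_rfl hT.le |>.1
  refine h1.of_forall_sdiff_eq_zero measurableSet_Ioi fun t ht => ?_
  rw [image_eq_zero_of_notMem_tsupport (hTs t fun h => ht.2 ⟨ht.1, h.2⟩), zero_smul]

/-- The weak form may be tested with the frequency localisations of divergence-free fields. -/
theorem WeakForm.mollified {ν : ℝ} {u₀ : L2sigma} {u : ℝ → L2sigma} (h : WeakForm ν u₀ u)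
    (hu : LocBdd u) (n : ℕ) (v : L2sigma) {θ : ℝ → ℝ} (hθ : ContDiff ℝ ∞ θ)
    (hθc : HasCompactSupport θ) :
    ∫ t in Ioi (0 : ℝ), (deriv θ t * ⟪smooth n (u t), v⟫ + θ t * ⟪force n ν (u t), v⟫) =
      -(θ 0 * ⟪smooth n u₀, v⟫) := by
  obtain ⟨φ, hφ, hφc, hφd, hφe, m, hm, hmb, hφm⟩ := exists_testFields n v
  have hnice := fun k => nice_of_compactSupport (hφ k) (hφc k)
  obtain ⟨C1, hC1⟩ := hmb 1
  have hC10 : 0 ≤ C1 := (norm_nonneg _).trans ((hφm 1 0 0).trans (hC1 0))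
  have hm0 : ∀ j x, 0 ≤ m j x := fun j x => (norm_nonneg _).trans (hφm j 0 x)
  -- bounds that do not depend on the cutoff
  have b0 : ∀ k (z : L2), |pairField (φ k) z| ≤ √(∫ x, m 0 x ^ 2) * ‖z‖ := fun k z => by
    rw [pairField, ← Real.norm_eq_abs]
    refine (norm_integral_le_integral_norm _).trans (le_trans ?_ (integral_norm_mul_le z (hm 0)))
    refine integral_mono_of_nonneg (Eventually.of_forall fun x => norm_nonneg _)
      ((Lp.memLp z).norm.integrable_mul (hm 0).norm) (Eventually.of_forall fun x => ?_)
    refine (norm_inner_le_norm (𝕜 := ℝ) _ _).trans ?_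
    have := hφm 0 k x
    rw [norm_iteratedFDeriv_zero] at this
    simp only
    rw [abs_of_nonneg (hm0 0 x)]
    gcongr
  have b2 : ∀ k (z : L2), |pairLap (φ k) z| ≤ √(∫ x, (3 * m 2 x) ^ 2) * ‖z‖ := fun k z => by
    rw [pairLap, ← Real.norm_eq_abs]
    refine (norm_integral_le_integral_norm _).trans
      (le_trans ?_ (integral_norm_mul_le z ((hm 2).const_mul 3)))
    refine integral_mono_of_nonneg (Eventually.of_forall fun x => norm_nonneg _)
      ((Lp.memLp z).norm.integrable_mul ((hm 2).const_mul 3).norm)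
        (Eventually.of_forall fun x => ?_)
    refine (norm_inner_le_norm (𝕜 := ℝ) _ _).trans ?_
    have := (norm_laplacian_le (φ k) x).trans (mul_le_mul_of_nonneg_left (hφm 2 k x) zero_le_three)
    simp only
    rw [abs_of_nonneg (mul_nonneg zero_le_three (hm0 2 x))]
    gcongr
  have hfd : ∀ k x, ‖fderiv ℝ (φ k) x‖ ≤ C1 := fun k x => by
    rw [norm_fderiv_eq_iteratedFDeriv_one]
    exact (hφm 1 k x).trans (hC1 x)
  have b1 : ∀ k (z : L2), |pairGrad (φ k) z| ≤ C1 * (‖z‖ * ‖z‖) := fun k z => by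
    rw [pairGrad_eq_inner (hnice k)]
    refine (abs_inner_matMul_le _ _ _).trans ?_
    gcongr
    exact (BoundedContinuousFunction.norm_le hC10).2 fun x => hfd k x
  -- convergence of the pairings with a fixed field
  have c0 : ∀ z : L2, Tendsto (fun k => pairField (φ k) z) atTop (𝓝 ⟪z, mollifyL2 n v⟫) :=
    fun z => by
    have e : ⟪z, mollifyL2 n v⟫ = ∫ x, ⟪z x, mollify n v x⟫ := by
      rw [inner_L2_eq]
      apply integral_congr_ae
      filter_upwards [coeFn_mollifyL2 n v] with x hx
      rw [hx]
    rw [e]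
    refine tendsto_integral_of_dominated_convergence (fun x => ‖z x‖ * |m 0 x|)
      (fun k => (integrable_inner_memLp (hnice k).memLp_self z).1)
      ((Lp.memLp z).norm.integrable_mul (hm 0).norm) (fun k => Eventually.of_forall fun x => ?_)
      (Eventually.of_forall fun x => ?_)
    · refine (norm_inner_le_norm (𝕜 := ℝ) _ _).trans ?_
      have := hφm 0 k x
      rw [norm_iteratedFDeriv_zero] at this
      rw [abs_of_nonneg (hm0 0 x)]
      gcongr
    · refine tendsto_const_nhds.congr' ?_
      filter_upwards [hφe x] with k hk
      rw [hk.eq_of_nhds]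
  have c2 : ∀ z : L2, Tendsto (fun k => pairLap (φ k) z) atTop (𝓝 ⟪z, mollifyLap n v⟫) :=
    fun z => by
    have e : ⟪z, mollifyLap n v⟫ = ∫ x, ⟪z x, Laplacian.laplacian (mollify n v) x⟫ := by
      rw [inner_L2_eq]
      apply integral_congr_ae
      filter_upwards [coeFn_mollifyLap n v] with x hx
      rw [hx]
    rw [e]
    refine tendsto_integral_of_dominated_convergence (fun x => ‖z x‖ * |3 * m 2 x|)
      (fun k => (integrable_inner_memLp (hnice k).memLp_laplacian z).1)
      ((Lp.memLp z).norm.integrable_mul ((hm 2).const_mul 3).norm)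
      (fun k => Eventually.of_forall fun x => ?_) (Eventually.of_forall fun x => ?_)
    · refine (norm_inner_le_norm (𝕜 := ℝ) _ _).trans ?_
      have := (norm_laplacian_le (φ k) x).trans
        (mul_le_mul_of_nonneg_left (hφm 2 k x) zero_le_three)
      rw [abs_of_nonneg (mul_nonneg zero_le_three (hm0 2 x))]
      gcongr
    · refine tendsto_const_nhds.congr' ?_
      filter_upwards [hφe x] with k hk
      rw [InnerProductSpace.laplacian_congr_nhds hk |>.eq_of_nhds]
  have c1 : ∀ z : L2, Tendsto (fun k => pairGrad (φ k) z) atTop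
      (𝓝 ⟪z, matMul (mollifyGrad n v) z⟫) := fun z => by
    rw [inner_matMul]
    refine tendsto_integral_of_dominated_convergence (fun x => C1 * ‖z x‖ ^ 2)
      (fun k => (integrable_inner_matMul (hnice k).grad z z).1)
      ((Lp.memLp z).norm.integrable_sq.const_mul _)
      (fun k => Eventually.of_forall fun x => ?_) (Eventually.of_forall fun x => ?_)
    · refine (norm_inner_le_norm (𝕜 := ℝ) _ _).trans ?_
      calc ‖z x‖ * ‖fderiv ℝ (φ k) x (z x)‖ ≤ ‖z x‖ * (C1 * ‖z x‖) := by
            gcongr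
            exact ContinuousLinearMap.le_of_opNorm_le _ (hfd k x) _
        _ = _ := by ring
    · refine tendsto_const_nhds.congr' ?_
      filter_upwards [hφe x] with k hk
      rw [hk.fderiv_eq, mollifyGrad_apply]
  -- passage to the limit in the weak form
  have hθd : Continuous (deriv θ) := hθ.continuous_deriv (by simp)
  obtain ⟨T, hT, hTs⟩ := exists_bound_of_compactSupport hθc
  obtain ⟨M, hM0, hM⟩ := hu.bdd T hT
  have hsep := fun k => h.separated (hφ k) (hφc k) (hφd k) hθ hθc
  have hlim := tendsto_integral_of_dominated_convergence (μ := volume.restrict (Ioi (0 : ℝ)))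
    (F := fun k t => deriv θ t * pairField (φ k) (u t) +
      θ t * (ν * pairLap (φ k) (u t) + pairGrad (φ k) (u t)))
    (f := fun t => deriv θ t * ⟪(u t : L2), mollifyL2 n v⟫ +
      θ t * (ν * ⟪(u t : L2), mollifyLap n v⟫ + ⟪(u t : L2), matMul (mollifyGrad n v) (u t : L2)⟫))
    (fun t => |deriv θ t| * (√(∫ x, m 0 x ^ 2) * M) +
      |θ t| * (|ν| * (√(∫ x, (3 * m 2 x) ^ 2) * M) + C1 * (M * M)))
    (fun k => ?_) ?_ (fun k => ?_) (Eventually.of_forall fun t => ?_)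
  · simp only [hsep] at hlim
    have h2 := tendsto_nhds_unique hlim ((c0 (u₀ : L2)).const_mul (θ 0)).neg
    simpa only [inner_smooth, inner_force] using h2
  · have hm' := hu.coe_L2.meas
    exact (hθd.aestronglyMeasurable.mul
      ((hnice k).continuous_pairField.comp_aestronglyMeasurable hm')).add
      (hθ.continuous.aestronglyMeasurable.mul
        ((((hnice k).continuous_pairLap.comp_aestronglyMeasurable hm').const_mul ν).add
          ((hnice k).continuous_pairGrad.comp_aestronglyMeasurable hm')))
  · exact (((hθd.integrable_of_hasCompactSupport hθc.deriv).abs.mul_const _).add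
      ((hθ.continuous.integrable_of_hasCompactSupport hθc).abs.mul_const _)).integrableOn
  · filter_upwards [hM] with t ht
    by_cases htT : t ≤ T
    · have hz : ‖(u t : L2)‖ ≤ M := ht htT
      rw [Real.norm_eq_abs]
      refine (abs_add_le _ _).trans ?_
      rw [abs_mul, abs_mul]
      have i0 := (b0 k (u t)).trans (mul_le_mul_of_nonneg_left hz (Real.sqrt_nonneg _))
      have i2 := (b2 k (u t)).trans (mul_le_mul_of_nonneg_left hz (Real.sqrt_nonneg _))
      have i1 : |pairGrad (φ k) (u t)| ≤ C1 * (M * M) := (b1 k (u t)).trans (by gcongr)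
      gcongr
      refine (abs_add_le _ _).trans ?_
      rw [abs_mul]
      gcongr
    · have h1 : t ∉ tsupport θ := hTs t fun h => htT h.2
      have h2 : deriv θ t = 0 := image_eq_zero_of_notMem_tsupport fun h2 =>
        h1 (tsupport_deriv_subset (𝕜 := ℝ) (f := θ) h2)
      rw [h2, image_eq_zero_of_notMem_tsupport h1]
      simp
  · exact ((c0 _).const_mul _).add ((((c2 _).const_mul ν).add (c1 _)).const_mul _)

/-- The frequency localisation of a weak solution is the primitive of the localised force. -/
theorem WeakForm.ae_smooth_eq {ν : ℝ} {u₀ : L2sigma} {u : ℝ → L2sigma} (h : WeakForm ν u₀ u)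
    (hu : LocBdd u) (n : ℕ) : ∀ᵐ t ∂volume.restrict (Ioi (0 : ℝ)),
      smooth n (u t) = smooth n u₀ + ∫ τ in (0 : ℝ)..t, force n ν (u τ) := by
  have ha : LocBdd fun t => smooth n (u t : L2) := hu.coe_L2.clm_comp (smooth n)
  have hb := locBdd_force hu n ν
  refine ae_eq_primitive_of_weak ha hb fun θ hθ hθc => ?_
  have hint : Integrable (fun t => deriv θ t • smooth n (u t : L2) + θ t • force n ν (u t))
      (volume.restrict (Ioi (0 : ℝ))) :=
    (ha.integrableOn_smul (hθ.continuous_deriv (by simp)) hθc.deriv).add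
      (hb.integrableOn_smul hθ.continuous hθc)
  refine ext_inner_left ℝ fun v => ?_
  have e : ∀ (c : ℝ) (z : L2sigma), ⟪v, c • z⟫ = c * ⟪z, v⟫ := fun c z =>
    (real_inner_smul_right v z c).trans (congrArg (c * ·) (real_inner_comm z v))
  rw [← integral_inner hint, inner_neg_right, e, ← h.mollified hu n v hθ hθc]
  congr 1
  ext t
  rw [inner_add_right, e, e]

/-! ### Fields of high Sobolev regularity -/

/-- The regularity that a Sobolev field `w ∈ H^s`, `s > 5/2`, has on the Fourier side: `𝓕(∇w)` is
integrable with norm at most `L`, and `Δw` is in `L²` with norm at most `K`. -/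
structure Regular (L K : ℝ) (w : L2) : Prop where
  integrable : ∀ i, Integrable (fun ξ => ‖ξ‖ * ‖vhat w i ξ‖) volume
  le_left : 2 * Real.pi * ∑ i, ∫ ξ, ‖ξ‖ * ‖vhat w i ξ‖ ≤ L
  integrable_sq : ∀ i, Integrable (fun ξ => ((4 * Real.pi ^ 2 * ‖ξ‖ ^ 2) * ‖vhat w i ξ‖) ^ 2) volume
  le_right : ∑ i, ∫ ξ, ((4 * Real.pi ^ 2 * ‖ξ‖ ^ 2) * ‖vhat w i ξ‖) ^ 2 ≤ K ^ 2
  nonneg : 0 ≤ K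

theorem rpow_half_sq {b : ℝ} (hb : 0 ≤ b) (r : ℝ) : (b ^ (r / 2)) ^ 2 = b ^ r := by
  rw [← Real.rpow_natCast, ← Real.rpow_mul hb]
  congr 1
  push_cast
  ring

/-- A bound of the Sobolev norm in terms of Bochner integrals, for each component. -/
theorem integral_sobolev_weight_le {s : ℝ} {M : ℝ≥0} {w : L2} (h : sobolevSq s w ≤ M) (i : Fin 3) :
    Integrable (fun ξ : E3 => (1 + ‖ξ‖ ^ 2) ^ s * ‖vhat w i ξ‖ ^ 2) volume ∧
      ∫ ξ : E3, (1 + ‖ξ‖ ^ 2) ^ s * ‖vhat w i ξ‖ ^ 2 ≤ (M : ℝ) := by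
  have hi : ∫⁻ ξ : E3, ENNReal.ofReal ((1 + ‖ξ‖ ^ 2) ^ s * ‖vhat w i ξ‖ ^ 2) ≤ M := by
    refine le_trans ?_ ((Finset.single_le_sum (f := fun i : Fin 3 => ∫⁻ ξ : E3,
      ENNReal.ofReal ((1 + ‖ξ‖ ^ 2) ^ s) * ‖vhat w i ξ‖ₑ ^ 2) (fun _ _ => zero_le)
      (Finset.mem_univ i)).trans h)
    refine (lintegral_congr fun ξ => ?_).le
    rw [ENNReal.ofReal_mul (by positivity), ENNReal.ofReal_pow (norm_nonneg _), ofReal_norm]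
  have hm : AEStronglyMeasurable (fun ξ : E3 => (1 + ‖ξ‖ ^ 2) ^ s * ‖vhat w i ξ‖ ^ 2) volume := by
    refine AEStronglyMeasurable.mul (Continuous.aestronglyMeasurable ?_)
      ((memLp_vhat w i).1.norm.pow 2)
    exact Continuous.rpow_const (by fun_prop) fun ξ => Or.inl (by positivity)
  have hn : ∀ ξ : E3, 0 ≤ (1 + ‖ξ‖ ^ 2) ^ s * ‖vhat w i ξ‖ ^ 2 := fun ξ => by positivity
  refine ⟨⟨hm, ?_⟩, ?_⟩
  · rw [hasFiniteIntegral_iff_ofReal (Eventually.of_forall hn)]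
    exact hi.trans_lt ENNReal.coe_lt_top
  · rw [integral_eq_lintegral_of_nonneg_ae (Eventually.of_forall hn) hm]
    exact ENNReal.toReal_le_of_le_ofReal M.2 (by rwa [ENNReal.ofReal_coe_nnreal])

/-- `H^s ⊆ W^{1,∞} ∩ H²` for `s > 5/2`, with quantitative bounds. The first embedding is the
Cauchy–Schwarz inequality for `|ξ| |ŵ| ≤ (1 + |ξ|²)^((1 - s)/2) · (1 + |ξ|²)^(s/2) |ŵ|`, where the
square of the first factor is integrable on `ℝ³` because `2 (s - 1) > 3`. -/
theorem exists_regular {s : ℝ} (hs : 5 / 2 < s) (M : ℝ≥0) :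
    ∃ L K : ℝ, 0 ≤ L ∧ ∀ w : L2, sobolevSq s w ≤ M → Regular L K w := by
  have hJ : Integrable (fun ξ : E3 => (1 + ‖ξ‖ ^ 2) ^ (-(2 * (s - 1)) / 2)) volume :=
    integrable_rpow_neg_one_add_norm_sq (by rw [finrank_euclideanSpace_fin]; push_cast; linarith)
  have hgc : Continuous fun ξ : E3 => (1 + ‖ξ‖ ^ 2) ^ ((1 - s) / 2) :=
    Continuous.rpow_const (by fun_prop) fun ξ => Or.inl (by positivity)
  have hhc : Continuous fun ξ : E3 => (1 + ‖ξ‖ ^ 2) ^ (s / 2) :=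
    Continuous.rpow_const (by fun_prop) fun ξ => Or.inl (by positivity)
  have hsq : ∀ (ξ : E3) (r : ℝ), ((1 + ‖ξ‖ ^ 2) ^ (r / 2)) ^ 2 = (1 + ‖ξ‖ ^ 2) ^ r := fun ξ r =>
    rpow_half_sq (by positivity) r
  have hg : MemLp (fun ξ : E3 => (1 + ‖ξ‖ ^ 2) ^ ((1 - s) / 2)) 2 volume := by
    rw [memLp_two_iff_integrable_sq hgc.aestronglyMeasurable]
    refine hJ.congr (Eventually.of_forall fun ξ => ?_)
    simp only [hsq]
    congr 1
    ring
  set J := ∫ ξ : E3, ((1 + ‖ξ‖ ^ 2) ^ ((1 - s) / 2)) ^ 2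
  refine ⟨2 * Real.pi * (3 * (√J * √M)), √(3 * ((4 * Real.pi ^ 2) ^ 2 * M)), by positivity,
    fun w hw => ?_⟩
  have hint := fun i => integral_sobolev_weight_le hw i
  have hh : ∀ i, MemLp (fun ξ : E3 => (1 + ‖ξ‖ ^ 2) ^ (s / 2) * ‖vhat w i ξ‖) 2 volume :=
    fun i => by
    refine (memLp_two_iff_integrable_sq (hhc.aestronglyMeasurable.mul (memLp_vhat w i).1.norm)).2 ?_
    refine (hint i).1.congr (Eventually.of_forall fun ξ => ?_)
    simp only [Pi.mul_apply, mul_pow, hsq]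
  have hbase : ∀ ξ : E3, ‖ξ‖ ≤ (1 + ‖ξ‖ ^ 2) ^ ((1 : ℝ) / 2) := fun ξ => by
    rw [← Real.sqrt_eq_rpow]
    exact Real.le_sqrt_of_sq_le (by linarith)
  have hle : ∀ i ξ, ‖ξ‖ * ‖vhat w i ξ‖ ≤ |(1 + ‖ξ‖ ^ 2) ^ ((1 - s) / 2)| *
      |(1 + ‖ξ‖ ^ 2) ^ (s / 2) * ‖vhat w i ξ‖| := fun i ξ => by
    rw [abs_of_nonneg (by positivity), abs_of_nonneg (by positivity), ← mul_assoc,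
      ← Real.rpow_add (by positivity)]
    gcongr
    refine (hbase ξ).trans_eq ?_
    congr 1
    ring
  have hprod := fun i => hg.abs.integrable_mul (hh i).abs
  have hi1 : ∀ i, Integrable (fun ξ => ‖ξ‖ * ‖vhat w i ξ‖) volume := fun i =>
    (hprod i).mono' (continuous_norm.aestronglyMeasurable.mul (memLp_vhat w i).1.norm)
      (Eventually.of_forall fun ξ => by
        rw [Real.norm_of_nonneg (by positivity)]
        exact hle i ξ)
  have hsq2 : ∀ i ξ, ((4 * Real.pi ^ 2 * ‖ξ‖ ^ 2) * ‖vhat w i ξ‖) ^ 2 ≤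
      (4 * Real.pi ^ 2) ^ 2 * ((1 + ‖ξ‖ ^ 2) ^ s * ‖vhat w i ξ‖ ^ 2) := fun i ξ => by
    have h1 : (‖ξ‖ ^ 2) ^ 2 ≤ (1 + ‖ξ‖ ^ 2) ^ s := by
      calc (‖ξ‖ ^ 2) ^ 2 ≤ (1 + ‖ξ‖ ^ 2) ^ 2 := by gcongr; linarith
        _ = (1 + ‖ξ‖ ^ 2) ^ (2 : ℝ) := by norm_cast
        _ ≤ _ := Real.rpow_le_rpow_of_exponent_le (by nlinarith [norm_nonneg ξ]) (by linarith)
    calc _ = (4 * Real.pi ^ 2) ^ 2 * ((‖ξ‖ ^ 2) ^ 2 * ‖vhat w i ξ‖ ^ 2) := by ring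
      _ ≤ _ := by gcongr
  have hi2 : ∀ i, Integrable (fun ξ => ((4 * Real.pi ^ 2 * ‖ξ‖ ^ 2) * ‖vhat w i ξ‖) ^ 2) volume :=
    fun i => ((hint i).1.const_mul _).mono'
      (((by fun_prop : Continuous fun ξ : E3 => 4 * Real.pi ^ 2 * ‖ξ‖ ^ 2).aestronglyMeasurable.mul
        (memLp_vhat w i).1.norm).pow 2)
      (Eventually.of_forall fun ξ => by
        rw [Real.norm_of_nonneg (by positivity)]
        exact hsq2 i ξ)
  refine ⟨hi1, ?_, hi2, ?_, Real.sqrt_nonneg _⟩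
  · have h1 : ∀ i, ∫ ξ, ‖ξ‖ * ‖vhat w i ξ‖ ≤ √J * √M := fun i => by
      refine (integral_mono (hi1 i) (hprod i) (hle i)).trans
        ((integral_mul_le_sqrt hg (hh i)).trans ?_)
      gcongr
      simp only [mul_pow, hsq]
      exact (hint i).2
    gcongr
    exact (Finset.sum_le_sum fun i _ => h1 i).trans_eq (by simp)
  · rw [Real.sq_sqrt (by positivity)]
    have h1 : ∀ i, ∫ ξ, ((4 * Real.pi ^ 2 * ‖ξ‖ ^ 2) * ‖vhat w i ξ‖) ^ 2 ≤
        (4 * Real.pi ^ 2) ^ 2 * M := fun i => by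
      refine (integral_mono (hi2 i) ((hint i).1.const_mul _) (hsq2 i)).trans ?_
      rw [integral_const_mul]
      gcongr
      exact (hint i).2
    exact (Finset.sum_le_sum fun i _ => h1 i).trans_eq (by simp)

/-- High Sobolev norms dominate the energy. -/
theorem norm_sq_le_of_sobolevSq_le {s : ℝ} (hs : 0 ≤ s) {M : ℝ≥0} {w : L2} (h : sobolevSq s w ≤ M) :
    ‖w‖ ^ 2 ≤ 3 * M := by
  rw [← sum_integral_norm_sq_vhat]
  have h1 : ∀ i, ∫ ξ, ‖vhat w i ξ‖ ^ 2 ≤ M := fun i => by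
    obtain ⟨h1, h2⟩ := integral_sobolev_weight_le h i
    refine (integral_mono (memLp_vhat w i).norm.integrable_sq h1 fun ξ => ?_).trans h2
    have : 1 ≤ (1 + ‖ξ‖ ^ 2) ^ s := Real.one_le_rpow (by nlinarith [norm_nonneg ξ]) hs
    exact le_mul_of_one_le_left (by positivity) this
  exact (Finset.sum_le_sum fun i _ => h1 i).trans_eq (by simp)

/-! ### The gradient of a regular field -/

theorem dist_boundedContinuous (D D' : BoundedContinuousFunction E3 (E3 →L[ℝ] E3)) :
    dist D D' = ‖D - D'‖ := by
  refine le_antisymm ?_ ?_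
  · refine (BoundedContinuousFunction.dist_le (norm_nonneg (D - D'))).2 fun x => ?_
    rw [dist_eq_norm]
    exact (D - D').norm_coe_le_norm x
  · refine (BoundedContinuousFunction.norm_le dist_nonneg).2 fun x => ?_
    rw [BoundedContinuousFunction.sub_apply, ← dist_eq_norm]
    exact BoundedContinuousFunction.dist_coe_le_dist x

theorem norm_mollifyGrad_sub_le {n m : ℕ} (w : L2)
    (h : ∀ i, Integrable (fun ξ => ‖ξ‖ * ‖vhat w i ξ‖) volume) :
    ‖mollifyGrad n w - mollifyGrad m w‖ ≤ 2 * Real.pi *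
      ((∑ i, ∫ ξ, ‖ξ‖ * ‖vhat w i ξ - bandSym n w i ξ‖) +
        ∑ i, ∫ ξ, ‖ξ‖ * ‖vhat w i ξ - bandSym m w i ξ‖) := by
  have hb : ∀ k i, Integrable (fun ξ => ‖ξ‖ * ‖vhat w i ξ - bandSym k w i ξ‖) volume :=
    fun k i => by
    refine ((h i).const_mul 2).mono' (continuous_norm.aestronglyMeasurable.mul
      ((memLp_vhat w i).1.sub (band_bandSym k w i).memLp.1).norm) (Eventually.of_forall fun ξ => ?_)
    rw [Real.norm_of_nonneg (by positivity)]
    have := norm_sub_le (vhat w i ξ) (bandSym k w i ξ)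
    have := norm_bandSym_le k w i ξ
    have := norm_nonneg ξ
    nlinarith
  have hGi : ∀ i, Integrable (fun ξ => bandSym n w i ξ - bandSym m w i ξ) volume := fun i =>
    (band_bandSym n w i).integrable.sub (band_bandSym m w i).integrable
  have hGle : ∀ i ξ, ‖ξ‖ * ‖bandSym n w i ξ - bandSym m w i ξ‖ ≤
      ‖ξ‖ * ‖vhat w i ξ - bandSym n w i ξ‖ + ‖ξ‖ * ‖vhat w i ξ - bandSym m w i ξ‖ := fun i ξ => by
    rw [← mul_add]
    gcongr
    rw [norm_sub_rev (vhat w i ξ) (bandSym n w i ξ)]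
    exact norm_sub_le_norm_sub_add_norm_sub _ _ _
  have hGi' : ∀ i, Integrable (fun ξ => ‖ξ‖ * ‖bandSym n w i ξ - bandSym m w i ξ‖) volume :=
    fun i =>
    ((hb n i).add (hb m i)).mono' (continuous_norm.aestronglyMeasurable.mul (hGi i).1.norm)
      (Eventually.of_forall fun ξ => by
        rw [Real.norm_of_nonneg (by positivity)]
        exact hGle i ξ)
  have hfield : ∀ x, field (fun i ξ => bandSym n w i ξ - bandSym m w i ξ) x =
      mollify n w x - mollify m w x := fun x => by
    ext i
    exact reInv_sub (band_bandSym n w i).integrable (band_bandSym m w i).integrable x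
  refine (BoundedContinuousFunction.norm_le ?_).2 fun x => ?_
  · refine mul_nonneg (by positivity) (add_nonneg ?_ ?_) <;>
      exact Finset.sum_nonneg fun i _ => integral_nonneg fun ξ => by positivity
  · have h1 := norm_fderiv_field_le hGi hGi' x
    rw [funext hfield, fderiv_fun_sub (differentiable_mollify n w x) (differentiable_mollify m w x)]
      at h1
    refine h1.trans ?_
    gcongr
    rw [← Finset.sum_add_distrib]
    refine Finset.sum_le_sum fun i _ => ?_
    rw [← integral_add (hb n i) (hb m i)]
    exact integral_mono (hGi' i) ((hb n i).add (hb m i)) (hGle i)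

/-- The gradient of a regular field, as the uniform limit of the gradients of its frequency
localisations (a junk value if there is no such limit). -/
def gradient (w : L2) : BoundedContinuousFunction E3 (E3 →L[ℝ] E3) :=
  limUnder atTop fun n => mollifyGrad n w

theorem Regular.tendsto_mollifyGrad {L K : ℝ} {w : L2} (h : Regular L K w) :
    Tendsto (fun n => mollifyGrad n w) atTop (𝓝 (gradient w)) := by
  refine CauchySeq.tendsto_limUnder ?_
  have h0 : Tendsto (fun n => ∑ i, ∫ ξ, ‖ξ‖ * ‖vhat w i ξ - bandSym n w i ξ‖) atTop (𝓝 0) := by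
    have : ∀ i, Tendsto (fun n => ∫ ξ, ‖ξ‖ * ‖vhat w i ξ - bandSym n w i ξ‖) atTop (𝓝 0) :=
      fun i => by
      rw [← integral_zero E3 ℝ (μ := volume)]
      refine tendsto_integral_of_dominated_convergence (fun ξ => 2 * (‖ξ‖ * ‖vhat w i ξ‖))
        (fun n => continuous_norm.aestronglyMeasurable.mul
          ((memLp_vhat w i).1.sub (band_bandSym n w i).memLp.1).norm)
        ((h.integrable i).const_mul 2) (fun n => Eventually.of_forall fun ξ => ?_) ?_
      · rw [Real.norm_of_nonneg (by positivity)]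
        have := norm_sub_le (vhat w i ξ) (bandSym n w i ξ)
        have := norm_bandSym_le n w i ξ
        have := norm_nonneg ξ
        nlinarith
      · filter_upwards [tendsto_bandSym w i] with ξ hξ
        simpa using ((tendsto_const_nhds (x := vhat w i ξ)).sub hξ).norm.const_mul ‖ξ‖
    simpa using tendsto_finsetSum Finset.univ fun i _ => this i
  rw [Metric.cauchySeq_iff]
  intro ε hε
  have hev := (h0.const_mul (2 * Real.pi)).eventually (gt_mem_nhds
    (show 2 * Real.pi * 0 < ε / 2 by rw [mul_zero]; positivity))
  obtain ⟨N, hN⟩ := eventually_atTop.1 hev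
  refine ⟨N, fun n hn m hm => ?_⟩
  rw [dist_boundedContinuous]
  refine (norm_mollifyGrad_sub_le w h.integrable).trans_lt ?_
  rw [mul_add]
  linarith [hN n hn, hN m hm]

theorem Regular.norm_mollifyGrad_le {L K : ℝ} {w : L2} (h : Regular L K w) (n : ℕ) :
    ‖mollifyGrad n w‖ ≤ L := by
  refine (Fluid.norm_mollifyGrad_le n w).trans (le_trans ?_ h.le_left)
  gcongr with i
  · exact (band_bandSym n w i).integrable_norm_mul
  · exact h.integrable i
  · intro ξ
    exact mul_le_mul_of_nonneg_left (norm_bandSym_le n w i ξ) (norm_nonneg ξ)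

theorem Regular.norm_gradient_le {L K : ℝ} {w : L2} (h : Regular L K w) : ‖gradient w‖ ≤ L := by
  refine (BoundedContinuousFunction.norm_le
    ((norm_nonneg (mollifyGrad 0 w)).trans (h.norm_mollifyGrad_le 0))).2
    fun x => ?_
  exact le_of_tendsto' (((continuous_eval_const x).tendsto _).comp
    h.tendsto_mollifyGrad).norm fun n =>
      ((mollifyGrad n w).norm_coe_le_norm x).trans (h.norm_mollifyGrad_le n)

theorem Regular.norm_mollifyLap_le {L K : ℝ} {w : L2} (h : Regular L K w) (n : ℕ) :
    ‖mollifyLap n w‖ ≤ K := by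
  suffices h2 : ‖mollifyLap n w‖ ^ 2 ≤ K ^ 2 from (abs_le_of_sq_le_sq' h2 h.nonneg).2
  refine (norm_mollifyLap_sq_le n w).trans (le_trans ?_ h.le_right)
  refine Finset.sum_le_sum fun i _ => ?_
  refine integral_mono_of_nonneg (Eventually.of_forall fun ξ => by positivity) (h.integrable_sq i)
    (Eventually.of_forall fun ξ => ?_)
  have := norm_bandSym_le n w i ξ
  simp only
  gcongr

theorem tendsto_matMul {ι : Type*} {l : Filter ι}
    {D : ι → BoundedContinuousFunction E3 (E3 →L[ℝ] E3)} {z : ι → L2}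
    {D' : BoundedContinuousFunction E3 (E3 →L[ℝ] E3)} {z' : L2} (h : Tendsto D l (𝓝 D'))
    (hz : Tendsto z l (𝓝 z')) :
    Tendsto (fun k => matMul (D k) (z k)) l (𝓝 (matMul D' z')) := by
  have h : Tendsto (fun n => ‖D n - D'‖) l (𝓝 0) := by
    simpa only [dist_boundedContinuous] using! tendsto_iff_dist_tendsto_zero.1 h
  have h1 : Tendsto (fun k => matMul (D k - D') (z k)) l (𝓝 0) := by
    refine squeeze_zero_norm (fun k => norm_matMul_le _ _) ?_
    simpa using h.mul hz.norm
  have h2 := h1.add (((matMul D').continuous.tendsto z').comp hz)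
  rw [zero_add] at h2
  refine h2.congr fun k => ?_
  rw [matMul_sub, Function.comp_apply, sub_add_cancel]

/-! ### The advection term -/

/-- Advection by a divergence-free field is skew-symmetric. -/
theorem inner_matMul_mollifyGrad_add (v : L2sigma) (a b : L2) (m n : ℕ) :
    ⟪mollifyL2 m a, matMul (mollifyGrad n b) v⟫ + ⟪mollifyL2 n b, matMul (mollifyGrad m a) v⟫ =
      0 := by
  have hcoord : ∀ (k : ℕ) (c : L2) (x y : E3) (i : Fin 3),
      fderiv ℝ (fun z => mollify k c z i) x y = (fderiv ℝ (mollify k c) x y) i :=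
        fun k c x y i => by
    have := ((EuclideanSpace.proj i : E3 →L[ℝ] ℝ).hasFDerivAt.comp x
      (differentiable_mollify k c x).hasFDerivAt).fderiv
    exact congrArg (fun T : E3 →L[ℝ] ℝ => T y) this
  have hn : ∀ (k : ℕ) (c : L2) (i : Fin 3), Nice fun z => mollify k c z i := fun k c i =>
    (nice_mollify k c).clm_comp (EuclideanSpace.proj i : E3 →L[ℝ] ℝ)
  have hterm : ∀ (k l : ℕ) (c d : L2) (i : Fin 3), Integrable (fun x =>
      fderiv ℝ (fun z => mollify k c z i) x ((v : L2) x) * mollify l d x i) volume :=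
        fun k l c d i => by
    have h1 : MemLp (fun x => fderiv ℝ (fun z => mollify k c z i) x ((v : L2) x)) 2 volume := by
      simp only [hcoord]
      exact (EuclideanSpace.proj i : E3 →L[ℝ] ℝ).comp_memLp' (memLp_matMul (mollifyGrad k c) v)
    exact h1.integrable_mul (hn l d i).memLp_self
  have e : ∀ (k l : ℕ) (c d : L2), ⟪mollifyL2 l d, matMul (mollifyGrad k c) v⟫ =
      ∑ i, ∫ x, fderiv ℝ (fun z => mollify k c z i) x ((v : L2) x) * mollify l d x i :=
        fun k l c d => by
    rw [inner_matMul, ← integral_finsetSum _ fun i _ => hterm k l c d i]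
    apply integral_congr_ae
    filter_upwards [coeFn_mollifyL2 l d] with x hx
    rw [hx, inner_E3]
    refine Finset.sum_congr rfl fun i _ => ?_
    rw [hcoord, mollifyGrad_apply, mul_comm]
  rw [e, e, ← Finset.sum_add_distrib]
  refine Finset.sum_eq_zero fun i _ => ?_
  rw [← integral_add (hterm n m b a i) (hterm m n a b i), ← integral_fderiv_mul_eq_zero v (hn n b i)
    (hn m a i).contDiff (hn m a i).norm_bounded (hn m a i).fderiv.norm_bounded]
  congr 1
  ext x
  ring

/-- The trilinear form vanishes: `∫ w · ((v · ∇)w) = 0` for divergence-free `v`. -/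
theorem Regular.inner_matMul_gradient {L K : ℝ} {w : L2} (h : Regular L K w) (v : L2sigma) :
    ⟪w, matMul (gradient w) v⟫ = 0 := by
  refine tendsto_nhds_unique ((tendsto_mollifyL2 w).inner
    (tendsto_matMul h.tendsto_mollifyGrad tendsto_const_nhds)) ?_
  refine tendsto_const_nhds.congr fun n => ?_
  have := inner_matMul_mollifyGrad_add v w w n n
  linarith

/-- `w ↦ -P((w · ∇)w)`, where `P` is the projection to the divergence-free fields. -/
def advect (w : L2) : L2sigma := -L2sigma.orthogonalProjectionOnto (matMul (gradient w) w)

theorem inner_advect (w : L2) (v : L2sigma) : ⟪advect w, v⟫ = -⟪matMul (gradient w) w, v⟫ := by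
  rw [advect, inner_neg_left]
  congr 1
  exact Submodule.inner_orthogonalProjectionOnto_eq_of_mem_right v _

theorem Regular.norm_advect_le {L K : ℝ} {w : L2} (h : Regular L K w) : ‖advect w‖ ≤ L * ‖w‖ := by
  rw [advect, norm_neg]
  refine (Submodule.norm_orthogonalProjectionOnto_apply_le _ _).trans
    ((norm_matMul_le _ _).trans ?_)
  gcongr
  exact h.norm_gradient_le

theorem Regular.inner_advect_self {L K : ℝ} {w : L2sigma} (h : Regular L K w) :
    ⟪advect w, w⟫ = 0 := by
  rw [inner_advect, real_inner_comm, h.inner_matMul_gradient, neg_zero]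

/-- For a regular field the derivative in the advection term can be moved from the test field to the
field itself. -/
theorem Regular.inner_force_zero {L K : ℝ} {w : L2sigma} (h : Regular L K w) (n : ℕ) (v : L2sigma) :
    ⟪force n 0 (w : L2), v⟫ = -⟪matMul (gradient w) w, mollifyL2 n v⟫ := by
  rw [inner_force, zero_mul, zero_add]
  have h1 : Tendsto (fun m => ⟪mollifyL2 m (w : L2), matMul (mollifyGrad n v) (w : L2)⟫) atTop
      (𝓝 ⟪(w : L2), matMul (mollifyGrad n v) (w : L2)⟫) :=
    (tendsto_mollifyL2 (w : L2)).inner tendsto_const_nhds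
  have h2 : Tendsto (fun m => -⟪mollifyL2 n (v : L2), matMul (mollifyGrad m (w : L2)) (w : L2)⟫)
    atTop
      (𝓝 (-⟪mollifyL2 n (v : L2), matMul (gradient (w : L2)) (w : L2)⟫)) :=
    (tendsto_const_nhds.inner (tendsto_matMul h.tendsto_mollifyGrad tendsto_const_nhds)).neg
  rw [real_inner_comm (mollifyL2 n (v : L2))]
  refine tendsto_nhds_unique h1 (h2.congr fun m => ?_)
  have := inner_matMul_mollifyGrad_add w w v m n
  linarith

theorem Regular.tendsto_inner_force {L K : ℝ} {w : L2sigma} (h : Regular L K w) (v : L2sigma) :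
    Tendsto (fun n => ⟪force n 0 (w : L2), v⟫) atTop (𝓝 ⟪advect w, v⟫) := by
  simp only [h.inner_force_zero, inner_advect]
  exact (tendsto_const_nhds.inner (tendsto_mollifyL2 (v : L2))).neg

/-- The cancellation behind weak–strong uniqueness: in the evolution of `⟪u, w⟫`, where `w` solves
the Euler equations, the cubic terms combine to an expression that is quadratic in `u - w`. -/
theorem Regular.inner_matMul_add_advect {L K : ℝ} {w : L2sigma} (h : Regular L K w) (u : L2sigma) :
    ⟪(u : L2), matMul (gradient w) u⟫ + ⟪u, advect w⟫ =
      ⟪((u - w : L2sigma) : L2), matMul (gradient w) (u - w : L2sigma)⟫ := by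
  have h1 := h.inner_matMul_gradient (u - w)
  rw [real_inner_comm (advect w) u, inner_advect, real_inner_comm (u : L2)]
  rw [Submodule.coe_sub, map_sub] at h1 ⊢
  rw [inner_sub_left, h1, inner_sub_right]
  ring

/-! ### Sobolev solutions of the Euler equations -/

/-- A strong solution `W` of `W' = -P((W · ∇)W)` with datum `w₀` in the sense of primitives, with
locally bounded regularity; it also solves the Euler equations weakly. -/
structure EulerFlow (w₀ : L2sigma) (W : ℝ → L2sigma) : Prop where
  initial : W 0 = w₀
  locBdd_advect : LocBdd fun t => advect (W t)
  eq_primitive : ∀ t, 0 ≤ t → W t = W 0 + ∫ τ in (0 : ℝ)..t, advect (W τ)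
  regular : ∀ T : ℝ, 0 < T → ∃ L K : ℝ, 0 ≤ L ∧
    ∀ᵐ t ∂volume.restrict (Ioi (0 : ℝ)), t ≤ T → Regular L K (W t)
  weakForm : WeakForm 0 w₀ W

theorem tendsto_inner_smooth (u v : L2sigma) :
    Tendsto (fun n => ⟪smooth n (u : L2), v⟫) atTop (𝓝 ⟪u, v⟫) := by
  have h : Tendsto (fun n => ⟪(u : L2), mollifyL2 n (v : L2)⟫) atTop (𝓝 ⟪(u : L2), (v : L2)⟫) :=
    tendsto_const_nhds.inner (tendsto_mollifyL2 (v : L2))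
  exact h.congr fun n => (inner_smooth n u v).symm

theorem ae_restrict_Ioi_of_Ioo {P : ℝ → Prop} {T : ℝ}
    (h : ∀ᵐ t ∂volume.restrict (Ioo 0 (T + 1)), P t) :
    ∀ᵐ t ∂volume.restrict (Ioi (0 : ℝ)), t ≤ T → P t := by
  rw [ae_restrict_iff' measurableSet_Ioo] at h
  rw [ae_restrict_iff' measurableSet_Ioi]
  filter_upwards [h] with t ht ht0 htT
  exact ht ⟨ht0, by linarith⟩

theorem IsSobolevEulerSolution.locBdd {s : ℝ} (hs : 0 ≤ s) {u₀ : L2sigma} {u : ℝ → L2sigma}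
    (h : IsSobolevEulerSolution s u₀ u) : LocBdd u where
  meas := h.measurable
  bdd T hT := by
    obtain ⟨C, hC⟩ := h.bounded (T + 1) (by linarith)
    refine ⟨√(3 * C), Real.sqrt_nonneg _, ?_⟩
    filter_upwards [ae_restrict_Ioi_of_Ioo hC] with t ht htT
    exact Real.le_sqrt_of_sq_le (norm_sq_le_of_sobolevSq_le hs (ht htT))

theorem IsSobolevEulerSolution.regular {s : ℝ} (hs : 5 / 2 < s) {u₀ : L2sigma} {u : ℝ → L2sigma}
    (h : IsSobolevEulerSolution s u₀ u) {T : ℝ} (hT : 0 < T) : ∃ L K : ℝ, 0 ≤ L ∧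
      ∀ᵐ t ∂volume.restrict (Ioi (0 : ℝ)), t ≤ T → Regular L K (u t) := by
  obtain ⟨C, hC⟩ := h.bounded (T + 1) (by linarith)
  obtain ⟨L, K, hL, hreg⟩ := exists_regular hs C
  refine ⟨L, K, hL, ?_⟩
  filter_upwards [ae_restrict_Ioi_of_Ioo hC] with t ht htT using hreg _ (ht htT)

theorem IsSobolevEulerSolution.ae_regular {s : ℝ} (hs : 5 / 2 < s) {u₀ : L2sigma} {u : ℝ → L2sigma}
    (h : IsSobolevEulerSolution s u₀ u) :
    ∀ᵐ t ∂volume.restrict (Ioi (0 : ℝ)), ∃ L K : ℝ, Regular L K (u t) := by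
  have hk : ∀ k : ℕ, ∀ᵐ t ∂volume.restrict (Ioi (0 : ℝ)), t ≤ (k : ℝ) + 1 → ∃ L K : ℝ,
    Regular L K (u t) :=
    fun k => by
      obtain ⟨L, K, -, hLK⟩ := h.regular hs (T := k + 1) (by positivity)
      filter_upwards [hLK] with t ht htk using ⟨L, K, ht htk⟩
  filter_upwards [ae_all_iff.2 hk] with t ht
  obtain ⟨k, hk⟩ := exists_nat_ge t
  exact ht k (by linarith)

theorem IsSobolevEulerSolution.locBdd_advect {s : ℝ} (hs : 5 / 2 < s) {u₀ : L2sigma}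
    {u : ℝ → L2sigma}
    (h : IsSobolevEulerSolution s u₀ u) : LocBdd fun t => advect (u t) where
  meas := by
    have hu := h.locBdd (by linarith)
    refine aestronglyMeasurable_of_inner fun v => ?_
    refine aestronglyMeasurable_of_tendsto_ae atTop
      (f := fun n t => ⟪v, force n 0 (u t : L2)⟫) (fun n => ?_) ?_
    · exact aestronglyMeasurable_const.inner (locBdd_force hu n 0).meas
    · filter_upwards [h.ae_regular hs] with t ⟨L, K, ht⟩
      simp only [real_inner_comm _ v]
      exact ht.tendsto_inner_force v
  bdd T hT := by
    obtain ⟨M, hM0, hM⟩ := (h.locBdd (by linarith)).bdd T hT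
    obtain ⟨L, K, hL, hreg⟩ := h.regular hs hT
    refine ⟨L * M, by positivity, ?_⟩
    filter_upwards [hM, hreg] with t h1 h2 htT
    refine (h2 htT).norm_advect_le.trans ?_
    have : ‖(u t : L2)‖ ≤ M := h1 htT
    gcongr

theorem inner_intervalIntegral {p : ℝ → L2sigma} {t : ℝ} (hp : IntervalIntegrable p volume 0 t)
    (v : L2sigma) : ⟪∫ τ in (0 : ℝ)..t, p τ, v⟫ = ∫ τ in (0 : ℝ)..t, ⟪p τ, v⟫ := by
  rw [real_inner_comm]
  have := (innerSL ℝ v).intervalIntegral_comp_comm hp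
  simp only [innerSL_apply_apply] at this
  rw [← this]
  simp only [real_inner_comm v]

/-- The limit of the frequency-localised equations, as the frequency cutoff is removed. -/
theorem IsSobolevEulerSolution.ae_eq_primitive {s : ℝ} (hs : 5 / 2 < s) {u₀ : L2sigma}
    {u : ℝ → L2sigma} (h : IsSobolevEulerSolution s u₀ u) :
    ∀ᵐ t ∂volume.restrict (Ioi (0 : ℝ)), u t = u₀ + ∫ τ in (0 : ℝ)..t, advect (u τ) := by
  have hu := h.locBdd (by linarith)
  have hf := h.locBdd_advect hs
  filter_upwards [ae_all_iff.2 fun n => h.weakForm.ae_smooth_eq hu n,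
    ae_restrict_mem measurableSet_Ioi]
    with t ht ht0
  have ht0 : 0 < t := ht0
  refine ext_inner_right ℝ fun v => ?_
  rw [inner_add_left, inner_intervalIntegral (hf.intervalIntegrable le_rfl ht0.le)]
  refine tendsto_nhds_unique (tendsto_inner_smooth (u t) v) ?_
  have e : ∀ n, ⟪smooth n (u t : L2), v⟫ = ⟪smooth n (u₀ : L2), v⟫ +
      ∫ τ in (0 : ℝ)..t, ⟪force n 0 (u τ : L2), v⟫ := fun n => by
    rw [ht n, inner_add_left, inner_intervalIntegral
      ((locBdd_force hu n 0).intervalIntegrable le_rfl ht0.le)]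
  simp only [e]
  refine (tendsto_inner_smooth u₀ v).add ?_
  obtain ⟨M, hM0, hM⟩ := hu.bdd t ht0
  obtain ⟨L, K, hL, hreg⟩ := h.regular hs ht0
  have hsub : uIoc 0 t ⊆ Ioi 0 := by
    rw [uIoc_of_le ht0.le]
    exact fun τ hτ => hτ.1
  refine intervalIntegral.tendsto_integral_filter_of_dominated_convergence (fun _ => L * M * ‖v‖)
    (Eventually.of_forall fun n => ?_)
      (Eventually.of_forall fun n => ?_) intervalIntegrable_const ?_
  · exact ((locBdd_force hu n 0).meas.inner aestronglyMeasurable_const).mono_set hsub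
  · filter_upwards [(ae_restrict_iff' measurableSet_Ioi).1 hM,
      (ae_restrict_iff' measurableSet_Ioi).1 hreg] with τ h1 h2 hτ
    have hτt : τ ≤ t := by
      rw [uIoc_of_le ht0.le] at hτ
      exact hτ.2
    have h3 : ‖(u τ : L2)‖ ≤ M := h1 (hsub hτ) hτt
    have h4 := h2 (hsub hτ) hτt
    rw [h4.inner_force_zero, norm_neg]
    refine (norm_inner_le_norm (𝕜 := ℝ) _ _).trans ?_
    have h5 : ‖mollifyL2 n (v : L2)‖ ≤ ‖v‖ := norm_mollifyL2_le n (v : L2)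
    have h6 : ‖matMul (gradient (u τ)) (u τ : L2)‖ ≤ L * M := (norm_matMul_le _ _).trans (by
      have := h4.norm_gradient_le
      gcongr)
    gcongr
  · filter_upwards [(ae_restrict_iff' measurableSet_Ioi).1 (h.ae_regular hs)] with τ hτ hτt
    obtain ⟨L', K', hLK⟩ := hτ (hsub hτt)
    exact hLK.tendsto_inner_force v

theorem WeakForm.congr {ν : ℝ} {u₀ : L2sigma} {u w : ℝ → L2sigma} (h : WeakForm ν u₀ u)
    (huw : ∀ᵐ t ∂volume.restrict (Ioi (0 : ℝ)), w t = u t) : WeakForm ν u₀ w := by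
  intro φ h1 h2 h3
  rw [← h φ h1 h2 h3]
  apply integral_congr_ae
  filter_upwards [huw] with t ht
  rw [ht]

/-- A Sobolev solution of the Euler equations has a strong representative. -/
theorem IsSobolevEulerSolution.exists_eulerFlow {s : ℝ} (hs : 5 / 2 < s) {w₀ : L2sigma}
    {u : ℝ → L2sigma} (h : IsSobolevEulerSolution s w₀ u) : ∃ W, EulerFlow w₀ W := by
  have hf := h.locBdd_advect hs
  set W : ℝ → L2sigma := fun t => w₀ + ∫ τ in (0 : ℝ)..t, advect (u τ) with hW
  have hae : ∀ᵐ t ∂volume.restrict (Ioi (0 : ℝ)), u t = W t := h.ae_eq_primitive hs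
  have hW0 : W 0 = w₀ := by simp [hW]
  refine ⟨W, hW0, ⟨?_, fun T hT => ?_⟩, fun t ht => ?_, fun T hT => ?_,
    h.weakForm.congr (by filter_upwards [hae] with t ht using ht.symm)⟩
  · refine hf.meas.congr ?_
    filter_upwards [hae] with t ht
    rw [ht]
  · obtain ⟨M, hM0, hM⟩ := hf.bdd T hT
    refine ⟨M, hM0, ?_⟩
    filter_upwards [hM, hae] with t h1 h2
    rwa [h2] at h1
  · rw [hW0]
    simp only [hW]
    congr 1
    refine intervalIntegral.integral_congr_ae ?_
    filter_upwards [(ae_restrict_iff' measurableSet_Ioi).1 hae] with τ hτ hτt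
    rw [uIoc_of_le ht] at hτt
    rw [hτ hτt.1]
  · obtain ⟨L, K, hL, hreg⟩ := h.regular hs hT
    refine ⟨L, K, hL, ?_⟩
    filter_upwards [hreg, hae] with t h1 h2
    rwa [h2] at h1

theorem EulerFlow.continuousOn {w₀ : L2sigma} {W : ℝ → L2sigma} (h : EulerFlow w₀ W) :
    ContinuousOn W (Ici 0) :=
  (h.locBdd_advect.continuousOn_primitive (W 0)).congr h.eq_primitive

theorem EulerFlow.locBdd {w₀ : L2sigma} {W : ℝ → L2sigma} (h : EulerFlow w₀ W) : LocBdd W :=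
  LocBdd.of_continuousOn h.continuousOn

theorem EulerFlow.weaklyContinuous {w₀ : L2sigma} {W : ℝ → L2sigma} (h : EulerFlow w₀ W) :
    WeaklyContinuous W := fun _ => continuousOn_const.inner h.continuousOn

/-- Conservation of energy. -/
theorem EulerFlow.norm_eq {w₀ : L2sigma} {W : ℝ → L2sigma} (h : EulerFlow w₀ W) {t : ℝ}
    (ht : 0 ≤ t) :
    ‖W t‖ = ‖w₀‖ := by
  have h1 : ∫ τ in (0 : ℝ)..t, (⟪advect (W τ), W τ⟫ + ⟪W τ, advect (W τ)⟫) =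
      ⟪W t, W t⟫ - ⟪W 0, W 0⟫ :=
    LocBdd.integral_bilin (innerSL ℝ) h.locBdd_advect h.locBdd_advect h.eq_primitive
      h.eq_primitive ht
  rw [real_inner_self_eq_norm_sq, real_inner_self_eq_norm_sq, h.initial] at h1
  obtain rfl | ht := ht.eq_or_lt
  · rw [h.initial]
  obtain ⟨L, K, -, hreg⟩ := h.regular t ht
  have h2 : ∫ τ in (0 : ℝ)..t, (⟪advect (W τ), W τ⟫ + ⟪W τ, advect (W τ)⟫) =
      ∫ τ in (0 : ℝ)..t, (0 : ℝ) := by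
    refine intervalIntegral.integral_congr_ae ?_
    filter_upwards [(ae_restrict_iff' measurableSet_Ioi).1 hreg] with τ hτ hτt
    rw [uIoc_of_le ht.le] at hτt
    rw [real_inner_comm (advect (W τ : L2)) (W τ), (hτ hτt.1 hτt.2).inner_advect_self, add_zero]
  rw [h2, intervalIntegral.integral_zero] at h1
  have h3 : ‖W t‖ ^ 2 = ‖w₀‖ ^ 2 := by linarith
  exact (pow_left_inj₀ (norm_nonneg _) (norm_nonneg _) two_ne_zero).1 h3

/-! ### Stability of Sobolev solutions -/

/-- Gronwall's inequality for bounded functions that need not be continuous. The supremum `S` of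
`y(t) e^(-4Lt)` satisfies `S ≤ a + S / 2`, because of the factor `4` instead of `2` in the
exponential. -/
theorem le_mul_exp_of_le_add_integral {y : ℝ → ℝ} {T a B L : ℝ} (hT : 0 ≤ T) (hL : 0 ≤ L)
    (hy0 : ∀ t ∈ Icc 0 T, 0 ≤ y t) (hy : ∀ t ∈ Icc 0 T, y t ≤ B)
      (hint : IntervalIntegrable y volume 0 T)
    (h : ∀ t ∈ Icc 0 T, y t ≤ a + 2 * L * ∫ τ in (0 : ℝ)..t, y τ) :
    ∀ t ∈ Icc 0 T, y t ≤ 2 * a * Real.exp (4 * L * t) := by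
  set S := sSup ((fun t => y t * Real.exp (-(4 * L * t))) '' Icc 0 T) with hS
  have hexp : ∀ t, 0 ≤ t → Real.exp (-(4 * L * t)) ≤ 1 := fun t ht => by
    rw [Real.exp_le_one_iff]
    have : 0 ≤ 4 * L * t := by positivity
    linarith
  have hb : BddAbove ((fun t => y t * Real.exp (-(4 * L * t))) '' Icc 0 T) := by
    refine ⟨max B 0, ?_⟩
    rintro _ ⟨t, ht, rfl⟩
    have h1 : y t ≤ max B 0 := (hy t ht).trans (le_max_left _ _)
    have h2 : 0 ≤ max B 0 := le_max_right _ _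
    have h3 := hexp t ht.1
    have h4 := Real.exp_pos (-(4 * L * t))
    simp only
    nlinarith
  have hyS : ∀ t ∈ Icc 0 T, y t ≤ S * Real.exp (4 * L * t) := fun t ht => by
    have h1 : y t * Real.exp (-(4 * L * t)) ≤ S := le_csSup hb ⟨t, ht, rfl⟩
    have h2 := mul_le_mul_of_nonneg_right h1 (Real.exp_pos (4 * L * t)).le
    rwa [mul_assoc, ← Real.exp_add, neg_add_cancel, Real.exp_zero, mul_one] at h2
  have hI : ∀ t, ∫ τ in (0 : ℝ)..t, S * Real.exp (4 * L * τ) * (4 * L) =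
      S * Real.exp (4 * L * t) - S := fun t => by
    have hd : ∀ τ : ℝ, HasDerivAt (fun τ => S * Real.exp (4 * L * τ))
        (S * Real.exp (4 * L * τ) * (4 * L)) τ := fun τ => by
      have h1 : HasDerivAt (fun τ : ℝ => 4 * L * τ) (4 * L) τ := by
        simpa using (hasDerivAt_id τ).const_mul (4 * L)
      simpa [mul_assoc] using h1.exp.const_mul S
    rw [intervalIntegral.integral_eq_sub_of_hasDerivAt (fun τ _ => hd τ)
      (Continuous.intervalIntegrable (by fun_prop) _ _)]
    simp
  have hSle : S ≤ 2 * a := by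
    have h0 : (0 : ℝ) ∈ Icc 0 T := ⟨le_rfl, hT⟩
    have hS0 : 0 ≤ S := (hy0 0 h0).trans (by simpa using hyS 0 h0)
    have ha0 : 0 ≤ a := (hy0 0 h0).trans (by simpa using h 0 h0)
    have h1 : S ≤ a + S / 2 := by
      refine csSup_le ((nonempty_Icc.2 hT).image _) ?_
      rintro _ ⟨t, ht, rfl⟩
      have h2 : ∫ τ in (0 : ℝ)..t, y τ * (4 * L) ≤ ∫ τ in (0 : ℝ)..t,
        S * Real.exp (4 * L * τ) * (4 * L) := by
        refine intervalIntegral.integral_mono_on ht.1 ?_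
          (Continuous.intervalIntegrable (by fun_prop) _ _)
          fun τ hτ => ?_
        · refine (hint.mul_const _).mono_set ?_
          rw [uIcc_of_le ht.1, uIcc_of_le hT]
          exact Icc_subset_Icc_right ht.2
        · have := hyS τ ⟨hτ.1, hτ.2.trans ht.2⟩
          gcongr
      rw [hI, intervalIntegral.integral_mul_const] at h2
      have h3 := h t ht
      have h4 : y t ≤ (a - S / 2) + S / 2 * Real.exp (4 * L * t) := by nlinarith
      have h5 := mul_le_mul_of_nonneg_right h4 (Real.exp_pos (-(4 * L * t))).le
      rw [add_mul, mul_assoc (S / 2), ← Real.exp_add, add_neg_cancel, Real.exp_zero, mul_one] at h5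
      have h6 := hexp t ht.1
      have h7 := Real.exp_pos (-(4 * L * t))
      refine h5.trans ?_
      nlinarith
    linarith
  intro t ht
  exact (hyS t ht).trans (by gcongr)

theorem LocBdd.sub {E : Type*} [NormedAddCommGroup E] {p q : ℝ → E} (hp : LocBdd p)
    (hq : LocBdd q) :
    LocBdd fun t => p t - q t := by
  have hn : LocBdd fun t => -q t :=
    ⟨hq.meas.neg, fun T hT => by simpa only [norm_neg] using hq.bdd T hT⟩
  simpa only [sub_eq_add_neg] using hp.add hn

theorem WeaklyContinuous.inner_coe {u : ℝ → L2sigma} (hu : WeaklyContinuous u) (z : L2) :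
    ContinuousOn (fun t => ⟪(u t : L2), z⟫) (Ici 0) := by
  refine (hu (L2sigma.orthogonalProjectionOnto z)).congr fun t _ => ?_
  simp only
  rw [real_inner_comm]
  exact (Submodule.inner_orthogonalProjectionOnto_eq_of_mem_right (u t) z).symm

theorem WeaklyContinuous.locBdd {u : ℝ → L2sigma} (hu : WeaklyContinuous u) {C : ℝ}
    (hC : ∀ t, 0 ≤ t → ‖u t‖ ≤ C) : LocBdd u where
  meas := aestronglyMeasurable_of_inner fun v =>
    ((hu v).mono Ioi_subset_Ici_self).aestronglyMeasurable measurableSet_Ioi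
  bdd T _ := by
    refine ⟨max C 0, le_max_right _ _, ?_⟩
    filter_upwards [ae_restrict_mem measurableSet_Ioi] with t ht _
    exact (hC t (le_of_lt ht)).trans (le_max_left _ _)

theorem eqOn_Ici_of_ae {f g : ℝ → ℝ} (hf : ContinuousOn f (Ici 0)) (hg : ContinuousOn g (Ici 0))
    (h : ∀ᵐ t ∂volume.restrict (Ioi (0 : ℝ)), f t = g t) : EqOn f g (Ici 0) := by
  refine Measure.eqOn_of_ae_eq (μ := volume) ?_ hf hg (by rw [interior_Ici, closure_Ioi])
  rwa [← restrict_Ioi_eq_restrict_Ici]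

theorem WeakForm.smooth_eq {ν : ℝ} {u₀ : L2sigma} {u : ℝ → L2sigma} (h : WeakForm ν u₀ u)
    (hu : LocBdd u) (huc : WeaklyContinuous u) (n : ℕ) {t : ℝ} (ht : 0 ≤ t) :
    smooth n (u t : L2) = smooth n (u₀ : L2) + ∫ τ in (0 : ℝ)..t, force n ν (u τ) := by
  refine ext_inner_right ℝ fun v => ?_
  have hb := locBdd_force hu n ν
  refine eqOn_Ici_of_ae (f := fun t => ⟪smooth n (u t : L2), v⟫)
    (g := fun t => ⟪smooth n (u₀ : L2) + ∫ τ in (0 : ℝ)..t, force n ν (u τ), v⟫) ?_ ?_ ?_ ht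
  · exact (huc.inner_coe (mollifyL2 n v)).congr fun t _ => inner_smooth n (u t) v
  · exact (hb.continuousOn_primitive _).inner continuousOn_const
  · filter_upwards [h.ae_smooth_eq hu n] with t ht
    rw [ht]

/-- The relative energy inequality between a weak solution and a Sobolev solution `W`. The product
rule is applied to the scalar product of `W` and the frequency localisation of `u`, and the cutoff
is removed. The viscosity only contributes `ν ∫ u · ΔW`, which is bounded by `ν K T ‖u₀‖`. -/
theorem EulerFlow.norm_sq_sub_le_integral {ν T L K : ℝ} (hν : 0 ≤ ν) {u₀ w₀ : L2sigma}
    {u W : ℝ → L2sigma} (hW : EulerFlow w₀ W) (hu : WeakForm ν u₀ u) (huc : WeaklyContinuous u)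
    (hu0 : u 0 = u₀) (hub : ∀ t, 0 ≤ t → ‖u t‖ ≤ ‖u₀‖) (hL : 0 ≤ L)
    (hreg : ∀ᵐ t ∂volume.restrict (Ioi (0 : ℝ)), t ≤ T → Regular L K (W t)) (hK : 0 ≤ K) {t : ℝ}
    (ht : t ∈ Icc 0 T) :
    ‖u t - W t‖ ^ 2 ≤ (‖u₀ - w₀‖ ^ 2 + 2 * ν * K * T * ‖u₀‖) +
      2 * L * ∫ τ in (0 : ℝ)..t, ‖u τ - W τ‖ ^ 2 := by
  have hul := huc.locBdd hub
  have hsub : uIoc 0 t ⊆ Ioi 0 := by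
    rw [uIoc_of_le ht.1]
    exact fun τ hτ => hτ.1
  have hsubT : ∀ τ ∈ uIoc 0 t, τ ≤ T := by
    rw [uIoc_of_le ht.1]
    exact fun τ hτ => hτ.2.trans ht.2
  have hreg' : ∀ᵐ τ, τ ∈ uIoc 0 t → Regular L K (W τ) := by
    filter_upwards [(ae_restrict_iff' measurableSet_Ioi).1 hreg] with τ hτ hτt
    exact hτ (hsub hτt) (hsubT τ hτt)
  have hinner : ∀ {p q : ℝ → L2sigma}, LocBdd p → LocBdd q → LocBdd fun τ => ⟪p τ, q τ⟫ :=
    fun hp hq => LocBdd.bilin (innerSL ℝ) hp hq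
  have hsm : ∀ n, LocBdd fun τ => smooth n (u τ : L2) := fun n => hul.coe_L2.clm_comp (smooth n)
  -- the product rule
  have hprod : ∀ n, ∫ τ in (0 : ℝ)..t,
    (⟪force n ν (u τ : L2), W τ⟫ + ⟪smooth n (u τ : L2), advect (W τ)⟫) =
      ⟪smooth n (u t : L2), W t⟫ - ⟪smooth n (u 0 : L2), W 0⟫ := fun n =>
    LocBdd.integral_bilin (innerSL ℝ) (P := fun τ => smooth n (u τ : L2)) (locBdd_force hul n ν)
      hW.locBdd_advect
        (fun τ hτ => by rw [hu0]; exact hu.smooth_eq hul huc n hτ) hW.eq_primitive ht.1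
  have hgl : ∀ n, LocBdd fun τ => ⟪force n 0 (u τ : L2), W τ⟫ +
    ⟪smooth n (u τ : L2), advect (W τ)⟫ :=
    fun n => (hinner (locBdd_force hul n 0) hW.locBdd).add (hinner (hsm n) hW.locBdd_advect)
  have hle : ∀ n, ∫ τ in (0 : ℝ)..t, (⟪force n 0 (u τ : L2), W τ⟫ +
    ⟪smooth n (u τ : L2), advect (W τ)⟫) ≤
      (⟪smooth n (u t : L2), W t⟫ - ⟪smooth n (u 0 : L2), W 0⟫) + ν * K * ‖u₀‖ * t := fun n => by
    have hc : ∫ _τ in (0 : ℝ)..t, ν * K * ‖u₀‖ = ν * K * ‖u₀‖ * t := by simp; ring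
    have i1 : IntervalIntegrable (fun τ => ⟪force n ν (u τ : L2), W τ⟫ +
        ⟪smooth n (u τ : L2), advect (W τ)⟫) volume 0 t :=
      ((hinner (locBdd_force hul n ν) hW.locBdd).add
        (hinner (hsm n) hW.locBdd_advect)).intervalIntegrable
        le_rfl ht.1
    rw [← hprod n, ← hc, ← intervalIntegral.integral_add i1 intervalIntegrable_const]
    refine intervalIntegral.integral_mono_ae_restrict ht.1 ((hgl n).intervalIntegrable le_rfl ht.1)
      (i1.add intervalIntegrable_const) ?_
    rw [EventuallyLE, ae_restrict_iff' measurableSet_Icc]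
    filter_upwards [hreg', show ∀ᵐ τ : ℝ, τ ≠ 0 by simp [ae_iff, measure_singleton]] with τ h1 h0 hτ
    have h2 : τ ∈ uIoc 0 t := by
      rw [uIoc_of_le ht.1]
      exact ⟨lt_of_le_of_ne hτ.1 (Ne.symm h0), hτ.2⟩
    rw [inner_force, inner_force]
    have h3 : -(‖u₀‖ * K) ≤ ⟪(u τ : L2), mollifyLap n (W τ)⟫ := by
      refine neg_le_of_abs_le ((abs_real_inner_le_norm _ _).trans ?_)
      have h4 := (h1 h2).norm_mollifyLap_le n
      have h5 : ‖(u τ : L2)‖ ≤ ‖u₀‖ := hub τ hτ.1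
      gcongr
    have h4 := mul_le_mul_of_nonneg_left h3 hν
    linarith
  -- the limit of the cubic terms
  set g : ℝ → ℝ := fun τ => ⟪((u τ - W τ : L2sigma) : L2),
    matMul (gradient (W τ)) (u τ - W τ : L2sigma)⟫ with hg
  have hlim : ∀ᵐ τ, τ ∈ uIoc 0 t → Tendsto (fun n => ⟪force n 0 (u τ : L2), W τ⟫ +
      ⟪smooth n (u τ : L2), advect (W τ)⟫) atTop (𝓝 (g τ)) := by
    filter_upwards [hreg'] with τ h1 hτ
    simp only [hg]
    rw [← (h1 hτ).inner_matMul_add_advect]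
    refine Tendsto.add ?_ (tendsto_inner_smooth _ _)
    simp only [inner_force, zero_mul, zero_add]
    exact tendsto_const_nhds.inner (tendsto_matMul (h1 hτ).tendsto_mollifyGrad tendsto_const_nhds)
  have hbd : ∀ n, ∀ᵐ τ, τ ∈ uIoc 0 t → ‖⟪force n 0 (u τ : L2), W τ⟫ +
      ⟪smooth n (u τ : L2), advect (W τ)⟫‖ ≤ L * (‖u₀‖ * ‖u₀‖) + ‖u₀‖ * (L * ‖w₀‖) := fun n => by
    filter_upwards [hreg'] with τ h1 hτ
    have hτ0 : 0 ≤ τ := le_of_lt (hsub hτ)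
    have h5 : ‖(u τ : L2)‖ ≤ ‖u₀‖ := hub τ hτ0
    refine (norm_add_le _ _).trans (add_le_add ?_ ?_)
    · rw [inner_force, zero_mul, zero_add, Real.norm_eq_abs]
      refine (abs_inner_matMul_le _ _ _).trans ?_
      have := (h1 hτ).norm_mollifyGrad_le n
      gcongr
    · refine (norm_inner_le_norm (𝕜 := ℝ) _ _).trans ?_
      have h6 := (norm_smooth_le n (u τ : L2)).trans h5
      have h7 := (h1 hτ).norm_advect_le
      have h8 : ‖(W τ : L2)‖ = ‖w₀‖ := hW.norm_eq hτ0
      rw [h8] at h7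
      gcongr
  have hmeas : ∀ n, AEStronglyMeasurable (fun τ => ⟪force n 0 (u τ : L2), W τ⟫ +
      ⟪smooth n (u τ : L2), advect (W τ)⟫) (volume.restrict (uIoc 0 t)) := fun n =>
    (hgl n).meas.mono_set hsub
  have hint := intervalIntegral.tendsto_integral_filter_of_dominated_convergence _
    (Eventually.of_forall hmeas) (Eventually.of_forall hbd) intervalIntegrable_const hlim
  have h1 : ∫ τ in (0 : ℝ)..t, g τ ≤ (⟪u t, W t⟫ - ⟪u 0, W 0⟫) + ν * K * ‖u₀‖ * t :=
    le_of_tendsto_of_tendsto' hint (((tendsto_inner_smooth _ _).sub (tendsto_inner_smooth _ _)).add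
      tendsto_const_nhds) hle
  -- the quadratic bound of the limit
  have hgi : IntervalIntegrable g volume 0 t := by
    rw [intervalIntegrable_iff]
    refine IntegrableOn.of_bound (s := uIoc 0 t) measure_Ioc_lt_top
      (aestronglyMeasurable_of_tendsto_ae atTop hmeas
        ((ae_restrict_iff' measurableSet_uIoc).2 hlim)) (L * (‖u₀‖ * ‖u₀‖) + ‖u₀‖ * (L * ‖w₀‖)) ?_
    rw [ae_restrict_iff' measurableSet_uIoc]
    filter_upwards [hlim, ae_all_iff.2 hbd] with τ h1 h2 hτ
    exact le_of_tendsto' (h1 hτ).norm fun n => h2 n hτ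
  have hdl : LocBdd fun τ => ‖u τ - W τ‖ ^ 2 := by
    have h2 : LocBdd fun τ => u τ - W τ := hul.sub hW.locBdd
    simpa only [real_inner_self_eq_norm_sq] using hinner h2 h2
  have h2 : -(L * ∫ τ in (0 : ℝ)..t, ‖u τ - W τ‖ ^ 2) ≤ ∫ τ in (0 : ℝ)..t, g τ := by
    rw [← intervalIntegral.integral_const_mul, ← intervalIntegral.integral_neg]
    refine intervalIntegral.integral_mono_ae_restrict ht.1
      ((hdl.intervalIntegrable le_rfl ht.1).const_mul L).neg hgi ?_
    rw [EventuallyLE, ae_restrict_iff' measurableSet_Icc]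
    filter_upwards [hreg', show ∀ᵐ τ : ℝ, τ ≠ 0 by simp [ae_iff, measure_singleton]] with τ h1 h0 hτ
    have h2 : τ ∈ uIoc 0 t := by
      rw [uIoc_of_le ht.1]
      exact ⟨lt_of_le_of_ne hτ.1 (Ne.symm h0), hτ.2⟩
    refine neg_le_of_abs_le ((abs_inner_matMul_le _ _ _).trans ?_)
    rw [sq]
    have := (h1 h2).norm_gradient_le
    have e : ‖((u τ - W τ : L2sigma) : L2)‖ = ‖u τ - W τ‖ := rfl
    rw [e]
    gcongr
  have h3 := hub t ht.1
  have h4 : ‖u t‖ ^ 2 ≤ ‖u₀‖ ^ 2 := by gcongr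
  have h5 : ν * K * ‖u₀‖ * t ≤ ν * K * ‖u₀‖ * T := by
    have := ht.2
    gcongr
  rw [norm_sub_sq_real, norm_sub_sq_real, hW.norm_eq ht.1]
  rw [hu0, hW.initial] at h1
  linarith

/-- Sobolev solutions of the Euler equations attract weak solutions with nearby data, uniformly on
bounded time intervals. -/
theorem EulerFlow.norm_sq_sub_le {ν T L K : ℝ} (hν : 0 ≤ ν) {u₀ w₀ : L2sigma}
    {u W : ℝ → L2sigma} (hW : EulerFlow w₀ W) (hu : WeakForm ν u₀ u) (huc : WeaklyContinuous u)
    (hu0 : u 0 = u₀) (hub : ∀ t, 0 ≤ t → ‖u t‖ ≤ ‖u₀‖) (hL : 0 ≤ L)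
    (hreg : ∀ᵐ t ∂volume.restrict (Ioi (0 : ℝ)), t ≤ T → Regular L K (W t)) (hK : 0 ≤ K) {t : ℝ}
    (ht : t ∈ Icc 0 T) :
    ‖u t - W t‖ ^ 2 ≤ 2 * (‖u₀ - w₀‖ ^ 2 + 2 * ν * K * T * ‖u₀‖) * Real.exp (4 * L * T) := by
  have hT : 0 ≤ T := ht.1.trans ht.2
  have hdl : LocBdd fun τ => ‖u τ - W τ‖ ^ 2 := by
    have h2 : LocBdd fun τ => u τ - W τ := (huc.locBdd hub).sub hW.locBdd
    have h3 : LocBdd fun τ => ⟪u τ - W τ, u τ - W τ⟫ := LocBdd.bilin (innerSL ℝ) h2 h2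
    simpa only [real_inner_self_eq_norm_sq] using h3
  refine (le_mul_exp_of_le_add_integral (y := fun τ => ‖u τ - W τ‖ ^ 2)
    (B := (‖u₀‖ + ‖w₀‖) ^ 2) hT hL
    (fun τ _ => sq_nonneg _) (fun τ hτ => ?_) (hdl.intervalIntegrable le_rfl hT)
    (fun τ hτ => hW.norm_sq_sub_le_integral hν hu huc hu0 hub hL hreg hK hτ) t ht).trans ?_
  · have h1 := hub τ hτ.1
    have h2 := hW.norm_eq hτ.1
    have h3 := norm_sub_le (u τ) (W τ)
    rw [h2] at h3
    have h4 : ‖u τ - W τ‖ ≤ ‖u₀‖ + ‖w₀‖ := by linarith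
    gcongr
  · have := ht.2
    gcongr

end Fluid

namespace Fluid
open FourierTransform

/-! ### Density of the Sobolev fields -/

theorem lintegral_sobolev_weight_schwartz_lt_top (s : ℝ) (G : SchwartzMap E3 ℂ) :
    ∫⁻ ξ : E3, ENNReal.ofReal ((1 + ‖ξ‖ ^ 2) ^ s) * ‖G ξ‖ₑ ^ 2 < ⊤ := by
  have hg : Function.HasTemperateGrowth fun ξ : E3 => (1 + ‖ξ‖ ^ 2) ^ (s / 2) := by fun_prop
  have hm := (SchwartzMap.smulLeftCLM ℂ (fun ξ : E3 => (1 + ‖ξ‖ ^ 2) ^ (s / 2)) G).memLp 2 volume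
  have h := (memLp_two_iff_integrable_sq_norm hm.1).1 hm
  refine lt_of_eq_of_lt (lintegral_congr fun ξ => ?_) h.2
  beta_reduce
  rw [SchwartzMap.smulLeftCLM_apply_apply hg, Real.enorm_of_nonneg
    (by positivity), norm_smul, mul_pow,
    ENNReal.ofReal_mul (by positivity), Real.norm_of_nonneg (by positivity), ← ofReal_norm,
    ENNReal.ofReal_pow (norm_nonneg _), rpow_half_sq (by positivity)]

theorem sobolevSq_toLp_lt_top (s : ℝ) {f : E3 → E3} (hf : ContDiff ℝ ∞ f)
    (hc : HasCompactSupport f) :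
    sobolevSq s ((nice_of_compactSupport hf hc).memLp_self.toLp f) < ⊤ := by
  refine ENNReal.sum_lt_top.2 fun i _ => ?_
  have hfi : ContDiff ℝ ∞ fun x => ((f x i : ℝ) : ℂ) :=
    (Complex.ofRealCLM.comp (EuclideanSpace.proj i : E3 →L[ℝ] ℝ)).contDiff.comp hf
  have hci : HasCompactSupport fun x => ((f x i : ℝ) : ℂ) :=
    hc.comp_left (g := fun y : E3 => ((y i : ℝ) : ℂ)) (by simp)
  have e : component i ((nice_of_compactSupport hf hc).memLp_self.toLp f) =
      (hci.toSchwartzMap hfi).toLp 2 := by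
    ext1
    filter_upwards [coeFn_component i ((nice_of_compactSupport hf hc).memLp_self.toLp f),
      (nice_of_compactSupport hf hc).memLp_self.coeFn_toLp,
      (hci.toSchwartzMap hfi).coeFn_toLp 2] with x h1 h2 h3
    rw [h1, h2, h3]
    rfl
  rw [e, SchwartzMap.toLp_fourier_eq]
  refine lt_of_eq_of_lt (lintegral_congr_ae ?_)
    (lintegral_sobolev_weight_schwartz_lt_top s (𝓕 (hci.toSchwartzMap hfi)))
  filter_upwards [(𝓕 (hci.toSchwartzMap hfi)).coeFn_toLp 2] with ξ hξ
  rw [hξ]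

theorem toLp_mem_L2sigma {f : E3 → E3} (hf : ContDiff ℝ ∞ f) (hc : HasCompactSupport f)
    (hdiv : ∀ x, divergence f x = 0) :
    (nice_of_compactSupport hf hc).memLp_self.toLp f ∈ L2sigma := by
  intro ψ hψ hψc
  have e : ∫ x, fderiv ℝ ψ x ((nice_of_compactSupport hf hc).memLp_self.toLp f x) =
      ∫ x, ∑ i, f x i * fderiv ℝ ψ x (EuclideanSpace.single i 1) := by
    apply integral_congr_ae
    filter_upwards [(nice_of_compactSupport hf hc).memLp_self.coeFn_toLp] with x hx
    rw [hx]
    conv_lhs => rw [← (EuclideanSpace.basisFun (Fin 3) ℝ).sum_repr (f x)]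
    simp
  have hfi : ∀ i, ContDiff ℝ ∞ fun x => f x i := fun i =>
    (EuclideanSpace.proj i : E3 →L[ℝ] ℝ).contDiff.comp hf
  have hci : ∀ i, HasCompactSupport fun x => f x i := fun i =>
    hc.comp_left (g := fun y : E3 => y i) (by simp)
  have hdψ : ∀ i, Continuous fun x => fderiv ℝ ψ x (EuclideanSpace.single i (1 : ℝ)) := fun i =>
    (hψ.continuous_fderiv (by simp)).clm_apply continuous_const
  have hdf : ∀ i, Continuous fun x => fderiv ℝ (fun y => f y i) x
    (EuclideanSpace.single i (1 : ℝ)) :=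
    fun i => ((hfi i).continuous_fderiv (by simp)).clm_apply continuous_const
  have i1 : ∀ i, Integrable (fun x => f x i * fderiv ℝ ψ x
    (EuclideanSpace.single i (1 : ℝ))) volume :=
    fun i => ((hfi i).continuous.mul (hdψ i)).integrable_of_hasCompactSupport (hci i).mul_right
  have i2 : ∀ i, Integrable (fun x => fderiv ℝ (fun y => f y i) x
    (EuclideanSpace.single i (1 : ℝ)) * ψ x)
      volume := fun i => ((hdf i).mul hψ.continuous).integrable_of_hasCompactSupport hψc.mul_left
  have i3 : ∀ i, Integrable (fun x => f x i * ψ x) volume := fun i =>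
    ((hfi i).continuous.mul hψ.continuous).integrable_of_hasCompactSupport hψc.mul_left
  rw [e, integral_finsetSum _ fun i _ => i1 i]
  have hp : ∀ i, ∫ x, f x i * fderiv ℝ ψ x (EuclideanSpace.single i (1 : ℝ)) =
      -∫ x, fderiv ℝ (fun y => f y i) x (EuclideanSpace.single i (1 : ℝ)) * ψ x := fun i =>
    integral_mul_fderiv_eq_neg_fderiv_mul_of_integrable (i2 i) (i1 i) (i3 i)
      (fun x _ => (hfi i).differentiable (by simp) x) fun x _ => hψ.differentiable (by simp) x
  simp only [hp]
  rw [Finset.sum_neg_distrib, ← integral_finsetSum _ fun i _ => i2 i, neg_eq_zero]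
  rw [← integral_zero E3 ℝ (μ := volume)]
  congr 1
  ext x
  rw [← Finset.sum_mul]
  have : ∑ i, fderiv ℝ (fun y => f y i) x (EuclideanSpace.single i (1 : ℝ)) = divergence f x := by
    refine Finset.sum_congr rfl fun i _ => ?_
    have h1 := ((EuclideanSpace.proj i : E3 →L[ℝ] ℝ).hasFDerivAt.comp x
      (hf.differentiable (by simp) x).hasFDerivAt).fderiv
    exact congrArg (fun T : E3 →L[ℝ] ℝ => T (EuclideanSpace.single i 1)) h1
  rw [this, hdiv, zero_mul]

/-- The divergence-free fields of finite Sobolev norm are dense: they contain the smooth, compactly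
supported ones, whose closure contains all frequency localisations. -/
theorem dense_sobolev (s : ℝ) : Dense {w : L2sigma | sobolevSq s w < ⊤} := by
  set S : Set L2 := {w | w ∈ L2sigma ∧ sobolevSq s w < ⊤} with hS
  have hmoll : ∀ (n : ℕ) (v : L2sigma), mollifyL2 n (v : L2) ∈ closure S := fun n v => by
    obtain ⟨φ, hφ, hφc, hφd, hφe, m, hm, -, hφm⟩ := exists_testFields n v
    set F : ℕ → L2 := fun k => (nice_of_compactSupport (hφ k) (hφc k)).memLp_self.toLp (φ k) with hF
    refine mem_closure_of_tendsto (f := F) (b := atTop) ?_ (Eventually.of_forall fun k =>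
      ⟨toLp_mem_L2sigma (hφ k) (hφc k) (hφd k), sobolevSq_toLp_lt_top s (hφ k) (hφc k)⟩)
    rw [tendsto_iff_norm_sub_tendsto_zero]
    have hb : ∀ k x, ‖φ k x‖ ≤ m 0 x := fun k x => by simpa using hφm 0 k x
    have hb' : ∀ x, ‖mollify n (v : L2) x‖ ≤ m 0 x := fun x => by
      obtain ⟨k, hk⟩ := (hφe x).exists
      rw [← hk.eq_of_nhds]
      exact hb k x
    have e : ∀ k, ‖F k - mollifyL2 n (v : L2)‖ ^ 2 = ∫ x, ‖φ k x - mollify n (v : L2) x‖ ^ 2 :=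
      fun k => by
      rw [Lp.norm_sq_eq_integral]
      apply integral_congr_ae
      filter_upwards [Lp.coeFn_sub (F k) (mollifyL2 n (v : L2)), coeFn_mollifyL2 n (v : L2),
        (nice_of_compactSupport (hφ k) (hφc k)).memLp_self.coeFn_toLp] with x h1 h2 h3
      rw [h1, Pi.sub_apply, h2, h3]
    have hlim : Tendsto (fun k => ∫ x, ‖φ k x - mollify n (v : L2) x‖ ^ 2) atTop (𝓝 0) := by
      rw [← integral_zero E3 ℝ (μ := volume)]
      refine tendsto_integral_of_dominated_convergence (fun x => (2 * m 0 x) ^ 2) (fun k => ?_)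
        ((hm 0).const_mul 2).integrable_sq (fun k => Eventually.of_forall fun x => ?_)
        (Eventually.of_forall fun x => ?_)
      · exact ((((hφ k).continuous.sub (nice_mollify n (v : L2)).contDiff.continuous).norm).pow
          2).aestronglyMeasurable
      · rw [Real.norm_of_nonneg (by positivity)]
        have := (norm_sub_le (φ k x) (mollify n (v : L2) x)).trans (add_le_add (hb k x) (hb' x))
        gcongr
        linarith
      · refine tendsto_const_nhds.congr' ?_
        filter_upwards [hφe x] with k hk
        rw [hk.eq_of_nhds]
        simp
    have h2 := hlim.sqrt
    rw [Real.sqrt_zero] at h2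
    refine h2.congr fun k => ?_
    rw [← e, Real.sqrt_sq (norm_nonneg _)]
  intro v
  rw [closure_subtype]
  have h1 : (v : L2) ∈ closure S := by
    rw [← closure_closure]
    exact mem_closure_of_tendsto (tendsto_mollifyL2 (v : L2))
      (Eventually.of_forall fun n => hmoll n v)
  refine closure_mono ?_ h1
  rintro w ⟨hw, hws⟩
  exact ⟨⟨w, hw⟩, hws, rfl⟩

/-! ### Limits of solutions of the Euler equations -/

/-- A compactly supported family of maps, as a curve in the space of bounded continuous maps. -/
def slice (g : ℝ × E3 → E3 →L[ℝ] E3) (hg : Continuous g) (hc : HasCompactSupport g) (t : ℝ) :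
    BoundedContinuousFunction E3 (E3 →L[ℝ] E3) :=
  BoundedContinuousFunction.ofNormedAddCommGroup (fun x => g (t, x)) (hg.comp (by fun_prop))
    (hg.bounded_above_of_compact_support hc).choose
    fun x => (hg.bounded_above_of_compact_support hc).choose_spec (t, x)

@[simp] theorem slice_apply (g : ℝ × E3 → E3 →L[ℝ] E3) (hg : Continuous g)
  (hc : HasCompactSupport g)
    (t : ℝ) (x : E3) : slice g hg hc t x = g (t, x) := rfl

theorem exists_norm_slice_le (g : ℝ × E3 → E3 →L[ℝ] E3) (hg : Continuous g)
    (hc : HasCompactSupport g) :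
    ∃ C : ℝ, 0 ≤ C ∧ ∀ t, ‖slice g hg hc t‖ ≤ C := by
  obtain ⟨C, hC⟩ := hg.bounded_above_of_compact_support hc
  have hC0 : 0 ≤ C := (norm_nonneg _).trans (hC (0, 0))
  exact ⟨C, hC0, fun t => (BoundedContinuousFunction.norm_le hC0).2 fun x => hC (t, x)⟩

theorem continuous_slice (g : ℝ × E3 → E3 →L[ℝ] E3) (hg : Continuous g) (hc : HasCompactSupport g) :
    Continuous (slice g hg hc) := by
  have hu := hc.uniformContinuous_of_continuous hg
  rw [Metric.uniformContinuous_iff] at hu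
  rw [Metric.continuous_iff]
  intro t ε hε
  obtain ⟨δ, hδ, h⟩ := hu (ε / 2) (half_pos hε)
  refine ⟨δ, hδ, fun r hr => ?_⟩
  refine lt_of_le_of_lt ((BoundedContinuousFunction.dist_le (half_pos hε).le).2 fun x => ?_)
    (half_lt_self hε)
  refine (h ?_).le
  rw [Prod.dist_eq, dist_self, max_eq_left dist_nonneg]
  exact hr

/-- The weak form of the Euler equations as the integral of a functional that is jointly continuous
in the time and in the field. -/
theorem exists_weakForm_functional {φ : ℝ → E3 → E3} (hφ : ContDiff ℝ ∞ (Function.uncurry φ))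
    (hc : HasCompactSupport (Function.uncurry φ)) :
    ∃ (A D : ℝ → BoundedContinuousFunction E3 (E3 →L[ℝ] E3)) (h : L2) (C T : ℝ), 0 < T ∧ 0 ≤ C ∧
      Continuous A ∧ Continuous D ∧ (∀ t, ‖A t‖ ≤ C) ∧ (∀ t, ‖D t‖ ≤ C) ∧
      (∀ t, T < t → A t = 0 ∧ D t = 0) ∧ ∀ (t : ℝ) (z : L2),
        ∫ x, (⟪z x, deriv (fun τ => φ τ x) t + (0 : ℝ) • Laplacian.laplacian (φ t) x⟫ +
          ⟪z x, fderiv ℝ (φ t) x (z x)⟫) = ⟪z, matMul (A t) h⟫ + ⟪z, matMul (D t) z⟫ := by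
  set e0 : E3 := EuclideanSpace.single 0 1 with he0
  have hfc : Continuous (fderiv ℝ (Function.uncurry φ)) := hφ.continuous_fderiv (by simp)
  have hfs : HasCompactSupport (fderiv ℝ (Function.uncurry φ)) := hc.fderiv ℝ
  -- the time derivative, written as a matrix applied to a fixed unit vector
  set LA : (ℝ × E3 →L[ℝ] E3) →L[ℝ] (E3 →L[ℝ] E3) :=
    (ContinuousLinearMap.smulRightL ℝ E3 E3 (EuclideanSpace.proj 0 : E3 →L[ℝ] ℝ)).comp
      (ContinuousLinearMap.apply ℝ E3 ((1, 0) : ℝ × E3)) with hLA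
  set LD : (ℝ × E3 →L[ℝ] E3) →L[ℝ] (E3 →L[ℝ] E3) :=
    (ContinuousLinearMap.compL ℝ E3 (ℝ × E3) E3).flip (ContinuousLinearMap.inr ℝ ℝ E3) with hLD
  set gA : ℝ × E3 → E3 →L[ℝ] E3 := fun p => LA (fderiv ℝ (Function.uncurry φ) p) with hgA
  set gD : ℝ × E3 → E3 →L[ℝ] E3 := fun p => LD (fderiv ℝ (Function.uncurry φ) p) with hgD
  have hgAc : Continuous gA := LA.continuous.comp hfc
  have hgDc : Continuous gD := LD.continuous.comp hfc
  have hgAs : HasCompactSupport gA := hfs.comp_left (map_zero LA)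
  have hgDs : HasCompactSupport gD := hfs.comp_left (map_zero LD)
  -- a spatial ball that contains the support
  set B : Set E3 := Prod.snd '' tsupport (Function.uncurry φ) with hB
  have hBc : IsCompact B := hc.isCompact.image continuous_snd
  set h : L2 := indicatorConstLp 2 hBc.measurableSet hBc.measure_lt_top.ne e0 with hh
  obtain ⟨CA, hCA0, hCA⟩ := exists_norm_slice_le gA hgAc hgAs
  obtain ⟨CD, hCD0, hCD⟩ := exists_norm_slice_le gD hgDc hgDs
  obtain ⟨T, hT⟩ := (hc.isCompact.image continuous_fst).isBounded.subset_closedBall 0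
  have hzero : ∀ t, max T 1 < t → ∀ x, fderiv ℝ (Function.uncurry φ) (t, x) = 0 := fun t ht x => by
    refine image_eq_zero_of_notMem_tsupport fun hm => ?_
    have h1 := hT ⟨(t, x), tsupport_fderiv_subset ℝ hm, rfl⟩
    rw [Real.closedBall_eq_Icc] at h1
    have := h1.2
    have := le_max_left T 1
    simp only at *
    linarith
  have hdt : ∀ t x, deriv (fun τ => φ τ x) t = fderiv ℝ (Function.uncurry φ) (t, x) (1, 0) :=
    fun t x => by
    have h1 : HasFDerivAt (Function.uncurry φ) (fderiv ℝ (Function.uncurry φ) (t, x)) (t, x) :=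
      (hφ.differentiable (by simp) _).hasFDerivAt
    have h2 : HasDerivAt (fun τ : ℝ => (τ, x)) ((1 : ℝ), (0 : E3)) t :=
      (hasDerivAt_id t).prodMk (hasDerivAt_const t x)
    exact (h1.comp_hasDerivAt t h2).deriv
  have hdx : ∀ t x, fderiv ℝ (φ t) x = gD (t, x) := fun t x => by
    have h1 : HasFDerivAt (Function.uncurry φ) (fderiv ℝ (Function.uncurry φ) (t, x)) (t, x) :=
      (hφ.differentiable (by simp) _).hasFDerivAt
    have h2 : HasFDerivAt (fun y : E3 => (t, y)) (ContinuousLinearMap.inr ℝ ℝ E3) x :=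
      hasFDerivAt_prodMk_right t x
    exact (h1.comp x h2).fderiv
  refine ⟨slice gA hgAc hgAs, slice gD hgDc hgDs, h, max CA CD, max T 1,
    by positivity, by positivity,
    continuous_slice _ _ _, continuous_slice _ _ _, fun t => (hCA t).trans (le_max_left _ _),
    fun t => (hCD t).trans (le_max_right _ _), fun t ht => ⟨?_, ?_⟩, fun t z => ?_⟩
  · ext1 x
    simp [hgA, hzero t ht x]
  · ext1 x
    simp [hgD, hzero t ht x]
  · have e1 : ∀ᵐ x, slice gA hgAc hgAs t x (h x) = deriv (fun τ => φ τ x) t := by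
      filter_upwards [indicatorConstLp_coeFn (p := 2) (hs := hBc.measurableSet)
        (hμs := hBc.measure_lt_top.ne) (c := e0)] with x hx
      rw [slice_apply, hh, hx, hdt]
      by_cases hxB : x ∈ B
      · rw [indicator_of_mem hxB]
        simp [hgA, hLA, he0]
      · have h0 : fderiv ℝ (Function.uncurry φ) (t, x) = 0 :=
          image_eq_zero_of_notMem_tsupport fun hm => hxB ⟨(t, x), tsupport_fderiv_subset ℝ hm, rfl⟩
        rw [indicator_of_notMem hxB, h0]
        simp
    rw [inner_matMul, inner_matMul, ← integral_add (integrable_inner_matMul _ _ _)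
      (integrable_inner_matMul _ _ _)]
    apply integral_congr_ae
    filter_upwards [e1] with x hx
    rw [hx, slice_apply, hdx, zero_smul, add_zero]

/-- Pointwise limits of bounded continuous solutions of the Euler equations are solutions. -/
theorem WeakForm.of_tendsto {w : ℕ → L2sigma} {u₀ : L2sigma} {W : ℕ → ℝ → L2sigma} {u : ℝ → L2sigma}
    (hW : ∀ k, WeakForm 0 (w k) (W k)) (hWc : ∀ k, ContinuousOn (W k) (Ici 0)) {M : ℝ}
    (hM : ∀ k t, 0 ≤ t → ‖W k t‖ ≤ M) (hw : Tendsto w atTop (𝓝 u₀))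
    (hu : ∀ t, 0 ≤ t → Tendsto (fun k => W k t) atTop (𝓝 (u t))) : WeakForm 0 u₀ u := by
  intro φ hφ hc hdiv
  obtain ⟨A, D, h, C, T, hT, hC, hA, hD, hAC, hDC, hz, hF⟩ := exists_weakForm_functional hφ hc
  have hW' := fun k => hW k φ hφ hc hdiv
  simp only [hF] at hW' ⊢
  have hφ0 : MemLp (φ 0) 2 (volume : Measure E3) := by
    have h1 : Continuous (φ 0) := hφ.continuous.comp
      (by fun_prop : Continuous fun x : E3 => ((0 : ℝ), x))
    refine h1.memLp_of_hasCompactSupport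
      (HasCompactSupport.intro (hc.isCompact.image continuous_snd)
      fun x hx => ?_)
    exact image_eq_zero_of_notMem_tsupport (f := Function.uncurry φ) (x := (0, x))
      fun hm => hx ⟨(0, x), hm, rfl⟩
  have hcoe : Continuous fun z : L2sigma => (z : L2) := continuous_subtype_val
  have hR : Tendsto (fun k => -∫ x, ⟪(w k : L2) x, φ 0 x⟫) atTop
    (𝓝 (-∫ x, ⟪(u₀ : L2) x, φ 0 x⟫)) := by
    simp only [pairField_eq_inner hφ0]
    exact (((hcoe.tendsto u₀).comp hw).inner tendsto_const_nhds).neg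
  refine tendsto_nhds_unique ?_ hR
  simp only [← hW']
  have hM0 : 0 ≤ M := (norm_nonneg _).trans (hM 0 0 le_rfl)
  refine tendsto_integral_of_dominated_convergence
    ((Ioc 0 T).indicator fun _ => C * (M * ‖h‖) + C * (M * M)) (fun k => ?_) ?_ (fun k => ?_) ?_
  · refine ContinuousOn.aestronglyMeasurable (fun t ht => ?_) measurableSet_Ioi
    have h1 : Tendsto (fun τ => ((W k τ : L2sigma) : L2)) (𝓝[Ioi 0] t) (𝓝 (W k t : L2)) :=
      (hcoe.tendsto _).comp ((hWc k t (mem_Ici.2 (le_of_lt ht))).mono Ioi_subset_Ici_self)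
    exact (h1.inner (tendsto_matMul (hA.continuousWithinAt (s := Ioi 0)) tendsto_const_nhds)).add
      (h1.inner (tendsto_matMul (hD.continuousWithinAt (s := Ioi 0)) h1))
  · refine ((integrable_indicator_iff measurableSet_Ioc).2 ?_).integrableOn
    exact integrableOn_const measure_Ioc_lt_top.ne
  · filter_upwards [ae_restrict_mem measurableSet_Ioi] with t ht
    have ht : 0 < t := ht
    by_cases htT : t ≤ T
    · rw [indicator_of_mem (mem_Ioc.2 ⟨ht, htT⟩)]
      have h1 : ‖(W k t : L2)‖ ≤ M := hM k t ht.le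
      have h2 := hAC t
      have h3 := hDC t
      refine (norm_add_le _ _).trans (add_le_add ?_ ?_)
      · refine (abs_inner_matMul_le _ _ _).trans ?_
        gcongr
      · refine (abs_inner_matMul_le _ _ _).trans ?_
        gcongr
    · have hz' := hz t (not_le.1 htT)
      have h0 : ∀ z : L2, matMul (0 : BoundedContinuousFunction E3 (E3 →L[ℝ] E3)) z = 0 :=
        fun z => by
        rw [← sub_self (0 : BoundedContinuousFunction E3 (E3 →L[ℝ] E3)), matMul_sub, sub_self]
      rw [indicator_of_notMem fun hm => htT hm.2, hz'.1, hz'.2, h0, h0]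
      simp
  · filter_upwards [ae_restrict_mem measurableSet_Ioi] with t ht
    have h1 : Tendsto (fun k => ((W k t : L2sigma) : L2)) atTop (𝓝 (u t : L2)) :=
      (hcoe.tendsto _).comp (hu t (le_of_lt ht))
    exact (h1.inner tendsto_const_nhds).add
      (h1.inner (((matMul (D t)).continuous.tendsto _).comp h1))

end Fluid

namespace Fluid

/-! ### The generic data -/

/-- Weakly continuous weak solutions whose energy never exceeds the initial energy. -/
structure IsAdmissible (ν : ℝ) (u₀ : L2sigma) (u : ℝ → L2sigma) : Prop where
  weaklyContinuous : WeaklyContinuous u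
  initial : u 0 = u₀
  weakForm : WeakForm ν u₀ u
  norm_le : ∀ t, 0 ≤ t → ‖u t‖ ≤ ‖u₀‖

theorem EulerFlow.isAdmissible {w₀ : L2sigma} {W : ℝ → L2sigma} (h : EulerFlow w₀ W) :
    IsAdmissible 0 w₀ W :=
  ⟨h.weaklyContinuous, h.initial, h.weakForm, fun _ ht => (h.norm_eq ht).le⟩

theorem isAdmissible_of_mem_lerayHopf {ν : ℝ} {u₀ : L2sigma} {u : ℝ → L2sigma}
    (h : u ∈ lerayHopf ν u₀) : IsAdmissible ν u₀ u := by
  refine ⟨h.1.weaklyContinuous, h.1.initial, h.1.weakForm, fun t ht => ?_⟩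
  obtain rfl | ht := ht.eq_or_lt
  · rw [h.1.initial]
  have h1 : 2⁻¹ * ‖u t‖ₑ ^ 2 ≤ 2⁻¹ * ‖u₀‖ₑ ^ 2 := le_self_add.trans (h.2 t ht)
  rw [ENNReal.mul_le_mul_iff_right (by simp) (by simp)] at h1
  have h2 : ‖u t‖ₑ ≤ ‖u₀‖ₑ := le_of_not_gt fun hlt => h1.not_gt
    (ENNReal.pow_lt_pow_left two_ne_zero hlt)
  rwa [enorm_le_iff_norm_le] at h2

/-- `W` attracts up to `ε`, on the time interval `[0, T]`, all admissible solutions with data at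
distance less than `ρ` of `w₀` and viscosity at most `ρ`. -/
def Attracts (w₀ : L2sigma) (W : ℝ → L2sigma) (T ε ρ : ℝ) : Prop :=
  ∀ (u₀ : L2sigma), ‖u₀ - w₀‖ < ρ → ∀ ν : ℝ, 0 ≤ ν → ν ≤ ρ → ∀ u, IsAdmissible ν u₀ u →
    ∀ t ∈ Icc 0 T, ‖u t - W t‖ ≤ ε

/-- Stability on `[0, T]`: the bound of `EulerFlow.norm_sq_sub_le` tends to zero with `ρ`. -/
theorem EulerFlow.exists_attracts {w₀ : L2sigma} {W : ℝ → L2sigma} (h : EulerFlow w₀ W) {T ε : ℝ}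
    (hT : 0 < T) (hε : 0 < ε) : ∃ ρ : ℝ, 0 < ρ ∧ ρ < ε ∧ Attracts w₀ W T ε ρ := by
  obtain ⟨L, K, hL, hreg⟩ := h.regular T hT
  -- `0 ≤ K` follows only at a time of regularity, hence the maximum
  have hreg' : ∀ᵐ t ∂volume.restrict (Ioi (0 : ℝ)), t ≤ T → Regular L (max K 0) (W t) := by
    filter_upwards [hreg] with t ht htT
    rw [max_eq_left (ht htT).nonneg]
    exact ht htT
  have hK : 0 ≤ max K 0 := le_max_right _ _
  set f : ℝ → ℝ := fun ρ => 2 * (ρ ^ 2 + 2 * ρ * max K 0 * T * (‖w₀‖ + ρ)) * Real.exp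
    (4 * L * T) with hf
  have hfc : Continuous f := by fun_prop
  have hf0 : f 0 < ε ^ 2 := by
    simp only [hf]
    norm_num
    positivity
  have hev : ∀ᶠ ρ in 𝓝[>] (0 : ℝ), f ρ < ε ^ 2 ∧ ρ < ε ∧ 0 < ρ := by
    filter_upwards [mem_nhdsWithin_of_mem_nhds ((hfc.tendsto 0).eventually (gt_mem_nhds hf0)),
      mem_nhdsWithin_of_mem_nhds (gt_mem_nhds hε), self_mem_nhdsWithin] with ρ h1 h2 h3
    exact ⟨h1, h2, h3⟩
  obtain ⟨ρ, hρ1, hρ2, hρ3⟩ := hev.exists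
  refine ⟨ρ, hρ3, hρ2, fun u₀ hu₀ ν hν hνρ u hu t ht => ?_⟩
  suffices hsq : ‖u t - W t‖ ^ 2 ≤ ε ^ 2 from (abs_le_of_sq_le_sq' hsq hε.le).2
  refine (h.norm_sq_sub_le hν hu.weakForm hu.weaklyContinuous hu.initial hu.norm_le hL hreg' hK
    ht).trans (le_trans ?_ hρ1.le)
  have h1 : ‖u₀‖ ≤ ‖w₀‖ + ρ := by
    have := norm_sub_norm_le u₀ w₀
    linarith
  simp only [hf]
  gcongr

/-- A datum whose neighbourhoods contain data of attracting Sobolev solutions at every scale. -/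
def IsGeneric (u₀ : L2sigma) : Prop :=
  ∀ m : ℕ, ∃ (w₀ : L2sigma) (W : ℝ → L2sigma) (ρ : ℝ), EulerFlow w₀ W ∧ 0 < ρ ∧
    ρ < ((m : ℝ) + 1)⁻¹ ∧ Attracts w₀ W (m + 1) ((m : ℝ) + 1)⁻¹ ρ ∧ ‖u₀ - w₀‖ < ρ

/-- For each scale `m`, the union of the balls around the points of `S` within which the flow
attracts at that scale is open and dense. -/
theorem eventually_isGeneric {S : Set L2sigma} (hS : Dense S)
    (hflow : ∀ w ∈ S, ∃ W, EulerFlow w W) :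
    ∀ᶠ u₀ in residual L2sigma, IsGeneric u₀ := by
  refine eventually_countable_forall.2 fun m => ?_
  have hm : (0 : ℝ) < ((m : ℝ) + 1)⁻¹ := by positivity
  have hex : ∀ w ∈ S, ∃ ρ : ℝ, 0 < ρ ∧ ∀ u₀ ∈ Metric.ball w ρ,
    ∃ (w₀ : L2sigma) (W : ℝ → L2sigma) (ρ : ℝ),
      EulerFlow w₀ W ∧ 0 < ρ ∧ ρ < ((m : ℝ) + 1)⁻¹ ∧ Attracts w₀ W (m + 1) ((m : ℝ) + 1)⁻¹ ρ ∧
        ‖u₀ - w₀‖ < ρ := fun w hw => by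
    obtain ⟨W, hW⟩ := hflow w hw
    obtain ⟨ρ, h1, h2, h3⟩ := hW.exists_attracts (T := m + 1) (by positivity) hm
    refine ⟨ρ, h1, fun u₀ hu₀ => ⟨w, W, ρ, hW, h1, h2, h3, ?_⟩⟩
    rwa [← dist_eq_norm]
  choose! ρ hρ hball using hex
  refine mem_of_superset (residual_of_dense_open (s := ⋃ w ∈ S, Metric.ball w (ρ w)) ?_ ?_) ?_
  · exact isOpen_biUnion fun w _ => Metric.isOpen_ball
  · exact hS.mono fun w hw => mem_biUnion hw (Metric.mem_ball_self (hρ w hw))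
  · intro u₀ hu₀
    obtain ⟨w, hw, h⟩ := mem_iUnion₂.1 hu₀
    exact hball w hw u₀ h

/-- For a generic datum there is an Euler solution that attracts all admissible solutions with the
same datum as the viscosity tends to zero. It is the limit of the attracting flows `W m`, which form
a Cauchy sequence because each of them attracts the later ones: these are themselves admissible,
with viscosity zero. -/
theorem IsGeneric.exists_limit {u₀ : L2sigma} (h : IsGeneric u₀) : ∃ u : ℝ → L2sigma,
    IsWeakEulerSolution u₀ u ∧ (∀ t, 0 ≤ t → ‖u t‖ = ‖u₀‖) ∧
      ∀ T ε : ℝ, 0 < ε → ∀ᶠ ν in 𝓝[>] (0 : ℝ), ∀ v, IsAdmissible ν u₀ v →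
        ∀ t ∈ Icc 0 T, ‖v t - u t‖ ≤ ε := by
  choose w W ρ hW hρ hρm hatt hdist using h
  have hinv : Tendsto (fun m : ℕ => ((m : ℝ) + 1)⁻¹) atTop (𝓝 0) := by
    simpa using tendsto_one_div_add_atTop_nhds_zero_nat (𝕜 := ℝ)
  have hw : Tendsto w atTop (𝓝 u₀) := by
    rw [tendsto_iff_norm_sub_tendsto_zero]
    refine squeeze_zero (fun m => norm_nonneg _) (fun m => ?_) hinv
    rw [norm_sub_rev]
    exact ((hdist m).trans (hρm m)).le
  have hclose : ∀ m : ℕ, ∀ᶠ k in atTop, ∀ t ∈ Icc 0 ((m : ℝ) + 1), ‖W k t - W m t‖ ≤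
    ((m : ℝ) + 1)⁻¹ := fun m => by
    have h1 : ∀ᶠ k in atTop, ‖w k - w m‖ < ρ m :=
      (hw.sub_const (w m)).norm.eventually (gt_mem_nhds (hdist m))
    filter_upwards [h1] with k hk
    exact hatt m (w k) hk 0 le_rfl (hρ m).le (W k) (hW k).isAdmissible
  -- the large indices, for a given time interval and accuracy
  have hm : ∀ T ε : ℝ, 0 < ε → ∀ᶠ m : ℕ in atTop, T ≤ (m : ℝ) + 1 ∧ ((m : ℝ) + 1)⁻¹ < ε :=
    fun T ε hε => by
    filter_upwards [eventually_ge_atTop ⌈T⌉₊, hinv.eventually (gt_mem_nhds hε)] with m h1 h2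
    refine ⟨?_, h2⟩
    have := Nat.ceil_le.1 h1
    linarith
  set u : ℝ → L2sigma := fun t => limUnder atTop fun m => W m t with hu
  have hlim : ∀ t, 0 ≤ t → Tendsto (fun m => W m t) atTop (𝓝 (u t)) := fun t ht => by
    refine CauchySeq.tendsto_limUnder (Metric.cauchySeq_iff'.2 fun ε hε => ?_)
    obtain ⟨m, hmT, hmε⟩ := (hm t (ε / 2) (half_pos hε)).exists
    obtain ⟨N, hN⟩ := eventually_atTop.1 (hclose m)
    refine ⟨N, fun k hk => ?_⟩
    have h1 := hN k hk t ⟨ht, hmT⟩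
    have h2 := hN N le_rfl t ⟨ht, hmT⟩
    rw [← dist_eq_norm] at h1 h2
    have := dist_triangle_right (W k t) (W N t) (W m t)
    linarith
  have hle : ∀ m : ℕ, ∀ t ∈ Icc 0 ((m : ℝ) + 1), ‖u t - W m t‖ ≤ ((m : ℝ) + 1)⁻¹ := fun m t ht =>
    le_of_tendsto ((hlim t ht.1).sub_const (W m t)).norm ((hclose m).mono fun k hk => hk t ht)
  have hnorm : ∀ t, 0 ≤ t → ‖u t‖ = ‖u₀‖ := fun t ht => by
    refine tendsto_nhds_unique (hlim t ht).norm (hw.norm.congr fun k => ?_)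
    exact ((hW k).norm_eq ht).symm
  have hcont : ContinuousOn u (Ici 0) := by
    intro t ht
    have ht0 : 0 ≤ t := ht
    have hunif : TendstoUniformlyOn W u atTop (Icc 0 (t + 1)) := by
      rw [Metric.tendstoUniformlyOn_iff]
      intro ε hε
      filter_upwards [hm (t + 1) ε hε] with m hmε r hr
      rw [dist_eq_norm]
      exact (hle m r ⟨hr.1, hr.2.trans hmε.1⟩).trans_lt hmε.2
    have h1 := hunif.continuousOn
      (Frequently.of_forall fun k => (hW k).continuousOn.mono Icc_subset_Ici_self)
    refine (h1 t ⟨ht0, by linarith⟩).mono_of_mem_nhdsWithin ?_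
    exact inter_mem self_mem_nhdsWithin (mem_nhdsWithin_of_mem_nhds (Iic_mem_nhds (by linarith)))
  obtain ⟨M, hM⟩ := hw.norm.bddAbove_range
  refine ⟨u, ⟨fun z => continuousOn_const.inner hcont, ?_, ?_⟩, hnorm, fun T ε hε => ?_⟩
  · refine tendsto_nhds_unique (hlim 0 le_rfl) (hw.congr fun k => ?_)
    exact (hW k).initial.symm
  · refine WeakForm.of_tendsto (fun k => (hW k).weakForm) (fun k => (hW k).continuousOn) (M := M)
      (fun k t ht => ?_) hw hlim
    rw [(hW k).norm_eq ht]
    exact hM ⟨k, rfl⟩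
  · obtain ⟨m, hmT, hmε⟩ := (hm T (ε / 2) (half_pos hε)).exists
    filter_upwards [Ioc_mem_nhdsGT (hρ m)] with ν hν v hv t ht
    have ht' : t ∈ Icc 0 ((m : ℝ) + 1) := ⟨ht.1, ht.2.trans hmT⟩
    have h1 := hatt m u₀ (hdist m) ν hν.1.le hν.2 v hv t ht'
    have h2 := hle m t ht'
    rw [← dist_eq_norm] at h1 h2 ⊢
    have := dist_triangle_right (v t) (u t) (W m t)
    linarith

/-! ### Absence of anomalous dissipation -/

/-- A supremum over Leray–Hopf solutions vanishes in the inviscid limit if the quantity is of order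
`ε` as soon as the solutions are `ε`-close to the limit. -/
theorem liminf_iSup_lerayHopf_eq_zero {u₀ : L2sigma} {Q : ℝ → (ℝ → L2sigma) → ℝ≥0∞} {C : ℝ}
    (hC : 0 ≤ C)
    (h : ∀ ε : ℝ, 0 < ε → ∀ᶠ ν in 𝓝[>] (0 : ℝ), ∀ v ∈ lerayHopf ν u₀, Q ν v ≤
      ENNReal.ofReal (C * ε)) :
    liminf (fun ν : ℝ => ⨆ v ∈ lerayHopf ν u₀, Q ν v) (𝓝[>] 0) = 0 := by
  refine Tendsto.liminf_eq (ENNReal.tendsto_nhds_zero.2 fun η hη => ?_)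
  obtain ⟨δ, hδ, hδη⟩ : ∃ δ : ℝ, 0 < δ ∧ ENNReal.ofReal δ ≤ η := by
    by_cases hη' : η = ⊤
    · exact ⟨1, one_pos, hη' ▸ le_top⟩
    · exact ⟨η.toReal, ENNReal.toReal_pos hη.ne' hη', ENNReal.ofReal_toReal_le⟩
  have hC1 : 0 < C + 1 := by linarith
  filter_upwards [h (δ / (C + 1)) (by positivity)] with ν hν
  refine iSup₂_le fun v hv => (hν v hv).trans ((ENNReal.ofReal_le_ofReal ?_).trans hδη)
  rw [mul_div_assoc', div_le_iff₀ hC1]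
  nlinarith

theorem norm_sq_sub_norm_sq_le {H : Type*} [NormedAddCommGroup H] {x y z : H} {ε : ℝ}
    (hx : ‖x‖ ≤ ‖z‖) (hy : ‖y‖ = ‖z‖) (h : ‖x - y‖ ≤ ε) : ‖z‖ ^ 2 - ‖x‖ ^ 2 ≤ 2 * ‖z‖ * ε := by
  have h1 := norm_sub_norm_le y x
  rw [norm_sub_rev, hy] at h1
  nlinarith [norm_nonneg x, norm_nonneg z]

/-- The energy inequality bounds the dissipation by the loss of kinetic energy. -/
theorem dissipation_le {ν : ℝ} {u₀ : L2sigma} {v : ℝ → L2sigma} (h : v ∈ lerayHopf ν u₀) {t : ℝ}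
    (ht : 0 < t) : ENNReal.ofReal ν * ∫⁻ τ in Ioo 0 t, gradSq (v τ) ≤
      ENNReal.ofReal (2⁻¹ * (‖u₀‖ ^ 2 - ‖v t‖ ^ 2)) := by
  have h1 := h.2 t ht
  have e : ∀ z : L2sigma, 2⁻¹ * ‖z‖ₑ ^ 2 = ENNReal.ofReal (2⁻¹ * ‖z‖ ^ 2) := fun z => by
    rw [ENNReal.ofReal_mul (by norm_num), ENNReal.ofReal_pow (norm_nonneg _), ofReal_norm,
      ENNReal.ofReal_inv_of_pos two_pos, ENNReal.ofReal_ofNat]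
  rw [e, e] at h1
  rw [mul_sub, ENNReal.ofReal_sub _ (by positivity)]
  exact ENNReal.le_sub_of_add_le_left ENNReal.ofReal_ne_top h1

theorem IsGeneric.noAnomalousDissipation {u₀ : L2sigma} (h : IsGeneric u₀) :
    NoAnomalousDissipation u₀ := by
  obtain ⟨u, hu, hnorm, hlim⟩ := h.exists_limit
  have henergy : ∀ T ε : ℝ, 0 < ε → ∀ᶠ ν in 𝓝[>] (0 : ℝ), ∀ v ∈ lerayHopf ν u₀, ∀ t ∈ Icc 0 T,
      ‖u₀‖ ^ 2 - ‖v t‖ ^ 2 ≤ 2 * ‖u₀‖ * ε := fun T ε hε => by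
    filter_upwards [hlim T ε hε] with ν hν v hv t ht
    have hva := isAdmissible_of_mem_lerayHopf hv
    exact norm_sq_sub_norm_sq_le (hva.norm_le t ht.1) (hnorm t ht.1) (hν v hva t ht)
  refine ⟨fun T hT => ?_, fun t ht => ?_, u, hu, ?_, fun T hT => ?_⟩
  · refine liminf_iSup_lerayHopf_eq_zero (C := T * (2 * ‖u₀‖)) (by positivity) fun ε hε => ?_
    filter_upwards [henergy T ε hε] with ν hν v hv
    calc ∫⁻ t in Ioo 0 T, ENNReal.ofReal (‖u₀‖ ^ 2 - ‖v t‖ ^ 2)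
        ≤ ∫⁻ _t in Ioo 0 T, ENNReal.ofReal (2 * ‖u₀‖ * ε) :=
          setLIntegral_mono measurable_const fun t ht =>
            ENNReal.ofReal_le_ofReal (hν v hv t (Ioo_subset_Icc_self ht))
      _ = ENNReal.ofReal (T * (2 * ‖u₀‖) * ε) := by
          rw [setLIntegral_const, Real.volume_Ioo, sub_zero, mul_comm, ← ENNReal.ofReal_mul hT.le]
          congr 1
          ring
  · refine liminf_iSup_lerayHopf_eq_zero (C := ‖u₀‖) (norm_nonneg _) fun ε hε => ?_
    filter_upwards [henergy t ε hε] with ν hν v hv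
    refine (dissipation_le hv ht).trans (ENNReal.ofReal_le_ofReal ?_)
    have := hν v hv t ⟨ht.le, le_rfl⟩
    linarith
  · filter_upwards [ae_restrict_mem measurableSet_Ioi] with t ht using hnorm t (le_of_lt ht)
  · refine liminf_iSup_lerayHopf_eq_zero (C := √T) (Real.sqrt_nonneg _) fun ε hε => ?_
    filter_upwards [hlim T ε hε] with ν hν v hv
    have h1 : ∀ᵐ t ∂volume.restrict (Ioo 0 T), ‖v t - u t‖ ≤ ε := by
      filter_upwards [ae_restrict_mem measurableSet_Ioo] with t ht
      exact hν v (isAdmissible_of_mem_lerayHopf hv) t (Ioo_subset_Icc_self ht)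
    refine (eLpNorm_le_of_ae_bound h1).trans_eq ?_
    rw [Measure.restrict_apply_univ, Real.volume_Ioo, sub_zero, ENNReal.ofReal_rpow_of_pos hT,
      ENNReal.ofReal_mul (Real.sqrt_nonneg _), Real.sqrt_eq_rpow]
    norm_num

end Fluid

end

theorem corollary6p6 (s : ℝ) (hs : 5 / 2 < s)
    (hEuler : ∀ u₀ : Fluid.L2sigma, Fluid.sobolevSq s u₀ < ⊤ →
      ∃ u : ℝ → Fluid.L2sigma, Fluid.IsSobolevEulerSolution s u₀ u) :
    ∀ᶠ u₀ in residual Fluid.L2sigma, Fluid.NoAnomalousDissipation u₀ := by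
  refine (Fluid.eventually_isGeneric (Fluid.dense_sobolev s) fun w hw => ?_).mono
    fun u₀ h => h.noAnomalousDissipation
  obtain ⟨u, hu⟩ := hEuler w hw
  exact hu.exists_eulerFlow hs
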